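/- Let $I=(-1,1)$, $\omega=1+t$, $\omega^{a,b}=(1-t)^a(1+t)^b$, let $\|f\|_w=(\int_I w f^2\,dt)^{1/2}$, $(f,g)_w=\int_I wfg\,dt$ for real functions and a weight $w$ (no subscript: $w=1$), and let all derivatives be weak derivatives on $I$. Let $R>0$, let $l\ge 1$ be an integer, let $\tau\in\mathbb R$, and put $L_lu=(1+t)^{-2}\partial_t\big((1+t)^2\partial_tu\big)-l(l+1)(1+t)^{-2}u$ and $$H^2_{0,\omega,l}(I)=\{u:\ \partial_t^ku\in L^2_{\omega^{2k-2}}(I),\ k=0,1,2,\ u(\pm1)=u'(1)=0\}.$$ Let $\tilde n\in L^\infty(I)$ satisfy, almost everywhere on $I$, either $\tilde n\ge 1+\alpha$ for some $\alpha>0$, or $\delta\le\tilde n\le 1-\beta$ for some $\delta,\beta>0$. In the first case let $$A_\tau(u,v)=\Big(\tfrac1{\tilde n-1}(L_l+\tfrac{R^2}4\tau)u,(L_l+\tfrac{R^2}4\tau)v\Big)_{\omega^2}+\tau^2\big(\tfrac{R^2}4\big)^2(u,v)_{\omega^2},$$ in the second case let $$A_\tau(u,v)=\Big(\tfrac1{1-\tilde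 n}(L_l+\tfrac{R^2}4\tau\tilde n)u,(L_l+\tfrac{R^2}4\tau\tilde n)v\Big)_{\omega^2}+\tau^2\big(\tfrac{R^2}4\big)^2(\tilde nu,v)_{\omega^2},$$ and let $B(u,v)=\tfrac{R^2}4\big((\partial_tu,\partial_tv)_{\omega^2}+l(l+1)(u,v)\big)$. Let $\lambda^1(\tau)\le\lambda^2(\tau)\le\cdots$ be the eigenvalues, repeated according to multiplicity, of the problem: find $\lambda$ and $0\ne u\in H^2_{0,\omega,l}(I)$ with $A_\tau(u,v)=\lambda B(u,v)$ for all $v\in H^2_{0,\omega,l}(I)$; let $u^1,u^2,\dots$ be corresponding eigenfunctions with $B(u^i,u^j)=\delta_{ij}$. Let $\lambda^1_N(\tau)\le\lambda^2_N(\tau)\le\cdots$ be the eigenvalues, repeated according to multiplicity, of the same problem with $H^2_{0,\omega,l}(I)$ replaced by the space $X_N$ of polynomials of degree at most $N$ lying in $H^2_{0,\omega,l}(I)$. For an integer $s\ge2$ let $$H^s_{\omega^{-2,-2},l}(I)=\{u\in H^2_{0,\omega,l}(I)\cap H^2(I):\ \partial_t^ku\in L^2_{\omega^{k-2,k-2}}(I),\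 3\le k\le s\}.$$ Let $m\ge1$ and $s\ge 2$ be integers. Then there is a constant $C>0$, depending only on $R,l,\tau,\tilde n,m,s$ (in particular independent of $N$ and of the choice of the eigenfunctions), such that, if $u^1,\dots,u^m\in H^s_{\omega^{-2,-2},l}(I)$, then for every integer $N\ge\max(m+2,s-1)$ $$|\lambda_N^m(\tau)-\lambda^m(\tau)|\le C\,N^{2(2-s)}\max_{1\le i\le m}\big(\|\partial_t^su^i\|_{\omega^{s-2,s-2}}+\|\partial_t^2u^i\|\big)^2\qquad\text{if } s\le3,$$ $$|\lambda_N^m(\tau)-\lambda^m(\tau)|\le C\,N^{2(2-s)}\max_{1\le i\le m}\|\partial_t^su^i\|_{\omega^{s-2,s-2}}^2\qquad\text{if } s>3.$$ -/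

import Mathlib

open MeasureTheory Set Filter Topology Polynomial
open scoped ContDiff

namespace TEMode

/-- The interval `I = (-1, 1)`. -/
def I : Set ℝ := Ioo (-1) 1

/-- `v` is the weak (distributional) derivative of order `k` of `u` on `I`. -/
def IsWeakDeriv (k : ℕ) (u v : ℝ → ℝ) : Prop :=
  LocallyIntegrableOn u I ∧ LocallyIntegrableOn v I ∧
    ∀ φ : ℝ → ℝ, ContDiff ℝ ∞ φ → HasCompactSupport φ → tsupport φ ⊆ I →
      ∫ t in I, iteratedDeriv k φ t * u t = (-1) ^ k * ∫ t in I, φ t * v t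

open Classical in
/-- The weak derivative `∂_t^k u` on `I` (unique up to null sets; `0` if there is none). -/
noncomputable def weakDeriv (k : ℕ) (u : ℝ → ℝ) : ℝ → ℝ :=
  if h : ∃ v, IsWeakDeriv k u v then h.choose else 0

/-- The Jacobi weight `ω^{a,b}(t) = (1 - t)^a (1 + t)^b`. The weight `ω^j`, where `ω = 1 + t`,
is `jacobi 0 j`. -/
noncomputable def jacobi (a b : ℤ) (t : ℝ) : ℝ := (1 - t) ^ a * (1 + t) ^ b

/-- Membership in the weighted space `L²_w(I)`. -/
def MemL2 (w : ℝ → ℝ) (f : ℝ → ℝ) : Prop :=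
  AEStronglyMeasurable f (volume.restrict I) ∧ IntegrableOn (fun t => w t * f t ^ 2) I

/-- The inner product `(f, g)_w = ∫_I w f g dt`. -/
noncomputable def ip (w : ℝ → ℝ) (f g : ℝ → ℝ) : ℝ := ∫ t in I, w t * f t * g t

/-- The norm `‖f‖_w = (∫_I w f² dt)^{1/2}`. -/
noncomputable def wnorm (w : ℝ → ℝ) (f : ℝ → ℝ) : ℝ := Real.sqrt (ip w f f)

/-- `u` has a weak derivative of order `k` on `I`, and `∂_t^k u ∈ L²_w(I)`. -/
def DerivMemL2 (k : ℕ) (w : ℝ → ℝ) (u : ℝ → ℝ) : Prop :=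
  ∃ v, IsWeakDeriv k u v ∧ MemL2 w v

/-- `f = 0` at the endpoint `a` of `I`: some representative of `f` tends to `0` at `a` from
within `I`. -/
def ZeroAt (f : ℝ → ℝ) (a : ℝ) : Prop :=
  ∃ g : ℝ → ℝ, f =ᵐ[volume.restrict I] g ∧ Tendsto g (𝓝[I] a) (𝓝 0)

/-- The space `H²_{0,ω,l}(I)`: `∂_t^k u ∈ L²_{ω^{2k-2}}(I)` for `k = 0, 1, 2`, and
`u(±1) = u'(1) = 0`. -/
def H20 : Set (ℝ → ℝ) :=
  {u | MemL2 (jacobi 0 (-2)) u ∧ DerivMemL2 1 (jacobi 0 0) u ∧ DerivMemL2 2 (jacobi 0 2) u ∧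
    ZeroAt u (-1) ∧ ZeroAt u 1 ∧ ZeroAt (weakDeriv 1 u) 1}

/-- The Sobolev space `H²(I)`. -/
def H2 : Set (ℝ → ℝ) :=
  {u | MemL2 (fun _ => 1) u ∧ DerivMemL2 1 (fun _ => 1) u ∧ DerivMemL2 2 (fun _ => 1) u}

/-- The space `H^s_{ω^{-2,-2},l}(I)`: the `u ∈ H²_{0,ω,l}(I) ∩ H²(I)` with
`∂_t^k u ∈ L²_{ω^{k-2,k-2}}(I)` for `3 ≤ k ≤ s`. -/
def Hs (s : ℕ) : Set (ℝ → ℝ) :=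
  {u | u ∈ H20 ∧ u ∈ H2 ∧
    ∀ k : ℕ, 3 ≤ k → k ≤ s → DerivMemL2 k (jacobi ((k : ℤ) - 2) ((k : ℤ) - 2)) u}

/-- `X_N`, the polynomials of degree at most `N` in `H²_{0,ω,l}(I)`. -/
def XN (N : ℕ) : Set (ℝ → ℝ) :=
  {f | f ∈ H20 ∧ ∃ p : ℝ[X], p.natDegree ≤ N ∧ f = fun t => p.eval t}

/-- `L_l u = (1+t)^{-2} ∂_t((1+t)² ∂_t u) - l(l+1) (1+t)^{-2} u`, with the product rule carried
out in the first term. -/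
noncomputable def opL (l : ℕ) (u : ℝ → ℝ) (t : ℝ) : ℝ :=
  weakDeriv 2 u t + 2 / (1 + t) * weakDeriv 1 u t - (l * (l + 1) : ℝ) / (1 + t) ^ 2 * u t

/-- The form `A_τ` for an index of refraction `n > 1`:
`(1/(n-1) (L + (R²/4) τ) u, (L + (R²/4) τ) v)_{ω²} + τ² (R²/4)² (u, v)_{ω²}`. -/
noncomputable def formA (R : ℝ) (l : ℕ) (n : ℝ → ℝ) (τ : ℝ) (u v : ℝ → ℝ) : ℝ :=
  ip (jacobi 0 2) (fun t => 1 / (n t - 1) * (opL l u t + R ^ 2 / 4 * τ * u t))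
      (fun t => opL l v t + R ^ 2 / 4 * τ * v t)
    + τ ^ 2 * (R ^ 2 / 4) ^ 2 * ip (jacobi 0 2) u v

/-- The form `Ã_τ` for an index of refraction `n < 1`:
`(1/(1-n) (L + (R²/4) τ n) u, (L + (R²/4) τ n) v)_{ω²} + τ² (R²/4)² (n u, v)_{ω²}`. -/
noncomputable def formA' (R : ℝ) (l : ℕ) (n : ℝ → ℝ) (τ : ℝ) (u v : ℝ → ℝ) : ℝ :=
  ip (jacobi 0 2) (fun t => 1 / (1 - n t) * (opL l u t + R ^ 2 / 4 * τ * n t * u t))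
      (fun t => opL l v t + R ^ 2 / 4 * τ * n t * v t)
    + τ ^ 2 * (R ^ 2 / 4) ^ 2 * ip (jacobi 0 2) (fun t => n t * u t) v

/-- The form `B(u, v) = (R²/4) ((∂_t u, ∂_t v)_{ω²} + l(l+1) (u, v))`. -/
noncomputable def formB (R : ℝ) (l : ℕ) (u v : ℝ → ℝ) : ℝ :=
  R ^ 2 / 4 * (ip (jacobi 0 2) (weakDeriv 1 u) (weakDeriv 1 v)
    + (l * (l + 1) : ℝ) * ip (fun _ => 1) u v)

/-- `u` is an eigenfunction, with eigenvalue `μ`, of: find `u ∈ V`, `u ≠ 0`, with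
`a(u, v) = μ b(u, v)` for all `v ∈ V`. -/
def IsEigenpair (V : Set (ℝ → ℝ)) (a b : (ℝ → ℝ) → (ℝ → ℝ) → ℝ) (μ : ℝ) (u : ℝ → ℝ) : Prop :=
  u ∈ V ∧ ¬ u =ᵐ[volume.restrict I] 0 ∧ ∀ v ∈ V, a u v = μ * b u v

/-- `lam 0 ≤ … ≤ lam (m-1)` are the first `m` eigenvalues, in ascending order and repeated
according to multiplicity, of the problem `a(u, v) = μ b(u, v)` on `V`, and `u 0, …, u (m-1)`
are corresponding `b`-orthonormal eigenfunctions. -/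
structure IsFirstEigenpairs (V : Set (ℝ → ℝ)) (a b : (ℝ → ℝ) → (ℝ → ℝ) → ℝ) (m : ℕ)
    (lam : Fin m → ℝ) (u : Fin m → ℝ → ℝ) : Prop where
  eigenpair : ∀ i, IsEigenpair V a b (lam i) (u i)
  orthonormal : ∀ i j, b (u i) (u j) = if i = j then 1 else 0
  monotone : Monotone lam
  /-- Every further eigenvalue is at least as large. -/
  first : ∀ μ w, IsEigenpair V a b μ w → (∀ i, b (u i) w = 0) → ∀ i, lam i ≤ μ

end TEMode

open TEMode

/-! Both forms `A_τ` are instances of one form `genForm`. It is bounded and coercive on `H20` for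
the norm ‖(1+t)u''‖, and `B` is compact relative to it. The eigenvalues are therefore governed by
Rayleigh quotients, and their Galerkin error is quadratic in the energy error of approximating the
eigenfunctions by polynomials.

Abstract part (`FirstPairs.galerkin_error`). Let P be the `A`-orthogonal projection onto the trial
space, let U = Σ cᵢuᵢ and D = PU − U. Then A(PU,PU) ≤ A(U,U) ≤ λ_m Σcᵢ² and B(PU,PU) ≥ Σcᵢ² +
2B(U,D). The cross term is itself quadratic in the error: B(uᵢ,D) = λᵢ⁻¹A(uᵢ,D) = λᵢ⁻¹A(uᵢ − Puᵢ,D),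
because D is `A`-orthogonal to the trial space. Min-max on the span of the Puᵢ gives λ_N ≤ λ/(1−θ),
with θ of the order of the squared error. If θ is not small, the crude bound λ_N ≤ Λ suffices; Λ
bounds the Rayleigh quotient on m fixed polynomials that lie in every admissible `XN N`, so the
constant does not depend on N.

Energy estimates. Put h = (1+t)u'', g = u', f = u/(1+t). The integrals of 2hg+g², 2gf−f² and hf+g²
vanish, since these are the derivatives of (1+t)u'², u²/(1+t) and uu' and all boundary terms are
zero. Completing squares yields two Hardy inequalities and, for l ≥ 1, the coercivity ‖h‖ ≤
‖(1+t)L_l u‖. For compactness, u'(t) is an integral of h against an L² kernel, so weak convergence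
of h gives pointwise convergence of u' and then of u, and dominated convergence finishes.

Approximation (`exists_XN_approx`). Project u'' in L² onto degree N−2 and integrate twice from 1.
The conditions at 1 hold by construction. The one at −1 holds because p(−1) = ∫(1+t)p'' for such p,
∫(1+t)u'' = 0, and the projection keeps the moment against 1+t when N ≥ 3. The rate comes from the
Legendre polynomials being eigenfunctions of (−1)^j ∂^j(1−t²)^j∂^j with j = s−2, whose eigenvalue at
degree N−1 is at least of order N^{2j}. -/

namespace TEMode

/-! ### Variational eigenvalue problems for positive semidefinite forms -/

section Abstract

variable {V : Type*} [AddCommGroup V] [Module ℝ V]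

/-- A symmetric positive semidefinite bilinear form. -/
structure IsPsd (A : LinearMap.BilinForm ℝ V) : Prop where
  symm : ∀ u v, A u v = A v u
  nonneg : ∀ v, 0 ≤ A v v

namespace IsPsd

variable {A : LinearMap.BilinForm ℝ V}

lemma sq_le (hA : IsPsd A) (u v : V) : A u v ^ 2 ≤ A u u * A v v :=
  LinearMap.BilinForm.apply_sq_le_of_symm A hA.nonneg ⟨fun x y => hA.symm x y⟩ u v

lemma abs_le (hA : IsPsd A) (u v : V) : |A u v| ≤ √(A u u) * √(A v v) := by
  rw [← Real.sqrt_mul (hA.nonneg u), ← Real.sqrt_sq_eq_abs]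
  exact Real.sqrt_le_sqrt (hA.sq_le u v)

lemma add_self (hA : IsPsd A) (u v : V) : A (u + v) (u + v) = A u u + 2 * A u v + A v v := by
  simp only [map_add, LinearMap.add_apply, hA.symm v u]; ring

lemma sub_self (hA : IsPsd A) (u v : V) : A (u - v) (u - v) = A u u - 2 * A u v + A v v := by
  simp only [map_sub, LinearMap.sub_apply, hA.symm v u]; ring

/-- The right side minus the left side is A(2v−u, 2v−u). -/
lemma apply_le (hA : IsPsd A) (u v : V) : A u u ≤ 2 * A v v + 2 * A (v - u) (v - u) := by
  have h := hA.nonneg (v + (v - u))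
  rw [hA.add_self] at h
  have h2 := hA.nonneg (2 • v - u)
  rw [hA.sub_self] at h2 ⊢
  simp only [map_nsmul, LinearMap.smul_apply, nsmul_eq_mul, Nat.cast_ofNat] at h2
  nlinarith [hA.symm u v]

/-- Cauchy–Schwarz, in the form used for orthogonality to pass to the limit. -/
lemma eq_zero_of_tendsto (hA : IsPsd A) {x : ℕ → V} {y z : V} (hx : ∀ n, A z (x n) = 0)
    (h : Tendsto (fun n => A (x n - y) (x n - y)) atTop (𝓝 0)) : A z y = 0 := by
  have h1 : Tendsto (fun n => A z z * A (x n - y) (x n - y)) atTop (𝓝 0) := by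
    simpa using h.const_mul (A z z)
  have h2 : ∀ n, A z y ^ 2 ≤ A z z * A (x n - y) (x n - y) := by
    intro n
    have := hA.sq_le z (x n - y)
    rw [map_sub, hx n] at this
    simpa using this
  have h3 := ge_of_tendsto' h1 h2
  exact pow_eq_zero_iff (two_ne_zero) |>.1 (le_antisymm h3 (sq_nonneg _))

end IsPsd

variable (A B : LinearMap.BilinForm ℝ V)

/-- `W` is complete for the seminorm of `A`. -/
def IsCompleteFor (W : Submodule ℝ V) : Prop :=
  ∀ x : ℕ → V, (∀ n, x n ∈ W) →
    (∀ ε > 0, ∃ N, ∀ i ≥ N, ∀ j ≥ N, A (x i - x j) (x i - x j) < ε) →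
    ∃ y ∈ W, Tendsto (fun n => A (x n - y) (x n - y)) atTop (𝓝 0)

/-- `A`-bounded sequences have `B`-Cauchy subsequences. -/
def IsCompactFor : Prop :=
  ∀ x : ℕ → V, (∃ M, ∀ n, A (x n) (x n) ≤ M) →
    ∃ φ : ℕ → ℕ, StrictMono φ ∧
      ∀ ε > 0, ∃ N, ∀ i ≥ N, ∀ j ≥ N, B (x (φ i) - x (φ j)) (x (φ i) - x (φ j)) < ε

/-- The first `m` eigenvalues, with orthonormal eigenvectors, of `A(u, v) = λ B(u, v)` on `W`. -/
structure FirstPairs (W : Submodule ℝ V) {m : ℕ} (lam : Fin m → ℝ) (u : Fin m → V) : Prop where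
  mem : ∀ i, u i ∈ W
  eig : ∀ i, ∀ v ∈ W, A (u i) v = lam i * B (u i) v
  orthonormal : ∀ i j, B (u i) (u j) = if i = j then 1 else 0
  monotone : Monotone lam
  -- Being nonzero is expressed through `B`, because `V` will consist of functions rather than
  -- classes and `B` vanishes on those that are zero almost everywhere.
  first : ∀ μ, ∀ w ∈ W, B w w ≠ 0 → (∀ v ∈ W, A w v = μ * B w v) →
    (∀ i, B (u i) w = 0) → ∀ i, lam i ≤ μ

variable {A B} {K : ℝ}

/-- The Rayleigh quotient attains its minimum. -/
lemma exists_rayleigh_min (hA : IsPsd A) (hB : IsPsd B) (hBA : ∀ v, B v v ≤ K * A v v)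
    (hc : IsCompactFor A B) {S : Submodule ℝ V} (hS : IsCompleteFor A S)
    {w₀ : V} (hw₀ : w₀ ∈ S) (hBw₀ : B w₀ w₀ ≠ 0) :
    ∃ μ : ℝ, ∃ y ∈ S, 0 < B y y ∧ A y y = μ * B y y ∧ ∀ v ∈ S, μ * B v v ≤ A v v := by
  classical
  set T : Set ℝ := {r | ∃ v ∈ S, 0 < B v v ∧ r = A v v / B v v} with hT
  have hTne : T.Nonempty :=
    ⟨_, w₀, hw₀, lt_of_le_of_ne (hB.nonneg _) (Ne.symm hBw₀), rfl⟩
  have hTbd : BddBelow T := ⟨0, by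
    rintro r ⟨v, -, hv, rfl⟩
    exact div_nonneg (hA.nonneg v) hv.le⟩
  set μ := sInf T with hμ
  have hμ0 : 0 ≤ μ := le_csInf hTne (by
    rintro r ⟨v, -, hv, rfl⟩
    exact div_nonneg (hA.nonneg v) hv.le)
  have hmin : ∀ v ∈ S, μ * B v v ≤ A v v := by
    intro v hv
    rcases (hB.nonneg v).eq_or_lt with h | h
    · rw [← h, mul_zero]; exact hA.nonneg v
    · have : μ ≤ A v v / B v v := csInf_le hTbd ⟨v, hv, h, rfl⟩
      rwa [le_div_iff₀ h] at this
  have hseq : ∀ n : ℕ, ∃ v ∈ S, B v v = 1 ∧ A v v < μ + 1 / ((n : ℝ) + 1) := by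
    intro n
    obtain ⟨r, ⟨v, hv, hBv, rfl⟩, hr⟩ := exists_lt_of_csInf_lt hTne
      (show sInf T < μ + 1 / ((n : ℝ) + 1) from lt_add_of_pos_right _ Nat.one_div_pos_of_nat)
    have hs : 0 < √(B v v) := Real.sqrt_pos.2 hBv
    have hss : (√(B v v))⁻¹ * (√(B v v))⁻¹ = (B v v)⁻¹ := by
      rw [← mul_inv, Real.mul_self_sqrt hBv.le]
    refine ⟨(√(B v v))⁻¹ • v, S.smul_mem _ hv, ?_, ?_⟩
    · simp only [map_smul, LinearMap.smul_apply, smul_eq_mul]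
      rw [← mul_assoc, hss, inv_mul_cancel₀ hBv.ne']
    · simp only [map_smul, LinearMap.smul_apply, smul_eq_mul]
      rw [← mul_assoc, hss, inv_mul_eq_div]; exact hr
  choose x hxS hxB hxA using hseq
  obtain ⟨φ, hφ, hcau⟩ := hc x ⟨μ + 1, fun n => (hxA n).le.trans (by
    have : 1 / ((n : ℝ) + 1) ≤ 1 := by
      rw [div_le_one (by positivity)]; linarith [Nat.cast_nonneg (α := ℝ) n]
    linarith)⟩
  have hlim : Tendsto (fun n => A (x (φ n)) (x (φ n))) atTop (𝓝 μ) := by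
    have h1 : Tendsto (fun n : ℕ => μ + 1 / ((n : ℝ) + 1)) atTop (𝓝 μ) := by
      simpa using (tendsto_one_div_add_atTop_nhds_zero_nat (𝕜 := ℝ)).const_add μ
    refine tendsto_of_tendsto_of_tendsto_of_le_of_le tendsto_const_nhds
      (h1.comp hφ.tendsto_atTop) (fun n => ?_) (fun n => (hxA _).le)
    have := hmin _ (hxS (φ n))
    rwa [hxB, mul_one] at this
  -- By the parallelogram law and A ≥ μB at xᵢ+xⱼ, A(xᵢ−xⱼ) ≤ 2(A xᵢ−μ) + 2(A xⱼ−μ) + μB(xᵢ−xⱼ). The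
  -- first two terms are small for a minimizing sequence, the last one by compactness.
  have hCauchy : ∀ ε > 0, ∃ N, ∀ i ≥ N, ∀ j ≥ N,
      A (x (φ i) - x (φ j)) (x (φ i) - x (φ j)) < ε := by
    intro ε hε
    obtain ⟨N₁, hN₁⟩ := hcau (ε / (2 * (μ + 1))) (by positivity)
    obtain ⟨N₂, hN₂⟩ := (hlim.eventually (gt_mem_nhds (show μ < μ + ε / 8 by linarith))).exists_forall_of_atTop
    refine ⟨max N₁ N₂, fun i hi j hj => ?_⟩
    have hb := hN₁ i (le_of_max_le_left hi) j (le_of_max_le_left hj)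
    have hi' := hN₂ i (le_of_max_le_right hi)
    have hj' := hN₂ j (le_of_max_le_right hj)
    have hm := hmin _ (S.add_mem (hxS (φ i)) (hxS (φ j)))
    rw [hA.add_self, hB.add_self, hxB, hxB] at hm
    have hb0 := hB.nonneg (x (φ i) - x (φ j))
    rw [hB.sub_self, hxB, hxB] at hb hb0
    rw [hA.sub_self]
    have hb' : μ * (1 - 2 * B (x (φ i)) (x (φ j)) + 1) ≤ ε / 2 := by
      have h3 : (μ + 1) * (1 - 2 * B (x (φ i)) (x (φ j)) + 1) ≤ (μ + 1) * (ε / (2 * (μ + 1))) :=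
        mul_le_mul_of_nonneg_left hb.le (by linarith)
      have h4 : (μ + 1) * (ε / (2 * (μ + 1))) = ε / 2 := by field_simp
      nlinarith
    nlinarith
  obtain ⟨y, hyS, hy⟩ := hS (fun n => x (φ n)) (fun n => hxS _) hCauchy
  have hyB : Tendsto (fun n => B (x (φ n) - y) (x (φ n) - y)) atTop (𝓝 0) := by
    refine squeeze_zero (fun n => hB.nonneg _) (fun n => hBA _) ?_
    simpa using hy.const_mul K
  refine ⟨μ, y, hyS, ?_, ?_, hmin⟩
  -- Only positivity of B(y,y) is needed, so 1 ≤ 2B(y,y) + 2B(xₙ−y,xₙ−y) suffices in place of the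
  -- exact value of the limit.
  · have h1 : Tendsto (fun n => 2 * B y y + 2 * B (x (φ n) - y) (x (φ n) - y)) atTop
        (𝓝 (2 * B y y + 2 * 0)) := (hyB.const_mul 2).const_add _
    have h2 : 1 ≤ 2 * B y y + 2 * 0 := by
      refine ge_of_tendsto' h1 (fun n => ?_)
      have := hB.apply_le (x (φ n)) y
      rw [hxB, ← neg_sub (x (φ n)) y, map_neg, map_neg, LinearMap.neg_apply, neg_neg] at this
      exact this
    linarith
  · have h1 : Tendsto (fun n => 2 * (A (x (φ n)) (x (φ n)) - μ) +
        2 * A (x (φ n) - y) (x (φ n) - y)) atTop (𝓝 (2 * (μ - μ) + 2 * 0)) :=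
      ((hlim.sub_const μ).const_mul 2).add (hy.const_mul 2)
    have h2 : A y y - μ * B y y ≤ 2 * (μ - μ) + 2 * 0 := by
      refine ge_of_tendsto' h1 (fun n => ?_)
      -- With Q = A − μB ≥ 0 on S, the inequality Q(2xₙ−y) ≥ 0 reads Q(y) ≤ 2Q(xₙ) + 2Q(xₙ−y), and
      -- Q(xₙ−y) ≤ A(xₙ−y). Both terms tend to zero.
      have h3 := hmin _ (S.sub_mem (S.smul_mem 2 (hxS (φ n))) hyS)
      rw [hA.sub_self, hB.sub_self] at h3
      simp only [map_smul, LinearMap.smul_apply, smul_eq_mul, hxB] at h3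
      rw [hA.sub_self]
      have h4 := hB.nonneg (x (φ n) - y)
      rw [hB.sub_self, hxB] at h4
      nlinarith [mul_nonneg hμ0 h4]
    linarith [hmin y hyS]

/-- The lower Rayleigh bound above the first `q` eigenvectors. -/
lemma FirstPairs.rayleigh (hA : IsPsd A) (hB : IsPsd B) (hBA : ∀ v, B v v ≤ K * A v v)
    (hc : IsCompactFor A B) {W : Submodule ℝ V} (hW : IsCompleteFor A W)
    {q : ℕ} {lam : Fin (q + 1) → ℝ} {u : Fin (q + 1) → V} (h : FirstPairs A B W lam u)
    {w : V} (hw : w ∈ W) (hwo : ∀ i : Fin q, B (u i.castSucc) w = 0) :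
    lam (Fin.last q) * B w w ≤ A w w := by
  -- If the bound fails, the minimizer y on the `B`-complement S of the first q eigenvectors has μ <
  -- lam (last q). It turns out to be an eigenvector on all of W that is `B`-orthogonal to every uᵢ,
  -- against `first`.
  by_contra! hlt
  let S : Submodule ℝ V := W ⊓ ⨅ i : Fin q, LinearMap.ker (B (u i.castSucc))
  have hmemS : ∀ v, v ∈ S ↔ v ∈ W ∧ ∀ i : Fin q, B (u i.castSucc) v = 0 := by
    intro v; simp [S, Submodule.mem_iInf]
  have hS : IsCompleteFor A S := by
    intro x hx hcau
    obtain ⟨y, hy, hlim⟩ := hW x (fun n => ((hmemS _).1 (hx n)).1) hcau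
    refine ⟨y, (hmemS y).2 ⟨hy, fun i => ?_⟩, hlim⟩
    refine hB.eq_zero_of_tendsto (fun n => ((hmemS _).1 (hx n)).2 i) ?_
    refine squeeze_zero (fun n => hB.nonneg _) (fun n => hBA _) ?_
    simpa using hlim.const_mul K
  have hBw : B w w ≠ 0 := by
    intro h0
    rw [h0, mul_zero] at hlt
    exact absurd (hA.nonneg w) (not_le.2 hlt)
  obtain ⟨μ, y, hyS, hyB, hyA, hmin⟩ := exists_rayleigh_min hA hB hBA hc hS
    ((hmemS w).2 ⟨hw, hwo⟩) hBw
  have hμ : μ < lam (Fin.last q) := by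
    have h1 := hmin w ((hmemS w).2 ⟨hw, hwo⟩)
    have h2 : 0 < B w w := lt_of_le_of_ne (hB.nonneg _) (Ne.symm hBw)
    exact lt_of_mul_lt_mul_right (h1.trans_lt hlt) h2.le
  obtain ⟨hyW, hyo⟩ := (hmemS y).1 hyS
  have hEL : ∀ v ∈ S, A y v = μ * B y v := by
    intro v hv
    -- The constant term is A(y,y) − μB(y,y) = 0, so nonnegativity for all t forces the linear
    -- coefficient, which is the Euler–Lagrange expression, to vanish.
    have hquad : ∀ t : ℝ, 0 ≤ (A v v - μ * B v v) * (t * t) + (2 * (A y v - μ * B y v)) * t + 0 := by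
      intro t
      have h1 := hmin _ (S.add_mem hyS (S.smul_mem t hv))
      rw [hA.add_self, hB.add_self] at h1
      simp only [map_smul, LinearMap.smul_apply, smul_eq_mul] at h1
      nlinarith
    have := discrim_le_zero hquad
    rw [discrim] at this
    have h0 : (2 * (A y v - μ * B y v)) ^ 2 ≤ 0 := by linarith
    have h1 := pow_eq_zero_iff (two_ne_zero) |>.1 (le_antisymm h0 (sq_nonneg _))
    linarith
  have heig : ∀ v ∈ W, A y v = μ * B y v := by
    intro v hv
    -- The part of v along the first q eigenvectors contributes nothing, since y is orthogonal to
    -- them for `B` and hence, by their eigenvalue equation, for `A`.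
    let p : V := ∑ i : Fin q, B (u i.castSucc) v • u i.castSucc
    have hp : v - p ∈ S := by
      refine (hmemS _).2 ⟨W.sub_mem hv (W.sum_mem fun i _ => W.smul_mem _ (h.mem _)), fun i => ?_⟩
      simp only [p, map_sub, map_sum, map_smul, smul_eq_mul, h.orthonormal]
      simp
    have hAp : A y p = 0 := by
      simp only [p, map_sum, map_smul, smul_eq_mul]
      refine Finset.sum_eq_zero fun i _ => ?_
      rw [hA.symm y, h.eig _ _ hyW, hyo i]; ring
    have hBp : B y p = 0 := by
      simp only [p, map_sum, map_smul, smul_eq_mul]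
      refine Finset.sum_eq_zero fun i _ => ?_
      rw [hB.symm y, hyo i]; ring
    have := hEL _ hp
    rwa [map_sub, map_sub, hAp, hBp, sub_zero, sub_zero] at this
  have hlast : B (u (Fin.last q)) y = 0 := by
    have h1 := h.eig (Fin.last q) y hyW
    have h2 := heig _ (h.mem (Fin.last q))
    rw [hA.symm, h2, hB.symm] at h1
    have h3 : (μ - lam (Fin.last q)) * B (u (Fin.last q)) y = 0 := by linarith
    rcases mul_eq_zero.1 h3 with h4 | h4
    · linarith
    · exact h4
  have := h.first μ y hyW hyB.ne' heig (fun i => Fin.lastCases hlast hyo i) (Fin.last q)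
  linarith

/-- The min-max upper bound. -/
lemma FirstPairs.last_le (hA : IsPsd A) (hB : IsPsd B) (hBA : ∀ v, B v v ≤ K * A v v)
    (hc : IsCompactFor A B) {W : Submodule ℝ V} (hW : IsCompleteFor A W)
    {q : ℕ} {lam : Fin (q + 1) → ℝ} {u : Fin (q + 1) → V} (h : FirstPairs A B W lam u)
    {z : Fin (q + 1) → V} (hz : ∀ i, z i ∈ W) {Λ : ℝ}
    (hz0 : ∀ c : Fin (q + 1) → ℝ, B (∑ i, c i • z i) (∑ i, c i • z i) = 0 → c = 0)
    (hzΛ : ∀ c : Fin (q + 1) → ℝ, A (∑ i, c i • z i) (∑ i, c i • z i) ≤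
      Λ * B (∑ i, c i • z i) (∑ i, c i • z i)) :
    lam (Fin.last q) ≤ Λ := by
  -- q linear constraints on q+1 coefficients: some nontrivial combination of the zᵢ is
  -- `B`-orthogonal to the first q eigenvectors, and `rayleigh` applies to it.
  let f : (Fin (q + 1) → ℝ) →ₗ[ℝ] (Fin q → ℝ) :=
    LinearMap.pi fun i => (B (u i.castSucc)).comp (Fintype.linearCombination ℝ z)
  have hker : LinearMap.ker f ≠ ⊥ := by
    apply LinearMap.ker_ne_bot_of_finrank_lt
    simp
  obtain ⟨c, hc1, hc0⟩ := (Submodule.ne_bot_iff _).1 hker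
  have hfc : ∀ i : Fin q, B (u i.castSucc) (∑ i, c i • z i) = 0 := by
    intro i
    have := congrFun (LinearMap.mem_ker.1 hc1) i
    simpa [f, Fintype.linearCombination_apply] using this
  have h1 := h.rayleigh hA hB hBA hc hW
    (W.sum_mem fun i _ => W.smul_mem (c i) (hz i)) hfc
  have h2 : 0 < B (∑ i, c i • z i) (∑ i, c i • z i) :=
    lt_of_le_of_ne (hB.nonneg _) fun h0 => hc0 (hz0 c h0.symm)
  exact le_of_mul_le_mul_right (h1.trans (hzΛ c)) h2

lemma FirstPairs.sum_B {W : Submodule ℝ V} {m : ℕ} {lam : Fin m → ℝ} {u : Fin m → V}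
    (h : FirstPairs A B W lam u) (c : Fin m → ℝ) :
    B (∑ i, c i • u i) (∑ i, c i • u i) = ∑ i, c i ^ 2 := by
  simp [map_sum, LinearMap.sum_apply, h.orthonormal, sq]

lemma FirstPairs.sum_A {W : Submodule ℝ V} {m : ℕ} {lam : Fin m → ℝ} {u : Fin m → V}
    (h : FirstPairs A B W lam u) (c : Fin m → ℝ) :
    A (∑ i, c i • u i) (∑ i, c i • u i) = ∑ i, lam i * c i ^ 2 := by
  have : ∀ i j, A (u i) (u j) = lam i * if i = j then 1 else 0 := fun i j => by
    rw [h.eig i _ (h.mem j), h.orthonormal]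
  simp only [map_sum, LinearMap.sum_apply, map_smul, LinearMap.smul_apply, this, smul_eq_mul]
  refine Finset.sum_congr rfl fun i _ => ?_
  simp; ring

lemma FirstPairs.sum_A_le {W : Submodule ℝ V} {q : ℕ} {lam : Fin (q + 1) → ℝ}
    {u : Fin (q + 1) → V} (h : FirstPairs A B W lam u) (c : Fin (q + 1) → ℝ) :
    A (∑ i, c i • u i) (∑ i, c i • u i) ≤ lam (Fin.last q) * ∑ i, c i ^ 2 := by
  rw [h.sum_A, Finset.mul_sum]
  exact Finset.sum_le_sum fun i _ =>
    mul_le_mul_of_nonneg_right (h.monotone (Fin.le_last i)) (sq_nonneg _)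

/-! ### Galerkin projection and the eigenvalue error -/

/-- Orthogonal projections onto finite-dimensional subspaces on which `A` is definite. -/
lemma exists_projection (W : Submodule ℝ V) [FiniteDimensional ℝ W]
    (hW : ∀ v ∈ W, A v v = 0 → v = 0) (u : V) : ∃ p ∈ W, ∀ v ∈ W, A (p - u) v = 0 := by
  let f : W →ₗ[ℝ] Module.Dual ℝ W := (LinearMap.lcomp ℝ ℝ W.subtype).comp (LinearMap.comp (A : V →ₗ[ℝ] V →ₗ[ℝ] ℝ) W.subtype)
  have hf : Function.Injective f := by
    rw [← LinearMap.ker_eq_bot, LinearMap.ker_eq_bot']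
    intro v hv
    have := LinearMap.congr_fun hv v
    exact Subtype.ext (hW v v.2 this)
  have hs := (LinearMap.injective_iff_surjective_of_finrank_eq_finrank
    (Subspace.dual_finrank_eq (K := ℝ) (V := W)).symm).1 hf
  obtain ⟨p, hp⟩ := hs (LinearMap.comp (A u) W.subtype)
  refine ⟨p, p.2, fun v hv => ?_⟩
  have := LinearMap.congr_fun hp ⟨v, hv⟩
  rw [map_sub, LinearMap.sub_apply, sub_eq_zero]
  exact this

/-- The limit y found in W need not lie in X, but its projection p does, and A(xₙ−y) = A(p−y) +
A(xₙ−p) shows that p is a limit as well. -/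
lemma IsCompleteFor.of_finiteDimensional (hA : IsPsd A) {W X : Submodule ℝ V} (hXW : X ≤ W)
    (hW : IsCompleteFor A W) [FiniteDimensional ℝ X] (hX : ∀ v ∈ X, A v v = 0 → v = 0) :
    IsCompleteFor A X := by
  intro x hx hcau
  obtain ⟨y, -, hlim⟩ := hW x (fun n => hXW (hx n)) hcau
  obtain ⟨p, hp, hpo⟩ := exists_projection X hX y
  refine ⟨p, hp, squeeze_zero (fun n => hA.nonneg _) (fun n => ?_) hlim⟩
  have h1 : x n - y = (p - y) + (x n - p) := by abel
  rw [h1, hA.add_self, hpo _ (X.sub_mem (hx n) hp)]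
  linarith [hA.nonneg (p - y)]

/-- The Galerkin eigenvalue estimate: the error of the last of the first `q + 1` eigenvalues is
bounded by the square of the `A`-error of approximation of the eigenvectors. -/
theorem FirstPairs.galerkin_error (hA : IsPsd A) (hB : IsPsd B)
    (hBA : ∀ v, B v v ≤ K * A v v) (hK : 0 < K) (hc : IsCompactFor A B)
    {W X : Submodule ℝ V} (hXW : X ≤ W) (hW : IsCompleteFor A W)
    [FiniteDimensional ℝ X] (hX : ∀ v ∈ X, A v v = 0 → v = 0)
    {q : ℕ} {lam lamX : Fin (q + 1) → ℝ} {u uX : Fin (q + 1) → V}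
    (h : FirstPairs A B W lam u) (hx : FirstPairs A B X lamX uX)
    {z : Fin (q + 1) → V} (hz : ∀ i, z i ∈ X) {Λ : ℝ}
    (hz0 : ∀ c : Fin (q + 1) → ℝ, B (∑ i, c i • z i) (∑ i, c i • z i) = 0 → c = 0)
    (hzΛ : ∀ c : Fin (q + 1) → ℝ, A (∑ i, c i • z i) (∑ i, c i • z i) ≤
      Λ * B (∑ i, c i • z i) (∑ i, c i • z i))
    {E : ℝ} (hE : ∀ i, ∃ p ∈ X, A (p - u i) (p - u i) ≤ E) :
    |lamX (Fin.last q) - lam (Fin.last q)| ≤ 4 * Λ * (q + 1) ^ 2 * K * E := by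
  have hXc : IsCompleteFor A X := hW.of_finiteDimensional hA hXW hX
  have hlower : lam (Fin.last q) ≤ lamX (Fin.last q) := by
    refine h.last_le hA hB hBA hc hW (fun i => hXW (hx.mem i)) (fun c hc0 => ?_)
      (fun c => ?_)
    · rw [hx.sum_B] at hc0
      funext i
      have := (Finset.sum_eq_zero_iff_of_nonneg (fun i _ => sq_nonneg (c i))).1 hc0 i
        (Finset.mem_univ i)
      simpa using this
    · rw [hx.sum_B]; exact hx.sum_A_le c
  have hXΛ : lamX (Fin.last q) ≤ Λ := hx.last_le hA hB hBA hc hXc hz hz0 hzΛ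
  -- The eigenvalues are at least 1/K, so the factors λᵢ⁻¹ that appear below are at most K.
  have hlamK : ∀ i, 1 ≤ K * lam i := by
    intro i
    have h1 := hBA (u i)
    rw [h.eig i _ (h.mem i), h.orthonormal, if_pos rfl, mul_one] at h1
    exact h1
  have hlam : ∀ i, 0 < lam i := fun i => by
    by_contra! h0
    nlinarith [hlamK i]
  have hΛ : 0 < Λ := (hlam (Fin.last q)).trans_le (hlower.trans hXΛ)
  choose P hPX hPo using exists_projection (A := A) X hX
  have hPE : ∀ i, A (P (u i) - u i) (P (u i) - u i) ≤ E := by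
    intro i
    obtain ⟨p, hp, hpE⟩ := hE i
    have h1 : p - u i = (P (u i) - u i) + (p - P (u i)) := by abel
    rw [h1, hA.add_self, hPo _ _ (X.sub_mem hp (hPX _))] at hpE
    linarith [hA.nonneg (p - P (u i))]
  have hE0 : 0 ≤ E := (hA.nonneg _).trans (hPE 0)
  rw [abs_of_nonneg (by linarith)]
  set θ : ℝ := 2 * (q + 1) ^ 2 * K * E with hθ
  have hθ0 : 0 ≤ θ := by positivity
  have hgoal : 4 * Λ * (q + 1) ^ 2 * K * E = 2 * Λ * θ := by rw [hθ]; ring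
  rw [hgoal]
  -- For large θ the claimed bound 2Λθ exceeds Λ ≥ lamX, so there is nothing to prove. For θ ≤ 1/2
  -- one may use (1−θ)⁻¹ ≤ 1+2θ.
  by_cases hθ1 : 1 / 2 < θ
  · nlinarith [hlam (Fin.last q)]
  push Not at hθ1
  have hcombo : ∀ c : Fin (q + 1) → ℝ, ∀ S : ℝ, 0 ≤ S → (∀ i, |c i| ≤ S) →
      √(A (∑ i, c i • (P (u i) - u i)) (∑ i, c i • (P (u i) - u i))) ≤ (q + 1) * S * √E := by
    intro c S hS0 hS
    apply Real.sqrt_le_iff.2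
    refine ⟨by positivity, ?_⟩
    simp only [map_sum, LinearMap.sum_apply, map_smul, LinearMap.smul_apply, smul_eq_mul, Finset.mul_sum]
    calc ∑ x, ∑ y, c x * (c y * (A (P (u y) - u y)) (P (u x) - u x))
        ≤ ∑ x : Fin (q + 1), ∑ y : Fin (q + 1), S * S * E := by
          refine Finset.sum_le_sum fun x _ => Finset.sum_le_sum fun y _ => ?_
          refine (le_abs_self _).trans ?_
          rw [abs_mul, abs_mul, ← mul_assoc]
          have h1 : |A (P (u y) - u y) (P (u x) - u x)| ≤ E := by
            refine (hA.abs_le _ _).trans ?_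
            calc _ ≤ √E * √E := mul_le_mul (Real.sqrt_le_sqrt (hPE y)) (Real.sqrt_le_sqrt (hPE x))
                  (Real.sqrt_nonneg _) (Real.sqrt_nonneg _)
              _ = E := Real.mul_self_sqrt hE0
          exact mul_le_mul (mul_le_mul (hS x) (hS y) (abs_nonneg _) hS0) h1 (abs_nonneg _)
            (by positivity)
      _ = ((q + 1) * S * √E) ^ 2 := by
          simp only [Finset.sum_const, Finset.card_univ, Fintype.card_fin, nsmul_eq_mul, mul_pow,
            Real.sq_sqrt hE0]
          push_cast; ring
  have hkey : ∀ c : Fin (q + 1) → ℝ,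
      A (∑ i, c i • P (u i)) (∑ i, c i • P (u i)) ≤ lam (Fin.last q) * ∑ i, c i ^ 2 ∧
      (1 - θ) * ∑ i, c i ^ 2 ≤ B (∑ i, c i • P (u i)) (∑ i, c i • P (u i)) := by
    intro c
    set U := ∑ i, c i • u i with hU
    set PU := ∑ i, c i • P (u i) with hPU
    set D := ∑ i, c i • (P (u i) - u i) with hD
    have hDe : D = PU - U := by
      simp only [hD, hPU, hU, smul_sub, Finset.sum_sub_distrib]
    have hPUX : PU ∈ X := X.sum_mem fun i _ => X.smul_mem _ (hPX _)
    have hDo : ∀ v ∈ X, A D v = 0 := by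
      intro v hv
      simp only [hD, map_sum, LinearMap.sum_apply, map_smul, LinearMap.smul_apply, hPo _ v hv,
        smul_zero, Finset.sum_const_zero]
    constructor
    · have h1 : U = PU - D := by rw [hDe]; abel
      have h2 := h.sum_A_le c
      rw [← hU, h1, hA.sub_self, hA.symm PU D, hDo _ hPUX] at h2
      linarith [hA.nonneg D]
    · have h1 : PU = U + D := by rw [hDe]; abel
      rw [h1, hB.add_self, h.sum_B]
      set σ := ∑ i, c i ^ 2 with hσ
      have hσ0 : 0 ≤ σ := Finset.sum_nonneg fun i _ => sq_nonneg _
      have hci : ∀ i, |c i| ≤ √σ := fun i => by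
        rw [← Real.sqrt_sq_eq_abs]
        exact Real.sqrt_le_sqrt (Finset.single_le_sum (f := fun i => c i ^ 2)
          (fun i _ => sq_nonneg _) (Finset.mem_univ i))
      -- The eigenvalue equation trades B(uᵢ,·) for λᵢ⁻¹A(uᵢ,·), and uᵢ may then be replaced by
      -- uᵢ−Puᵢ because D is `A`-orthogonal to X. The cross term thus becomes a product of two
      -- errors, which gives the doubled rate.
      have hBUD : B U D = - A D (∑ i, (c i * (lam i)⁻¹) • (P (u i) - u i)) := by
        have hDW : D ∈ W := by
          rw [hDe]
          exact W.sub_mem (hXW hPUX) (W.sum_mem fun i _ => W.smul_mem _ (h.mem i))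
        have e1 : B U D = A (∑ i, (c i * (lam i)⁻¹) • u i) D := by
          simp only [hU, map_sum, LinearMap.sum_apply, map_smul, LinearMap.smul_apply, smul_eq_mul]
          refine Finset.sum_congr rfl fun i _ => ?_
          rw [h.eig i _ hDW, mul_assoc, ← mul_assoc (lam i)⁻¹, inv_mul_cancel₀ (hlam i).ne',
            one_mul]
        rw [e1, hA.symm]
        simp only [smul_sub, Finset.sum_sub_distrib, map_sub]
        rw [hDo _ (X.sum_mem fun i _ => X.smul_mem _ (hPX _))]
        ring
      have hbound : |B U D| ≤ (q + 1) ^ 2 * K * E * σ := by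
        rw [hBUD, abs_neg]
        refine (hA.abs_le _ _).trans ?_
        calc _ ≤ ((q + 1) * √σ * √E) * ((q + 1) * (√σ * K) * √E) := by
              refine mul_le_mul (hcombo c _ (Real.sqrt_nonneg _) hci)
                (hcombo _ _ (by positivity) fun i => ?_) (Real.sqrt_nonneg _) (by positivity)
              rw [abs_mul, abs_of_pos (inv_pos.2 (hlam i))]
              refine mul_le_mul (hci i) ?_ (inv_pos.2 (hlam i)).le (Real.sqrt_nonneg _)
              rw [inv_le_iff_one_le_mul₀ (hlam i)]
              linarith [hlamK i]
          _ = (q + 1) ^ 2 * K * (√E * √E) * (√σ * √σ) := by ring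
          _ = _ := by rw [Real.mul_self_sqrt hE0, Real.mul_self_sqrt hσ0]
      have := (abs_le.1 hbound).1
      nlinarith [hB.nonneg D]
  have hupper : lamX (Fin.last q) ≤ lam (Fin.last q) * (1 - θ)⁻¹ := by
    refine hx.last_le hA hB hBA hc hXc (fun i => hPX (u i)) (fun c hc0 => ?_) (fun c => ?_)
    · have h1 := (hkey c).2
      rw [hc0] at h1
      have h2 : ∑ i, c i ^ 2 ≤ 0 := by
        by_contra! h3
        nlinarith
      funext i
      have := (Finset.sum_eq_zero_iff_of_nonneg (fun i _ => sq_nonneg (c i))).1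
        (le_antisymm h2 (Finset.sum_nonneg fun i _ => sq_nonneg _)) i (Finset.mem_univ i)
      simpa using this
    · refine (hkey c).1.trans ?_
      rw [mul_assoc]
      refine mul_le_mul_of_nonneg_left ?_ (hlam _).le
      rw [inv_mul_eq_div, le_div_iff₀ (by linarith), mul_comm]
      exact (hkey c).2
  have hinv : (1 - θ)⁻¹ ≤ 1 + 2 * θ := by
    rw [inv_le_iff_one_le_mul₀ (by linarith)]
    nlinarith
  have h5 : lam (Fin.last q) * (1 - θ)⁻¹ ≤ lam (Fin.last q) * (1 + 2 * θ) :=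
    mul_le_mul_of_nonneg_left hinv (hlam _).le
  have h6 : lam (Fin.last q) * θ ≤ Λ * θ := mul_le_mul_of_nonneg_right (hlower.trans hXΛ) hθ0
  nlinarith

end Abstract

/-! ### Weak derivatives on the interval -/

/-- Lebesgue measure on `I`. -/
noncomputable abbrev volI : Measure ℝ := volume.restrict I

lemma isOpen_I : IsOpen I := isOpen_Ioo

lemma measurableSet_I : MeasurableSet I := measurableSet_Ioo

lemma zero_mem_I : (0 : ℝ) ∈ I := by simp [I]

/-- Smooth functions with compact support in `I`. -/
structure IsTest (φ : ℝ → ℝ) : Prop where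
  smooth : ContDiff ℝ ∞ φ
  compact : HasCompactSupport φ
  subset : tsupport φ ⊆ I

lemma integrable_mul_of_tsupport {φ u : ℝ → ℝ} (hφ : Continuous φ) (hc : HasCompactSupport φ)
    (hs : tsupport φ ⊆ I) (hu : LocallyIntegrableOn u I) :
    Integrable (fun t => φ t * u t) := by
  have h1 : IntegrableOn u (tsupport φ) := hu.integrableOn_compact_subset hs hc
  have h2 : IntegrableOn (fun t => φ t * u t) (tsupport φ) :=
    h1.continuousOn_mul hφ.continuousOn hc
  refine (integrableOn_iff_integrable_of_support_subset ?_).1 h2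
  intro t ht
  refine subset_tsupport φ ?_
  intro h0
  exact ht (by simp [h0])

lemma IsTest.integrable {φ u : ℝ → ℝ} (hφ : IsTest φ) (hu : LocallyIntegrableOn u I) :
    Integrable (fun t => φ t * u t) volI :=
  (integrable_mul_of_tsupport hφ.smooth.continuous hφ.compact hφ.subset hu).restrict

lemma IsTest.deriv {φ : ℝ → ℝ} (hφ : IsTest φ) : IsTest (deriv φ) where
  smooth := (contDiff_infty_iff_deriv.1 hφ.smooth).2
  compact := hφ.compact.deriv
  subset := tsupport_deriv_subset.trans hφ.subset

lemma IsTest.iteratedDeriv {φ : ℝ → ℝ} (hφ : IsTest φ) (k : ℕ) : IsTest (iteratedDeriv k φ) := by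
  induction k with
  | zero => simpa using hφ
  | succ k ih => rw [iteratedDeriv_succ]; exact ih.deriv

lemma IsTest.setIntegral_eq {φ : ℝ → ℝ} (hφ : IsTest φ) (u : ℝ → ℝ) :
    ∫ t in I, φ t * u t = ∫ t, φ t * u t := by
  refine setIntegral_eq_integral_of_forall_compl_eq_zero fun t ht => ?_
  rw [image_eq_zero_of_notMem_tsupport (fun h => ht (hφ.subset h)), zero_mul]

lemma ae_eq_of_forall_test {v w : ℝ → ℝ} (hv : LocallyIntegrableOn v I)
    (hw : LocallyIntegrableOn w I)
    (h : ∀ φ, IsTest φ → ∫ t in I, φ t * v t = ∫ t in I, φ t * w t) : v =ᵐ[volI] w := by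
  have h1 : ∀ᵐ x, x ∈ I → (v - w) x = 0 := by
    refine isOpen_I.ae_eq_zero_of_integral_contDiff_smul_eq_zero (hv.sub hw) fun g hg hc hs => ?_
    have hgt : IsTest g := ⟨hg, hc, hs⟩
    have h2 := hgt.setIntegral_eq (v - w)
    simp only [smul_eq_mul, Pi.sub_apply] at h2 ⊢
    rw [← h2]
    simp only [mul_sub]
    rw [integral_sub (hgt.integrable hv) (hgt.integrable hw), h g hgt, sub_self]
  rw [EventuallyEq, ae_restrict_iff' measurableSet_I]
  filter_upwards [h1] with t ht hI
  exact sub_eq_zero.1 (ht hI)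

namespace IsWeakDeriv

variable {k : ℕ} {u v u' v' w : ℝ → ℝ}

lemma test (h : IsWeakDeriv k u v) {φ : ℝ → ℝ} (hφ : IsTest φ) :
    ∫ t in I, iteratedDeriv k φ t * u t = (-1) ^ k * ∫ t in I, φ t * v t :=
  h.2.2 φ hφ.smooth hφ.compact hφ.subset

lemma unique (h : IsWeakDeriv k u v) (h' : IsWeakDeriv k u w) : v =ᵐ[volI] w := by
  refine ae_eq_of_forall_test h.2.1 h'.2.1 fun φ hφ => ?_
  have := (h.test hφ).symm.trans (h'.test hφ)
  exact mul_left_cancel₀ (pow_ne_zero _ (by norm_num)) this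

lemma congr (h : IsWeakDeriv k u v) (hu : u =ᵐ[volI] u') (hv : v =ᵐ[volI] v') :
    IsWeakDeriv k u' v' := by
  refine ⟨h.1.congr hu, h.2.1.congr hv, fun φ h1 h2 h3 => ?_⟩
  have e1 : ∫ t in I, iteratedDeriv k φ t * u' t = ∫ t in I, iteratedDeriv k φ t * u t :=
    integral_congr_ae (by filter_upwards [hu] with t ht; rw [ht])
  have e2 : ∫ t in I, φ t * v' t = ∫ t in I, φ t * v t :=
    integral_congr_ae (by filter_upwards [hv] with t ht; rw [ht])
  rw [e1, e2, h.2.2 φ h1 h2 h3]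

lemma add (h : IsWeakDeriv k u v) (h' : IsWeakDeriv k u' v') :
    IsWeakDeriv k (u + u') (v + v') := by
  refine ⟨h.1.add h'.1, h.2.1.add h'.2.1, fun φ h1 h2 h3 => ?_⟩
  have hφ : IsTest φ := ⟨h1, h2, h3⟩
  simp only [Pi.add_apply, mul_add]
  rw [integral_add ((hφ.iteratedDeriv k).integrable h.1) ((hφ.iteratedDeriv k).integrable h'.1),
    integral_add (hφ.integrable h.2.1) (hφ.integrable h'.2.1), h.test hφ, h'.test hφ]
  ring

lemma smul (c : ℝ) (h : IsWeakDeriv k u v) : IsWeakDeriv k (c • u) (c • v) := by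
  refine ⟨h.1.smul c, h.2.1.smul c, fun φ h1 h2 h3 => ?_⟩
  have hφ : IsTest φ := ⟨h1, h2, h3⟩
  simp only [Pi.smul_apply, smul_eq_mul, mul_left_comm _ c]
  rw [integral_const_mul, integral_const_mul, h.test hφ]
  ring

lemma sub (h : IsWeakDeriv k u v) (h' : IsWeakDeriv k u' v') :
    IsWeakDeriv k (u - u') (v - v') := by
  have := h.add (h'.smul (-1))
  simpa [sub_eq_add_neg] using this

/-- The weak derivative of order `k + 1` is the weak derivative of the one of order `k`. -/
lemma of_succ (h : IsWeakDeriv k u v) (h' : IsWeakDeriv (k + 1) u w) : IsWeakDeriv 1 v w := by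
  refine ⟨h.2.1, h'.2.1, fun φ h1 h2 h3 => ?_⟩
  have hφ : IsTest φ := ⟨h1, h2, h3⟩
  have e1 := h.test hφ.deriv
  have e2 := h'.test hφ
  rw [iteratedDeriv_succ', e1, pow_succ] at e2
  rw [iteratedDeriv_one, pow_one]
  have : ((-1 : ℝ) ^ k) ≠ 0 := pow_ne_zero _ (by norm_num)
  apply mul_left_cancel₀ this
  rw [e2]; ring

lemma succ (h : IsWeakDeriv k u v) (h' : IsWeakDeriv 1 v w) : IsWeakDeriv (k + 1) u w := by
  refine ⟨h.1, h'.2.1, fun φ h1 h2 h3 => ?_⟩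
  have hφ : IsTest φ := ⟨h1, h2, h3⟩
  have e1 := h.test hφ.deriv
  have e2 := h'.test hφ
  rw [iteratedDeriv_one] at e2
  rw [iteratedDeriv_succ', e1, e2, pow_succ]; ring

lemma weakDeriv_ae (h : IsWeakDeriv k u v) : weakDeriv k u =ᵐ[volI] v := by
  have hex : ∃ v, IsWeakDeriv k u v := ⟨v, h⟩
  rw [weakDeriv, dif_pos hex]
  exact hex.choose_spec.unique h

lemma weakDeriv (h : IsWeakDeriv k u v) : IsWeakDeriv k u (weakDeriv k u) :=
  h.congr (ae_eq_refl u) h.weakDeriv_ae.symm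

end IsWeakDeriv

/-! ### Primitives -/

lemma intervalIntegrable_of_loc {v : ℝ → ℝ} (hv : LocallyIntegrableOn v I) {a b : ℝ} (ha : a ∈ I)
    (hb : b ∈ I) : IntervalIntegrable v volume a b := by
  rw [intervalIntegrable_iff']
  refine hv.integrableOn_compact_subset ?_ isCompact_uIcc
  exact ordConnected_Ioo.uIcc_subset ha hb

/-- Integration by parts for indefinite integrals. -/
lemma integral_by_parts {f g F G : ℝ → ℝ} {a b : ℝ} (hab : a ≤ b)
    (hf : IntervalIntegrable f volume a b) (hg : IntervalIntegrable g volume a b)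
    (hF : ∀ x ∈ Icc a b, F x = F a + ∫ t in a..x, f t)
    (hG : ∀ x ∈ Icc a b, G x = G a + ∫ t in a..x, g t) :
    ∫ t in a..b, (f t * G t + F t * g t) = F b * G b - F a * G a := by
  have hconst : ∀ c : ℝ, AbsolutelyContinuousOnInterval (fun _ : ℝ => c) a b := fun c =>
    (LipschitzOnWith.of_dist_le_mul (K := 0) (by simp)).absolutelyContinuousOnInterval
  have hFa : AbsolutelyContinuousOnInterval (fun x => F a + ∫ t in a..x, f t) a b :=
    (hconst _).add (hf.absolutelyContinuousOnInterval_intervalIntegral (by simp))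
  have hGa : AbsolutelyContinuousOnInterval (fun x => G a + ∫ t in a..x, g t) a b :=
    (hconst _).add (hg.absolutelyContinuousOnInterval_intervalIntegral (by simp))
  have h := AbsolutelyContinuousOnInterval.integral_deriv_mul_eq_sub hFa hGa
  simp only [← hF b ⟨hab, le_rfl⟩, ← hG b ⟨hab, le_rfl⟩, intervalIntegral.integral_same,
    add_zero] at h
  rw [← h]
  refine intervalIntegral.integral_congr_ae ?_
  filter_upwards [hf.ae_hasDerivAt_integral, hg.ae_hasDerivAt_integral] with x h1 h2 hx
  have hx' : x ∈ uIcc a b := uIoc_subset_uIcc hx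
  have e1 := ((h1 hx' a (by simp)).const_add (F a)).deriv
  have e2 := ((h2 hx' a (by simp)).const_add (G a)).deriv
  rw [uIcc_of_le hab] at hx'
  rw [e1, e2, hF x hx', hG x hx']

lemma exists_Icc_of_compact {K : Set ℝ} (hK : IsCompact K) (hs : K ⊆ I) :
    ∃ r : ℝ, 0 < r ∧ r < 1 ∧ K ⊆ Ioo (-r) r := by
  rcases K.eq_empty_or_nonempty with rfl | hne
  · exact ⟨1 / 2, by norm_num, by norm_num, empty_subset _⟩
  obtain ⟨x, hx, hmax⟩ := hK.exists_isMaxOn hne continuous_abs.continuousOn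
  have hx1 : |x| < 1 := abs_lt.2 (hs hx)
  refine ⟨(|x| + 1) / 2, by positivity, by linarith, fun y hy => abs_lt.1 ?_⟩
  have : |y| ≤ |x| := hmax hy
  linarith

lemma IsTest.eq_zero_of_notMem {φ : ℝ → ℝ} {s : Set ℝ} (h : tsupport φ ⊆ s) {x : ℝ}
    (hx : x ∉ s) : φ x = 0 :=
  image_eq_zero_of_notMem_tsupport fun h' => hx (h h')

lemma setIntegral_eq_interval {f : ℝ → ℝ} {r : ℝ} (hr0 : 0 < r) (hr : r < 1)
    (hf : ∀ x ∉ Ioo (-r) r, f x = 0) : ∫ t in I, f t = ∫ t in (-r)..r, f t := by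
  rw [intervalIntegral.integral_of_le (by linarith)]
  rw [setIntegral_eq_integral_of_forall_compl_eq_zero,
    setIntegral_eq_integral_of_forall_compl_eq_zero]
  · intro x hx; exact hf x fun h => hx (Ioo_subset_Ioc_self h)
  · intro x hx; exact hf x fun h => hx ⟨by linarith [h.1], by linarith [h.2]⟩

lemma continuousOn_primitive {v : ℝ → ℝ} (hv : LocallyIntegrableOn v I) (c : ℝ) :
    ContinuousOn (fun t => c + ∫ r in (0 : ℝ)..t, v r) I := by
  intro x hx
  obtain ⟨r, hr0, hr1, hr⟩ := exists_Icc_of_compact (isCompact_singleton (x := x)) (by simpa using hx)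
  have hx' : x ∈ Ioo (-r) r := hr rfl
  have h1 : IntervalIntegrable v volume (-r) r :=
    intervalIntegrable_of_loc hv ⟨by linarith, by linarith⟩ ⟨by linarith, by linarith⟩
  have h2 := (h1.absolutelyContinuousOnInterval_intervalIntegral (c := 0)
    (by rw [uIcc_of_le (by linarith)]; exact ⟨by linarith, by linarith⟩)).continuousOn
  rw [uIcc_of_le (by linarith)] at h2
  exact (continuousAt_const.add (h2.continuousAt (Icc_mem_nhds hx'.1 hx'.2))).continuousWithinAt

/-- An indefinite integral has the integrand as weak derivative. -/
lemma isWeakDeriv_primitive {v : ℝ → ℝ} (hv : LocallyIntegrableOn v I) (c : ℝ) :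
    IsWeakDeriv 1 (fun t => c + ∫ r in (0 : ℝ)..t, v r) v := by
  refine ⟨(continuousOn_primitive hv c).locallyIntegrableOn measurableSet_I, hv,
    fun φ h1 h2 h3 => ?_⟩
  have hφ : IsTest φ := ⟨h1, h2, h3⟩
  obtain ⟨r, hr0, hr1, hr⟩ := exists_Icc_of_compact h2 h3
  have hz : ∀ x ∉ Ioo (-r) r, φ x = 0 := fun x hx => IsTest.eq_zero_of_notMem hr hx
  have hz' : ∀ x ∉ Ioo (-r) r, deriv φ x = 0 := fun x hx =>
    IsTest.eq_zero_of_notMem (tsupport_deriv_subset.trans hr) hx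
  have hmem : ∀ x ∈ Icc (-r) r, x ∈ I := fun x hx => ⟨by linarith [hx.1], by linarith [hx.2]⟩
  rw [iteratedDeriv_one, setIntegral_eq_interval hr0 hr1 (fun x hx => by rw [hz' x hx, zero_mul]),
    setIntegral_eq_interval hr0 hr1 (fun x hx => by rw [hz x hx, zero_mul])]
  have hvi : IntervalIntegrable v volume (-r) r :=
    intervalIntegrable_of_loc hv (hmem _ ⟨le_rfl, by linarith⟩) (hmem _ ⟨by linarith, le_rfl⟩)
  have hφd : Continuous (deriv φ) := hφ.deriv.smooth.continuous
  have hdiff : Differentiable ℝ φ := h1.differentiable (by simp)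
  have h0 : ∀ x ∈ Icc (-r) r, IntervalIntegrable v volume 0 x := fun x hx =>
    intervalIntegrable_of_loc hv zero_mem_I (hmem x hx)
  have hlr : -r ≤ r := by linarith
  have key := integral_by_parts (f := deriv φ) (g := v) (F := φ)
    (G := fun t => c + ∫ r in (0 : ℝ)..t, v r) hlr (hφd.intervalIntegrable _ _) hvi
    (fun x _ => by
      rw [intervalIntegral.integral_deriv_eq_sub (fun y _ => hdiff y)
        (hφd.intervalIntegrable _ _)]; ring)
    (fun x hx => by
      have e := intervalIntegral.integral_add_adjacent_intervals (h0 _ ⟨le_rfl, hlr⟩)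
        ((h0 _ ⟨le_rfl, hlr⟩).symm.trans (h0 x hx))
      simp only [add_assoc, e])
  rw [hz r (by simp), hz (-r) (by simp), intervalIntegral.integral_add] at key
  · linarith
  · refine (ContinuousOn.mul hφd.continuousOn ?_).intervalIntegrable
    rw [uIcc_of_le hlr]
    exact (continuousOn_primitive hv c).mono hmem
  · exact hvi.continuousOn_mul h1.continuous.continuousOn


/-- The lemma of du Bois-Reymond. -/
lemma ae_const_of_isWeakDeriv_zero {w : ℝ → ℝ} (h : IsWeakDeriv 1 w 0) :
    ∃ c : ℝ, w =ᵐ[volI] fun _ => c := by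
  let f : ContDiffBump (0 : ℝ) := ⟨1 / 4, 1 / 2, by norm_num, by norm_num⟩
  set ψ : ℝ → ℝ := f.normed volume with hψdef
  have hψ : IsTest ψ := by
    refine ⟨f.contDiff_normed, f.hasCompactSupport_normed, ?_⟩
    rw [f.tsupport_normed_eq, Real.closedBall_eq_Icc]
    intro x hx
    have h1 : -(1 / 2 : ℝ) ≤ x := by simpa [f] using hx.1
    have h2 : x ≤ (1 / 2 : ℝ) := by simpa [f] using hx.2
    exact ⟨by linarith, by linarith⟩
  have hψ1 : ∫ t, ψ t = 1 := f.integral_normed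
  refine ⟨∫ t in I, ψ t * w t, ae_eq_of_forall_test h.1
    (continuousOn_const.locallyIntegrableOn measurableSet_I) fun g hg => ?_⟩
  set m : ℝ := ∫ t, g t with hm
  -- Subtracting m ψ makes the mean zero, so that the primitive φ of d again has compact support in
  -- I and is an admissible test function with derivative d.
  set d : ℝ → ℝ := fun t => g t - m * ψ t with hd
  have hdsm : ContDiff ℝ ∞ d := hg.smooth.sub (contDiff_const.mul hψ.smooth)
  have hgi : Integrable g := hg.smooth.continuous.integrable_of_hasCompactSupport hg.compact
  have hψi : Integrable ψ := hψ.smooth.continuous.integrable_of_hasCompactSupport hψ.compact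
  obtain ⟨r, hr0, hr1, hr⟩ := exists_Icc_of_compact (hg.compact.isCompact.union hψ.compact.isCompact)
    (union_subset hg.subset hψ.subset)
  have hdz : ∀ x ∉ Ioo (-r) r, d x = 0 := fun x hx => by
    simp only [hd]
    rw [IsTest.eq_zero_of_notMem (subset_union_left.trans hr) hx,
      IsTest.eq_zero_of_notMem (subset_union_right.trans hr) hx]; ring
  have hdint : ∫ t in (-r)..r, d t = 0 := by
    rw [← setIntegral_eq_interval hr0 hr1 hdz, setIntegral_eq_integral_of_forall_compl_eq_zero
      (fun x hx => hdz x fun h => hx (show x ∈ I from ⟨by linarith [h.1], by linarith [h.2]⟩))]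
    simp only [hd]
    rw [integral_sub hgi (hψi.const_mul m), integral_const_mul, hψ1, ← hm]; ring
  set φ : ℝ → ℝ := fun x => ∫ t in (-r)..x, d t with hφdef
  have hφd : ∀ x, HasDerivAt φ (d x) x := fun x =>
    intervalIntegral.integral_hasDerivAt_right (hdsm.continuous.intervalIntegrable _ _)
      (hdsm.continuous.stronglyMeasurableAtFilter _ _) hdsm.continuous.continuousAt
  have hφz : ∀ x ∉ Icc (-r) r, φ x = 0 := by
    intro x hx
    have hzero : ∀ a b : ℝ, (∀ t ∈ uIcc a b, t ∉ Ioo (-r) r) → ∫ t in a..b, d t = 0 := by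
      intro a b hab
      rw [intervalIntegral.integral_congr (g := fun _ => 0) (fun t ht => hdz t (hab t ht))]
      simp
    rcases lt_or_ge x (-r) with h1 | h1
    · refine hzero _ _ fun t ht h => ?_
      rw [uIcc_of_ge h1.le] at ht
      linarith [ht.2, h.1]
    · have h2 : r < x := by by_contra! h3; exact hx ⟨h1, h3⟩
      have e := intervalIntegral.integral_add_adjacent_intervals
        (hdsm.continuous.intervalIntegrable (μ := volume) (-r) r)
        (hdsm.continuous.intervalIntegrable (μ := volume) r x)
      rw [hφdef]
      simp only
      rw [← e, hdint, hzero r x fun t ht h => ?_, add_zero]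
      rw [uIcc_of_le h2.le] at ht
      linarith [ht.1, h.2]
  have hφs : tsupport φ ⊆ Icc (-r) r :=
    closure_minimal (fun x hx => by by_contra h; exact hx (hφz x h)) isClosed_Icc
  have hφ : IsTest φ := by
    refine ⟨contDiff_infty_iff_deriv.2 ⟨fun x => (hφd x).differentiableAt, ?_⟩,
      HasCompactSupport.intro isCompact_Icc hφz, hφs.trans fun x hx => ?_⟩
    · rwa [show deriv φ = d from funext fun x => (hφd x).deriv]
    · exact ⟨by linarith [hx.1], by linarith [hx.2]⟩
  have key := h.test hφ
  rw [iteratedDeriv_one, show deriv φ = d from funext fun x => (hφd x).deriv] at key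
  simp only [hd, Pi.zero_apply, mul_zero, integral_zero, sub_mul, mul_assoc] at key
  rw [integral_sub (hg.integrable h.1) ((hψ.integrable h.1).const_mul m), integral_const_mul] at key
  have e3 : ∫ t in I, g t = m := setIntegral_eq_integral_of_forall_compl_eq_zero
    fun x hx => IsTest.eq_zero_of_notMem hg.subset hx
  rw [integral_mul_const, e3]
  linarith

lemma IsWeakDeriv.exists_primitive {u v : ℝ → ℝ} (h : IsWeakDeriv 1 u v) :
    ∃ c : ℝ, u =ᵐ[volI] fun t => c + ∫ r in (0 : ℝ)..t, v r := by
  have h1 := h.sub (isWeakDeriv_primitive h.2.1 0)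
  rw [sub_self] at h1
  obtain ⟨c, hc⟩ := ae_const_of_isWeakDeriv_zero h1
  refine ⟨c, ?_⟩
  filter_upwards [hc] with t ht
  simp only [Pi.sub_apply, zero_add] at ht
  linarith

lemma isWeakDeriv_one_of_hasDerivAt {f f' : ℝ → ℝ} (hf : ∀ x, HasDerivAt f (f' x) x)
    (hc : Continuous f') : IsWeakDeriv 1 f f' := by
  have h := isWeakDeriv_primitive (v := f')
    (hc.continuousOn.locallyIntegrableOn measurableSet_I) (f 0)
  have e : (fun t => f 0 + ∫ r in (0 : ℝ)..t, f' r) = f := by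
    funext t
    rw [intervalIntegral.integral_eq_sub_of_hasDerivAt (fun x _ => hf x)
      (hc.intervalIntegrable _ _)]
    ring
  rwa [e] at h

lemma isWeakDeriv_polynomial (k : ℕ) (p : ℝ[X]) :
    IsWeakDeriv k (fun t => p.eval t) (fun t => (derivative^[k] p).eval t) := by
  induction k with
  | zero =>
    have h := p.continuous.continuousOn.locallyIntegrableOn (μ := volume) measurableSet_I
    exact ⟨h, h, fun φ _ _ _ => by simp⟩
  | succ k ih =>
    refine ih.succ ?_
    rw [Function.iterate_succ_apply']
    exact isWeakDeriv_one_of_hasDerivAt (fun x => Polynomial.hasDerivAt _ x)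
      (Polynomial.continuous _)

/-! ### Boundary values -/

/-- Relative neighbourhoods in I of a point of its closure have positive measure, so they meet every
set of full measure. -/
lemma ae_volI_eventually {a : ℝ} (ha : a ∈ closure I) {P : ℝ → Prop} (hP : ∀ᵐ t ∂volI, P t)
    {s : Set ℝ} (hs : s ∈ 𝓝[I] a) : ∃ t ∈ s, P t := by
  obtain ⟨U, hU, haU, hUs⟩ := mem_nhdsWithin.1 hs
  by_contra! hcon
  have hne : (U ∩ I).Nonempty := mem_closure_iff.1 ha U hU haU
  have hpos : 0 < volume (U ∩ I) := (hU.inter isOpen_I).measure_pos volume hne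
  rw [ae_restrict_iff' measurableSet_I, ae_iff] at hP
  refine hpos.ne' (measure_mono_null (fun t ht => ?_) hP)
  simp only [mem_ofPred_eq, Classical.not_imp]
  exact ⟨ht.2, hcon t (hUs ht)⟩

/-- Two representatives agree at points arbitrarily close to a, so their limits there cannot differ.
This makes boundary values independent of the representative. -/
lemma ZeroAt.eq_zero {f F : ℝ → ℝ} {a ℓ : ℝ} (h : ZeroAt f a) (ha : a ∈ closure I)
    (hF : f =ᵐ[volI] F) (hℓ : Tendsto F (𝓝[I] a) (𝓝 ℓ)) : ℓ = 0 := by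
  obtain ⟨g, hg, hg0⟩ := h
  by_contra hne
  have h1 : Tendsto (fun t => F t - g t) (𝓝[I] a) (𝓝 (ℓ - 0)) := hℓ.sub hg0
  rw [sub_zero] at h1
  obtain ⟨t, ht, ht'⟩ := ae_volI_eventually ha (hF.symm.trans hg) (h1.eventually_ne hne)
  exact ht (sub_eq_zero.2 ht')

lemma one_mem_closure_I : (1 : ℝ) ∈ closure I := by
  rw [I, closure_Ioo (by norm_num)]; simp

lemma neg_one_mem_closure_I : (-1 : ℝ) ∈ closure I := by
  rw [I, closure_Ioo (by norm_num)]; simp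

lemma ZeroAt.add {f g : ℝ → ℝ} {a : ℝ} (hf : ZeroAt f a) (hg : ZeroAt g a) :
    ZeroAt (f + g) a := by
  obtain ⟨f', h1, h2⟩ := hf
  obtain ⟨g', h3, h4⟩ := hg
  exact ⟨f' + g', h1.add h3, by simpa [Pi.add_def] using h2.add h4⟩

lemma ZeroAt.smul {f : ℝ → ℝ} {a : ℝ} (c : ℝ) (hf : ZeroAt f a) : ZeroAt (c • f) a := by
  obtain ⟨f', h1, h2⟩ := hf
  exact ⟨c • f', h1.const_smul c, by simpa [Pi.smul_def] using h2.const_mul c⟩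

lemma ZeroAt.congr {f g : ℝ → ℝ} {a : ℝ} (hf : ZeroAt f a) (h : f =ᵐ[volI] g) : ZeroAt g a := by
  obtain ⟨f', h1, h2⟩ := hf
  exact ⟨f', h.symm.trans h1, h2⟩

/-! ### The structure of `H20` -/

/-- The primitive of `f` that vanishes at `1`. -/
noncomputable def prim (f : ℝ → ℝ) (t : ℝ) : ℝ := -∫ r in t..1, f r

/-- Integrability up to the endpoint `1`. -/
def IntegrableToOne (f : ℝ → ℝ) : Prop := ∀ a ∈ I, IntervalIntegrable f volume a 1

lemma IntegrableToOne.intervalIntegrable {f : ℝ → ℝ} (hf : IntegrableToOne f) {a b : ℝ}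
    (ha : a ∈ I) (hb : b ∈ Ioc (-1 : ℝ) 1) : IntervalIntegrable f volume a b := by
  rcases hb.2.eq_or_lt with h | h
  · rw [h]; exact hf a ha
  · exact (hf a ha).trans (hf b ⟨hb.1, h⟩).symm

lemma IntegrableToOne.locallyIntegrableOn {f : ℝ → ℝ} (hf : IntegrableToOne f) :
    LocallyIntegrableOn f I := by
  intro x hx
  have hm : (-1 + x) / 2 ∈ I := ⟨by linarith [hx.1], by linarith [hx.2, hx.1]⟩
  refine ⟨Ioc ((-1 + x) / 2) 1, mem_nhdsWithin_of_mem_nhds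
    (Ioc_mem_nhds (by linarith [hx.1]) hx.2), ?_⟩
  have := hf _ hm
  rwa [intervalIntegrable_iff_integrableOn_Ioc_of_le hm.2.le] at this

lemma IntegrableToOne.of_integrable {f : ℝ → ℝ} (hf : Integrable f volI) : IntegrableToOne f := by
  intro a ha
  rw [intervalIntegrable_iff_integrableOn_Ioo_of_le ha.2.le]
  exact IntegrableOn.mono_set hf (Ioo_subset_Ioo_left ha.1.le)

@[simp] lemma prim_one (f : ℝ → ℝ) : prim f 1 = 0 := by simp [prim]

lemma prim_eq_add {f : ℝ → ℝ} {a x : ℝ} (h1 : IntervalIntegrable f volume a x)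
    (h2 : IntervalIntegrable f volume x 1) : prim f x = prim f a + ∫ t in a..x, f t := by
  rw [prim, prim, ← intervalIntegral.integral_add_adjacent_intervals h1 h2]; ring

lemma IntegrableToOne.prim_eq {f : ℝ → ℝ} (hf : IntegrableToOne f) {a : ℝ} (ha : a ∈ I) :
    ∀ x ∈ Icc a 1, prim f x = prim f a + ∫ t in a..x, f t := by
  intro x hx
  have hx' : x ∈ Ioc (-1 : ℝ) 1 := ⟨ha.1.trans_le hx.1, hx.2⟩
  have h1 := hf.intervalIntegrable ha hx'
  exact prim_eq_add h1 (h1.symm.trans (hf a ha))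

lemma IntegrableToOne.isWeakDeriv_prim {f : ℝ → ℝ} (hf : IntegrableToOne f) :
    IsWeakDeriv 1 (prim f) f := by
  refine (isWeakDeriv_primitive hf.locallyIntegrableOn (prim f 0)).congr ?_ (ae_eq_refl f)
  filter_upwards [ae_restrict_mem measurableSet_I] with t ht
  have h1 := hf.intervalIntegrable zero_mem_I (b := t) ⟨ht.1, ht.2.le⟩
  exact (prim_eq_add h1 (hf t ht)).symm

lemma IntegrableToOne.continuousOn_prim {f : ℝ → ℝ} (hf : IntegrableToOne f) {a : ℝ}
    (ha : a ∈ I) : ContinuousOn (prim f) (Icc a 1) := by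
  have h1 := ((hf a ha).absolutelyContinuousOnInterval_intervalIntegral (c := a)
    (by simp)).continuousOn
  rw [uIcc_of_le ha.2.le] at h1
  exact (continuousOn_const.add h1).congr (hf.prim_eq ha)

lemma continuousOn_prim_Icc {f : ℝ → ℝ} (hf : Integrable f volI) :
    ContinuousOn (prim f) (Icc (-1) 1) := by
  have h0 : IntervalIntegrable f volume (-1) 1 := by
    rw [intervalIntegrable_iff_integrableOn_Ioo_of_le (by norm_num)]; exact hf
  have h1 := (h0.absolutelyContinuousOnInterval_intervalIntegral (c := 1) (by simp)).continuousOn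
  rw [uIcc_of_le (by norm_num)] at h1
  refine h1.congr fun x _ => ?_
  rw [prim, intervalIntegral.integral_symm, neg_neg]

lemma IntegrableToOne.tendsto_prim_one {f : ℝ → ℝ} (hf : IntegrableToOne f) :
    Tendsto (prim f) (𝓝[I] 1) (𝓝 0) := by
  have h1 := hf.continuousOn_prim zero_mem_I 1 ⟨by norm_num, le_rfl⟩
  rw [ContinuousWithinAt, prim_one] at h1
  refine h1.mono_left (nhdsWithin_le_iff.2 ?_)
  refine mem_nhdsWithin.2 ⟨Ioi 0, isOpen_Ioi, by simp, fun x hx => ⟨(le_of_lt hx.1), hx.2.2.le⟩⟩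

lemma tendsto_prim_neg_one {f : ℝ → ℝ} (hf : Integrable f volI) :
    Tendsto (prim f) (𝓝[I] (-1)) (𝓝 (prim f (-1))) :=
  (continuousOn_prim_Icc hf (-1) (by simp)).mono_left (nhdsWithin_mono _ Ioo_subset_Icc_self)

lemma prim_congr {f g : ℝ → ℝ} (h : f =ᵐ[volI] g) {t : ℝ} (ht : t ∈ Icc (-1 : ℝ) 1) :
    prim f t = prim g t := by
  rw [prim, prim, intervalIntegral.integral_of_le ht.2, intervalIntegral.integral_of_le ht.2,
    integral_Ioc_eq_integral_Ioo, integral_Ioc_eq_integral_Ioo]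
  congr 1
  refine setIntegral_congr_ae measurableSet_Ioo ?_
  rw [EventuallyEq, ae_restrict_iff' measurableSet_I] at h
  filter_upwards [h] with x hx hx'
  exact hx ⟨ht.1.trans_lt hx'.1, hx'.2⟩

/-- A function with a weak derivative integrable up to `1`, and with boundary value `0` at `1`,
is the primitive of its weak derivative. -/
lemma IsWeakDeriv.ae_eq_prim {u v : ℝ → ℝ} (h : IsWeakDeriv 1 u v) (hv : IntegrableToOne v)
    (h0 : ZeroAt u 1) : u =ᵐ[volI] prim v := by
  obtain ⟨c, hc⟩ := h.exists_primitive
  have h1 : u =ᵐ[volI] fun t => (c - prim v 0) + prim v t := by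
    filter_upwards [hc, ae_restrict_mem measurableSet_I] with t ht htI
    rw [ht, prim_eq_add (hv.intervalIntegrable zero_mem_I ⟨htI.1, htI.2.le⟩) (hv t htI)]
    ring
  have h2 := h0.eq_zero one_mem_closure_I h1 (hv.tendsto_prim_one.const_add _)
  filter_upwards [h1] with t ht
  rw [ht]; linarith

/-- Writing the weight as a square moves it onto the function; all later estimates are in unweighted
L². -/
lemma memL2_iff {w σ f : ℝ → ℝ} (hσ : Measurable σ) (hw : ∀ t ∈ I, w t = σ t ^ 2)
    (hf : AEStronglyMeasurable f volI) : MemL2 w f ↔ MemLp (fun t => σ t * f t) 2 volI := by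
  have hm : AEStronglyMeasurable (fun t => σ t * f t) volI := hσ.aestronglyMeasurable.mul hf
  rw [memLp_two_iff_integrable_sq hm, MemL2, IntegrableOn]
  refine ⟨fun h => h.2.congr ?_, fun h => ⟨hf, h.congr ?_⟩⟩ <;>
  · filter_upwards [ae_restrict_mem measurableSet_I] with t ht
    rw [hw t ht]; ring

lemma jacobi_zero_two (t : ℝ) : jacobi 0 2 t = (1 + t) ^ 2 := by
  simp [jacobi]

lemma jacobi_zero_zero (t : ℝ) : jacobi 0 0 t = 1 := by simp [jacobi]

lemma jacobi_zero_neg_two (t : ℝ) : jacobi 0 (-2) t = ((1 + t)⁻¹) ^ 2 := by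
  simp only [jacobi, zpow_zero, one_mul, zpow_neg, inv_pow]; norm_cast

lemma memL2_jacobi_two {f : ℝ → ℝ} (hf : AEStronglyMeasurable f volI) :
    MemL2 (jacobi 0 2) f ↔ MemLp (fun t => (1 + t) * f t) 2 volI :=
  memL2_iff (by fun_prop) (fun t _ => jacobi_zero_two t) hf

lemma memL2_of_eq_one {w f : ℝ → ℝ} (hw : ∀ t ∈ I, w t = 1)
    (hf : AEStronglyMeasurable f volI) : MemL2 w f ↔ MemLp f 2 volI := by
  simpa using memL2_iff (σ := fun _ => 1) (by fun_prop) (fun t ht => by rw [hw t ht]; norm_num) hf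

lemma memL2_jacobi_neg_two {f : ℝ → ℝ} (hf : AEStronglyMeasurable f volI) :
    MemL2 (jacobi 0 (-2)) f ↔ MemLp (fun t => f t / (1 + t)) 2 volI := by
  rw [memL2_iff (σ := fun t => (1 + t)⁻¹) (by fun_prop) (fun t _ => jacobi_zero_neg_two t) hf]
  simp only [div_eq_inv_mul]

lemma integrable_of_memLp {f : ℝ → ℝ} (hf : MemLp f 2 volI) : Integrable f volI := by
  have : IsFiniteMeasure volI := ⟨by simp [volI, I]⟩
  exact hf.integrable one_le_two

/-- The factor 1/(1+t) is bounded away from −1. Near −1 the quotient may fail to be integrable,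
which is why primitives are taken from the endpoint 1. -/
lemma integrableToOne_div {h : ℝ → ℝ} (hh : MemLp h 2 volI) :
    IntegrableToOne (fun t => h t / (1 + t)) := by
  intro a ha
  have h1 := IntegrableToOne.of_integrable (integrable_of_memLp hh) a ha
  simp only [div_eq_mul_inv]
  refine h1.mul_continuousOn ?_
  rw [uIcc_of_le ha.2.le]
  refine ContinuousOn.inv₀ (by fun_prop) fun x hx => ?_
  linarith [hx.1, ha.1]

/-- `h = (1 + t) u''` presents `u` as an element of `H20`. -/
structure Profile (u h : ℝ → ℝ) : Prop where
  h_mem : MemLp h 2 volI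
  g_mem : MemLp (prim fun t => h t / (1 + t)) 2 volI
  f_mem : MemLp (fun t => u t / (1 + t)) 2 volI
  u_ae : u =ᵐ[volI] prim (prim fun t => h t / (1 + t))
  zero : prim (prim fun t => h t / (1 + t)) (-1) = 0

namespace Profile

variable {u h : ℝ → ℝ}

lemma isWeakDeriv_one (p : Profile u h) : IsWeakDeriv 1 u (prim fun t => h t / (1 + t)) :=
  (IntegrableToOne.of_integrable (integrable_of_memLp p.g_mem)).isWeakDeriv_prim.congr
    p.u_ae.symm (ae_eq_refl _)

lemma isWeakDeriv_two (p : Profile u h) : IsWeakDeriv 2 u (fun t => h t / (1 + t)) :=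
  p.isWeakDeriv_one.succ (integrableToOne_div p.h_mem).isWeakDeriv_prim

lemma mem_H20 (p : Profile u h) : u ∈ H20 := by
  have hum : AEStronglyMeasurable u volI :=
    p.isWeakDeriv_one.1.aestronglyMeasurable
  refine ⟨(memL2_jacobi_neg_two hum).2 p.f_mem, ⟨_, p.isWeakDeriv_one,
    (memL2_of_eq_one (fun t _ => jacobi_zero_zero t) p.g_mem.1).2 p.g_mem⟩,
    ⟨_, p.isWeakDeriv_two, ?_⟩, ?_, ?_, ?_⟩
  · rw [memL2_jacobi_two p.isWeakDeriv_two.2.1.aestronglyMeasurable]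
    refine p.h_mem.ae_eq ?_
    filter_upwards [ae_restrict_mem measurableSet_I] with t ht
    have : (1 + t) ≠ 0 := by linarith [ht.1]
    field_simp
  · refine ⟨_, p.u_ae, ?_⟩
    have := tendsto_prim_neg_one (integrable_of_memLp p.g_mem)
    rwa [p.zero] at this
  · exact ⟨_, p.u_ae, (IntegrableToOne.of_integrable
      (integrable_of_memLp p.g_mem)).tendsto_prim_one⟩
  · exact ⟨_, p.isWeakDeriv_one.weakDeriv_ae, (integrableToOne_div p.h_mem).tendsto_prim_one⟩

end Profile

/-- Every element of `H20` is presented by `(1 + t) u''`. -/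
lemma profile_of_mem_H20 {u : ℝ → ℝ} (hu : u ∈ H20) :
    Profile u (fun t => (1 + t) * weakDeriv 2 u t) := by
  obtain ⟨h0, ⟨v1, hv1, hm1⟩, ⟨v2, hv2, hm2⟩, hz1, hz2, hz3⟩ := hu
  have hd1 := hv1.weakDeriv
  have hd2 := hv2.weakDeriv
  have hh : MemLp (fun t => (1 + t) * weakDeriv 2 u t) 2 volI := by
    refine ((memL2_jacobi_two hm2.1).1 hm2).ae_eq ?_
    filter_upwards [hv2.weakDeriv_ae] with t ht
    rw [ht]
  have hg : MemLp (weakDeriv 1 u) 2 volI :=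
    ((memL2_of_eq_one (fun t _ => jacobi_zero_zero t) hm1.1).1 hm1).ae_eq hv1.weakDeriv_ae.symm
  have hq : (fun t => (1 + t) * weakDeriv 2 u t / (1 + t)) =ᵐ[volI] weakDeriv 2 u := by
    filter_upwards [ae_restrict_mem measurableSet_I] with t ht
    have : (1 + t) ≠ 0 := by linarith [ht.1]
    field_simp
  have hone := integrableToOne_div hh
  have e1 : weakDeriv 1 u =ᵐ[volI] prim fun t => (1 + t) * weakDeriv 2 u t / (1 + t) :=
    IsWeakDeriv.ae_eq_prim ((hd1.of_succ hd2).congr (ae_eq_refl _) hq.symm) hone hz3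
  have hg1 := IntegrableToOne.of_integrable (integrable_of_memLp hg)
  have e2 : u =ᵐ[volI] prim (weakDeriv 1 u) := hd1.ae_eq_prim hg1 hz2
  have e3 : prim (weakDeriv 1 u) =ᵐ[volI] prim (prim fun t => (1 + t) * weakDeriv 2 u t / (1 + t)) := by
    filter_upwards [ae_restrict_mem measurableSet_I] with t ht
    exact prim_congr e1 ⟨ht.1.le, ht.2.le⟩
  refine ⟨hh, hg.ae_eq e1, (memL2_jacobi_neg_two h0.1).1 h0, e2.trans e3, ?_⟩
  rw [← prim_congr e1 (by simp)]
  exact hz1.eq_zero neg_one_mem_closure_I e2 (tendsto_prim_neg_one (integrable_of_memLp hg))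

/-! ### Integral identities -/

lemma intervalIntegral_tendsto {q : ℝ → ℝ} (hq : Integrable q volI) :
    Tendsto (fun a => ∫ t in a..1, q t) (𝓝[I] (-1)) (𝓝 (∫ t in I, q t)) := by
  have h1 := (tendsto_prim_neg_one hq).neg
  simp only [prim, neg_neg] at h1
  rwa [intervalIntegral.integral_of_le (by norm_num), integral_Ioc_eq_integral_Ioo] at h1

/-- A boundary term of the form `(1 + a) q(a)` with `q` integrable vanishes. -/
lemma boundary_eq_zero {q : ℝ → ℝ} {ℓ : ℝ} (hq : Integrable q volI)
    (h : Tendsto (fun a => (1 + a) * q a) (𝓝[I] (-1)) (𝓝 ℓ)) : ℓ = 0 := by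
  by_contra hne
  have hpos : 0 < |ℓ| / 2 := by positivity
  have h1 : ∀ᶠ a in 𝓝[I] (-1), |ℓ| / 2 < |(1 + a) * q a| :=
    h.abs.eventually (lt_mem_nhds (by linarith [abs_pos.2 hne]))
  obtain ⟨ε, hε, hs⟩ := Metric.mem_nhdsWithin_iff.1 h1
  set δ := min (ε / 2) 1 with hδ
  have hδ0 : 0 < δ := by positivity
  have hδ1 : δ ≤ 1 := min_le_right _ _
  have hδε : δ ≤ ε / 2 := min_le_left _ _
  have hbound : ∀ a ∈ Ioo (-1) (-1 + δ), |ℓ| / 2 < (1 + a) * |q a| := by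
    intro a ha
    have : a ∈ Metric.ball (-1) ε ∩ I := by
      refine ⟨?_, ha.1, by linarith [ha.2]⟩
      rw [Metric.mem_ball, Real.dist_eq, abs_of_pos (by linarith [ha.1])]
      linarith [ha.2]
    have h2 : |ℓ| / 2 < |(1 + a) * q a| := hs this
    rwa [abs_mul, abs_of_pos (show 0 < 1 + a by linarith [ha.1])] at h2
  -- A nonzero limit would give |q(x)| ≥ c/(1+x) near −1, making 1/(1+x) integrable there.
  have hint : IntegrableOn (fun x : ℝ => (x - (-1))⁻¹) (Ioo (-1) (-1 + δ)) := by
    have hqi : IntegrableOn (fun x => (|ℓ| / 2)⁻¹ * |q x|) (Ioo (-1) (-1 + δ)) :=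
      (IntegrableOn.mono_set hq (Ioo_subset_Ioo_right (by linarith))).abs.const_mul _
    refine Integrable.mono hqi (by fun_prop) ?_
    filter_upwards [ae_restrict_mem measurableSet_Ioo] with x hx
    have hx1 : 0 < x - (-1) := by linarith [hx.1]
    have hb := hbound x hx
    rw [Real.norm_of_nonneg (by positivity), Real.norm_of_nonneg (by positivity),
      inv_mul_eq_div, inv_le_iff_one_le_mul₀ hx1, div_mul_eq_mul_div, le_div_iff₀ hpos]
    linarith
  have := (intervalIntegrable_iff_integrableOn_Ioo_of_le (by linarith)).2 hint
  rw [intervalIntegrable_sub_inv_iff] at this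
  rcases this with h3 | h3
  · linarith
  · exact h3 left_mem_uIcc

lemma eventually_mem_I : ∀ᶠ a in 𝓝[I] (-1), a ∈ I := self_mem_nhdsWithin

instance : NeBot (𝓝[I] (-1 : ℝ)) := mem_closure_iff_nhdsWithin_neBot.1 neg_one_mem_closure_I

/-- Integrability of p makes the boundary term converge as a → −1, and integrability of q then
forces its limit to be zero. -/
lemma integral_eq_of_boundary {p q : ℝ → ℝ} (hp : Integrable p volI) (hq : Integrable q volI)
    (h : ∀ a ∈ I, ∫ t in a..1, p t = -((1 + a) * q a)) :
    ∫ t in I, p t = 0 ∧ Tendsto (fun a => (1 + a) * q a) (𝓝[I] (-1)) (𝓝 0) := by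
  have h1 := intervalIntegral_tendsto hp
  have h2 : Tendsto (fun a => (1 + a) * q a) (𝓝[I] (-1)) (𝓝 (-∫ t in I, p t)) := by
    refine h1.neg.congr' ?_
    filter_upwards [eventually_mem_I] with a ha
    rw [h a ha, neg_neg]
  have h3 := boundary_eq_zero hq h2
  rw [h3] at h2
  exact ⟨by linarith, h2⟩

namespace Profile

variable {u h : ℝ → ℝ}

lemma intervalIntegrable_g (p : Profile u h) {a : ℝ} (ha : a ∈ I) :
    IntervalIntegrable (prim fun t => h t / (1 + t)) volume a 1 :=
  IntegrableToOne.of_integrable (integrable_of_memLp p.g_mem) a ha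

lemma intervalIntegrable_h (p : Profile u h) {a : ℝ} (ha : a ∈ I) :
    IntervalIntegrable h volume a 1 :=
  IntegrableToOne.of_integrable (integrable_of_memLp p.h_mem) a ha

/-- This is ((1+t)g)' = g + h in integrated form, where g = u' and h = (1+t)g'. Unlike g' alone, the
right side is integrable on all of I. -/
lemma omega_g_eq (p : Profile u h) {a : ℝ} (ha : a ∈ I) :
    ∀ x ∈ Icc a 1, (1 + x) * prim (fun t => h t / (1 + t)) x =
      (1 + a) * prim (fun t => h t / (1 + t)) a +
        ∫ t in a..x, (prim (fun t => h t / (1 + t)) t + h t) := by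
  intro x hx
  have hone := integrableToOne_div p.h_mem
  have hx' : x ∈ Ioc (-1 : ℝ) 1 := ⟨ha.1.trans_le hx.1, hx.2⟩
  have key := integral_by_parts (f := fun _ => (1 : ℝ)) (g := fun t => h t / (1 + t))
    (F := fun t => 1 + t) (G := prim fun t => h t / (1 + t)) hx.1
    (by simp) (hone.intervalIntegrable ha hx') (fun y _ => by simp)
    (fun y hy => hone.prim_eq ha y ⟨hy.1, hy.2.trans hx.2⟩)
  have e : ∫ t in a..x, (prim (fun t => h t / (1 + t)) t + h t) =
      ∫ t in a..x, (1 * prim (fun t => h t / (1 + t)) t + (1 + t) * (h t / (1 + t))) := by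
    refine intervalIntegral.integral_congr fun t ht => ?_
    rw [uIcc_of_le hx.1] at ht
    have : 1 + t ≠ 0 := by linarith [ht.1, ha.1]
    field_simp
  rw [e, key]; ring

/-- With g = u' and h = (1+t)g', the integrand is ((1+t)g²)'. The boundary term vanishes at 1
because g(1) = 0, and at −1 because g² is integrable. -/
lemma integral_hg (p : Profile u h) :
    ∫ t in I, (2 * (h t * prim (fun t => h t / (1 + t)) t) +
        prim (fun t => h t / (1 + t)) t ^ 2) = 0 ∧
      Tendsto (fun a => (1 + a) * prim (fun t => h t / (1 + t)) a ^ 2) (𝓝[I] (-1)) (𝓝 0) := by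
  refine integral_eq_of_boundary ?_ p.g_mem.integrable_sq fun a ha => ?_
  · exact ((p.h_mem.integrable_mul p.g_mem).const_mul 2).add p.g_mem.integrable_sq
  have hone := integrableToOne_div p.h_mem
  have key := integral_by_parts (f := fun t => h t / (1 + t))
    (g := fun t => prim (fun t => h t / (1 + t)) t + h t)
    (F := prim fun t => h t / (1 + t)) (G := fun t => (1 + t) * prim (fun t => h t / (1 + t)) t)
    ha.2.le (hone a ha) ((p.intervalIntegrable_g ha).add (p.intervalIntegrable_h ha))
    (hone.prim_eq ha) (p.omega_g_eq ha)
  rw [prim_one] at key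
  have e : ∫ t in a..1, (2 * (h t * prim (fun t => h t / (1 + t)) t) +
      prim (fun t => h t / (1 + t)) t ^ 2) = ∫ t in a..1, (h t / (1 + t) *
      ((1 + t) * prim (fun t => h t / (1 + t)) t) + prim (fun t => h t / (1 + t)) t *
      (prim (fun t => h t / (1 + t)) t + h t)) := by
    refine intervalIntegral.integral_congr fun t ht => ?_
    rw [uIcc_of_le ha.2.le] at ht
    have : 1 + t ≠ 0 := by linarith [ht.1, ha.1]
    field_simp; ring
  rw [e, key]; ring

lemma f_ae (p : Profile u h) :
    (fun t => u t / (1 + t)) =ᵐ[volI] fun t => prim (prim fun t => h t / (1 + t)) t / (1 + t) := by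
  filter_upwards [p.u_ae] with t ht
  rw [ht]

/-- With u the primitive of g and f = u/(1+t), the integrand is the derivative of u²/(1+t) =
(1+t)f². The boundary terms vanish since u(1) = 0 and f² is integrable. -/
lemma integral_gf (p : Profile u h) :
    ∫ t in I, (2 * (prim (fun t => h t / (1 + t)) t *
        (prim (prim fun t => h t / (1 + t)) t / (1 + t))) -
        (prim (prim fun t => h t / (1 + t)) t / (1 + t)) ^ 2) = 0 ∧
      Tendsto (fun a => (1 + a) * (prim (prim fun t => h t / (1 + t)) a / (1 + a)) ^ 2)
        (𝓝[I] (-1)) (𝓝 0) := by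
  have hf := p.f_mem.ae_eq p.f_ae
  refine integral_eq_of_boundary ?_ hf.integrable_sq fun a ha => ?_
  · exact ((p.g_mem.integrable_mul hf).const_mul 2).sub hf.integrable_sq
  set g := prim fun t => h t / (1 + t) with hg
  have hone : IntegrableToOne g := IntegrableToOne.of_integrable (integrable_of_memLp p.g_mem)
  have hpos : ∀ t ∈ Icc a 1, 1 + t ≠ 0 := fun t ht => by linarith [ht.1, ha.1]
  have hcinv : ContinuousOn (fun t : ℝ => -((1 + t) ^ 2)⁻¹) (Icc a 1) :=
    (ContinuousOn.inv₀ (by fun_prop) fun t ht => pow_ne_zero _ (hpos t ht)).neg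
  have hcU := hone.continuousOn_prim ha
  have hginv : IntervalIntegrable (fun t => g t / (1 + t)) volume a 1 := integrableToOne_div p.g_mem a ha
  have hV : ∀ x ∈ Icc a 1, prim g x / (1 + x) = prim g a / (1 + a) +
      ∫ t in a..x, (g t / (1 + t) + prim g t * (-((1 + t) ^ 2)⁻¹)) := by
    intro x hx
    have hsub : Icc a x ⊆ Icc a 1 := Icc_subset_Icc_right hx.2
    have hx' : x ∈ Ioc (-1 : ℝ) 1 := ⟨ha.1.trans_le hx.1, hx.2⟩
    have hii : ∀ y ∈ Icc a x, IntervalIntegrable (fun t : ℝ => -((1 + t) ^ 2)⁻¹) volume a y := by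
      intro y hy
      refine (hcinv.mono ?_).intervalIntegrable
      rw [uIcc_of_le hy.1]; exact Icc_subset_Icc_right (hy.2.trans hx.2)
    have key := integral_by_parts (f := g) (g := fun t => -((1 + t) ^ 2)⁻¹) (F := prim g)
      (G := fun t => (1 + t)⁻¹) hx.1 (hone.intervalIntegrable ha hx') (hii x ⟨hx.1, le_rfl⟩)
      (fun y hy => hone.prim_eq ha y (hsub hy)) (fun y hy => by
        rw [intervalIntegral.integral_eq_sub_of_hasDerivAt (f := fun t : ℝ => (1 + t)⁻¹)
          (fun t ht => ?_) (hii y hy)]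
        · ring
        · rw [uIcc_of_le hy.1] at ht
          have h1 := ((hasDerivAt_id t).const_add 1).fun_inv
            (hpos t ⟨ht.1, ht.2.trans (hy.2.trans hx.2)⟩)
          simpa [neg_div, div_eq_mul_inv] using h1)
    simp only [div_eq_mul_inv] at key ⊢
    rw [key]; ring
  have key := integral_by_parts (f := g) (g := fun t => g t / (1 + t) + prim g t * (-((1 + t) ^ 2)⁻¹))
    (F := prim g) (G := fun t => prim g t / (1 + t)) ha.2.le (hone a ha)
    (hginv.add (ContinuousOn.intervalIntegrable (by
      rw [uIcc_of_le ha.2.le]; exact hcU.mul hcinv))) (hone.prim_eq ha) hV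
  rw [prim_one] at key
  have e : ∫ t in a..1, (2 * (g t * (prim g t / (1 + t))) - (prim g t / (1 + t)) ^ 2) =
      ∫ t in a..1, (g t * (prim g t / (1 + t)) +
        prim g t * (g t / (1 + t) + prim g t * (-((1 + t) ^ 2)⁻¹))) := by
    refine intervalIntegral.integral_congr fun t ht => ?_
    rw [uIcc_of_le ha.2.le] at ht
    have := hpos t ht
    field_simp; ring
  rw [e, key]
  have := hpos a ⟨le_rfl, ha.2.le⟩
  field_simp; ring

/-- The integrand is (u'u)'. At −1 the boundary term is controlled by the two previous ones: |u'u| =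
(1+a)|g f| ≤ ((1+a)g² + (1+a)f²)/2. -/
lemma integral_hf (p : Profile u h) :
    ∫ t in I, (h t * (prim (prim fun t => h t / (1 + t)) t / (1 + t)) +
        prim (fun t => h t / (1 + t)) t ^ 2) = 0 := by
  have hf := p.f_mem.ae_eq p.f_ae
  set g := prim fun t => h t / (1 + t) with hg
  have hone := integrableToOne_div p.h_mem
  have hone' : IntegrableToOne g := IntegrableToOne.of_integrable (integrable_of_memLp p.g_mem)
  have hint : Integrable (fun t => h t * (prim g t / (1 + t)) + g t ^ 2) volI :=
    (p.h_mem.integrable_mul hf).add p.g_mem.integrable_sq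
  have h1 := intervalIntegral_tendsto hint
  have h2 : ∀ a ∈ I, ∫ t in a..1, (h t * (prim g t / (1 + t)) + g t ^ 2) = -(g a * prim g a) := by
    intro a ha
    have key := integral_by_parts (f := fun t => h t / (1 + t)) (g := g) (F := g) (G := prim g)
      ha.2.le (hone a ha) (hone' a ha) (hone.prim_eq ha) (hone'.prim_eq ha)
    rw [prim_one] at key
    have e : ∫ t in a..1, (h t * (prim g t / (1 + t)) + g t ^ 2) =
        ∫ t in a..1, (h t / (1 + t) * prim g t + g t * g t) := by
      refine intervalIntegral.integral_congr fun t ht => ?_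
      ring
    rw [e, key]; ring
  have h3 : Tendsto (fun a => g a * prim g a) (𝓝[I] (-1)) (𝓝 0) := by
    refine squeeze_zero_norm' (a := fun a => ((1 + a) * g a ^ 2 +
      (1 + a) * (prim g a / (1 + a)) ^ 2) / 2) ?_ ?_
    · filter_upwards [eventually_mem_I] with a ha
      have hpos : 0 < 1 + a := by linarith [ha.1]
      have e : prim g a = (1 + a) * (prim g a / (1 + a)) := by field_simp
      rw [Real.norm_eq_abs]
      set f := prim g a / (1 + a)
      rw [e, abs_le]
      constructor
      · nlinarith [mul_nonneg hpos.le (sq_nonneg (g a + f))]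
      · nlinarith [mul_nonneg hpos.le (sq_nonneg (g a - f))]
    · simpa using (p.integral_hg.2.add p.integral_gf.2).div_const 2
  have h4 : Tendsto (fun a => -(g a * prim g a)) (𝓝[I] (-1))
      (𝓝 (∫ t in I, (h t * (prim g t / (1 + t)) + g t ^ 2))) := by
    refine h1.congr' ?_
    filter_upwards [eventually_mem_I] with a ha
    exact h2 a ha
  have := tendsto_nhds_unique h4 h3.neg
  simpa using this

/-- Integrating (1+t)u'' by parts leaves −∫u' = u(−1) − u(1) = 0. This moment condition is what
later carries u(−1) = 0 over to the polynomial approximation. -/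
lemma integral_h (p : Profile u h) : ∫ t in I, h t = 0 := by
  set g := prim fun t => h t / (1 + t) with hg
  have hgi := integrable_of_memLp p.g_mem
  have hhi := integrable_of_memLp p.h_mem
  have h1 := intervalIntegral_tendsto (hgi.add hhi)
  have h2 : ∀ a ∈ I, ∫ t in a..1, (g + h) t = -((1 + a) * g a) := by
    intro a ha
    have := p.omega_g_eq ha 1 ⟨ha.2.le, le_rfl⟩
    rw [prim_one] at this
    simp only [Pi.add_apply]
    linarith
  have h3 := (integral_eq_of_boundary (hgi.add hhi) hgi h2).1
  have h0 : ∫ t in I, g t = 0 := by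
    have := p.zero
    rw [prim, intervalIntegral.integral_of_le (by norm_num), integral_Ioc_eq_integral_Ioo] at this
    simpa [I] using this
  have h5 : ∫ t in I, (g + h) t = (∫ t in I, g t) + ∫ t in I, h t := integral_add hgi hhi
  rw [← hg] at h3
  linarith

end Profile

/-! ### `H20` as a vector space -/

/-- `(1 + t) u''`. -/
noncomputable def omegaD2 (u : ℝ → ℝ) (t : ℝ) : ℝ := (1 + t) * weakDeriv 2 u t

/-- `u / (1 + t)`. -/
noncomputable def divOmega (u : ℝ → ℝ) (t : ℝ) : ℝ := u t / (1 + t)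

section H20

variable {u v : ℝ → ℝ}

lemma profile_omegaD2 (hu : u ∈ H20) : Profile u (omegaD2 u) := profile_of_mem_H20 hu

lemma weakDeriv_one_spec (hu : u ∈ H20) : IsWeakDeriv 1 u (weakDeriv 1 u) :=
  (profile_omegaD2 hu).isWeakDeriv_one.weakDeriv

lemma weakDeriv_two_spec (hu : u ∈ H20) : IsWeakDeriv 2 u (weakDeriv 2 u) :=
  (profile_omegaD2 hu).isWeakDeriv_two.weakDeriv

lemma weakDeriv_one_ae (hu : u ∈ H20) :
    weakDeriv 1 u =ᵐ[volI] prim fun t => omegaD2 u t / (1 + t) :=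
  (profile_omegaD2 hu).isWeakDeriv_one.weakDeriv_ae

lemma memLp_omegaD2 (hu : u ∈ H20) : MemLp (omegaD2 u) 2 volI := (profile_omegaD2 hu).h_mem

lemma memLp_weakDeriv_one (hu : u ∈ H20) : MemLp (weakDeriv 1 u) 2 volI :=
  (profile_omegaD2 hu).g_mem.ae_eq (weakDeriv_one_ae hu).symm

lemma memLp_divOmega (hu : u ∈ H20) : MemLp (divOmega u) 2 volI := (profile_omegaD2 hu).f_mem

lemma memLp_bounded_mul {c f : ℝ → ℝ} (M : ℝ) (hc : AEStronglyMeasurable c volI)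
    (hb : ∀ᵐ t ∂volI, |c t| ≤ M) (hf : MemLp f 2 volI) : MemLp (fun t => c t * f t) 2 volI := by
  refine MemLp.of_le_mul hf (hc.mul hf.1) (c := M) ?_
  filter_upwards [hb] with t ht
  rw [norm_mul]
  exact mul_le_mul_of_nonneg_right ht (norm_nonneg _)

lemma ae_abs_one_add_le : ∀ᵐ t ∂volI, |1 + t| ≤ 2 := by
  filter_upwards [ae_restrict_mem measurableSet_I] with t ht
  rw [abs_le]; exact ⟨by linarith [ht.1], by linarith [ht.2]⟩

lemma memLp_omega_mul {f : ℝ → ℝ} (hf : MemLp f 2 volI) :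
    MemLp (fun t => (1 + t) * f t) 2 volI :=
  memLp_bounded_mul 2 (by fun_prop) ae_abs_one_add_le hf

lemma ae_eq_omega_divOmega (u : ℝ → ℝ) : u =ᵐ[volI] fun t => (1 + t) * divOmega u t := by
  filter_upwards [ae_restrict_mem measurableSet_I] with t ht
  have : 1 + t ≠ 0 := by linarith [ht.1]
  rw [divOmega]; field_simp

lemma memLp_of_mem_H20 (hu : u ∈ H20) : MemLp u 2 volI :=
  (memLp_omega_mul (memLp_divOmega hu)).ae_eq (ae_eq_omega_divOmega u).symm

lemma weakDeriv_one_add (hu : u ∈ H20) (hv : v ∈ H20) :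
    weakDeriv 1 (u + v) =ᵐ[volI] weakDeriv 1 u + weakDeriv 1 v :=
  ((weakDeriv_one_spec hu).add (weakDeriv_one_spec hv)).weakDeriv_ae

lemma weakDeriv_one_smul (c : ℝ) (hu : u ∈ H20) :
    weakDeriv 1 (c • u) =ᵐ[volI] c • weakDeriv 1 u :=
  ((weakDeriv_one_spec hu).smul c).weakDeriv_ae

lemma omegaD2_add (hu : u ∈ H20) (hv : v ∈ H20) :
    omegaD2 (u + v) =ᵐ[volI] omegaD2 u + omegaD2 v := by
  filter_upwards [((weakDeriv_two_spec hu).add (weakDeriv_two_spec hv)).weakDeriv_ae] with t ht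
  simp only [omegaD2, Pi.add_apply, ht]; ring

lemma omegaD2_smul (c : ℝ) (hu : u ∈ H20) : omegaD2 (c • u) =ᵐ[volI] c • omegaD2 u := by
  filter_upwards [((weakDeriv_two_spec hu).smul c).weakDeriv_ae] with t ht
  simp only [omegaD2, Pi.smul_apply, smul_eq_mul, ht]; ring

lemma divOmega_add (u v : ℝ → ℝ) : divOmega (u + v) = divOmega u + divOmega v := by
  funext t; simp [divOmega, add_div]

lemma divOmega_smul (c : ℝ) (u : ℝ → ℝ) : divOmega (c • u) = c • divOmega u := by
  funext t; simp [divOmega, mul_div_assoc]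

lemma mem_H20_of {u g w : ℝ → ℝ} (h1 : IsWeakDeriv 1 u g) (h2 : IsWeakDeriv 2 u w)
    (hf : MemLp (divOmega u) 2 volI) (hg : MemLp g 2 volI)
    (hh : MemLp (fun t => (1 + t) * w t) 2 volI) (z1 : ZeroAt u (-1)) (z2 : ZeroAt u 1)
    (z3 : ZeroAt g 1) : u ∈ H20 :=
  ⟨(memL2_jacobi_neg_two h1.1.aestronglyMeasurable).2 hf,
    ⟨g, h1, (memL2_of_eq_one (fun t _ => jacobi_zero_zero t) hg.1).2 hg⟩,
    ⟨w, h2, (memL2_jacobi_two h2.2.1.aestronglyMeasurable).2 hh⟩, z1, z2,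
    z3.congr h1.weakDeriv_ae.symm⟩

end H20

/-- `H20` as a subspace of the space of all functions. -/
noncomputable def H20sub : Submodule ℝ (ℝ → ℝ) where
  carrier := H20
  zero_mem' := by
    have h0 : IsWeakDeriv 1 (0 : ℝ → ℝ) 0 := by
      simpa [Pi.zero_def] using isWeakDeriv_polynomial 1 (0 : ℝ[X])
    have h2 : IsWeakDeriv 2 (0 : ℝ → ℝ) 0 := by
      simpa [Pi.zero_def] using isWeakDeriv_polynomial 2 (0 : ℝ[X])
    have hza : ∀ a, ZeroAt (0 : ℝ → ℝ) a := fun a => ⟨0, ae_eq_refl _, tendsto_const_nhds⟩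
    refine mem_H20_of h0 h2 ?_ MemLp.zero ?_ (hza _) (hza _) (hza _)
    · rw [show divOmega 0 = 0 by funext t; simp [divOmega]]; exact MemLp.zero
    · simp
  add_mem' := by
    intro u v hu hv
    refine mem_H20_of ((weakDeriv_one_spec hu).add (weakDeriv_one_spec hv))
      ((weakDeriv_two_spec hu).add (weakDeriv_two_spec hv)) ?_
      ((memLp_weakDeriv_one hu).add (memLp_weakDeriv_one hv)) ?_ (hu.2.2.2.1.add hv.2.2.2.1)
      (hu.2.2.2.2.1.add hv.2.2.2.2.1) (hu.2.2.2.2.2.add hv.2.2.2.2.2)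
    · rw [divOmega_add]; exact (memLp_divOmega hu).add (memLp_divOmega hv)
    · refine ((memLp_omegaD2 hu).add (memLp_omegaD2 hv)).ae_eq (.of_forall fun t => ?_)
      simp only [omegaD2, Pi.add_apply]; ring
  smul_mem' := by
    intro c u hu
    refine mem_H20_of ((weakDeriv_one_spec hu).smul c) ((weakDeriv_two_spec hu).smul c) ?_
      ((memLp_weakDeriv_one hu).const_smul c) ?_ (hu.2.2.2.1.smul c)
      (hu.2.2.2.2.1.smul c) (hu.2.2.2.2.2.smul c)
    · rw [divOmega_smul]; exact (memLp_divOmega hu).const_smul c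
    · refine ((memLp_omegaD2 hu).const_smul c).ae_eq (.of_forall fun t => ?_)
      simp only [omegaD2, Pi.smul_apply, smul_eq_mul]; ring

/-! ### Hardy inequalities and coercivity -/

section Identities

variable {u : ℝ → ℝ}

lemma divOmega_ae (hu : u ∈ H20) : divOmega u =ᵐ[volI]
    fun t => prim (prim fun t => omegaD2 u t / (1 + t)) t / (1 + t) := (profile_omegaD2 hu).f_ae

lemma integral_omegaD2_mul (hu : u ∈ H20) :
    ∫ t in I, (2 * (omegaD2 u t * weakDeriv 1 u t) + weakDeriv 1 u t ^ 2) = 0 := by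
  rw [← (profile_omegaD2 hu).integral_hg.1]
  refine integral_congr_ae ?_
  filter_upwards [weakDeriv_one_ae hu] with t ht
  rw [ht]

lemma integral_weakDeriv_mul (hu : u ∈ H20) :
    ∫ t in I, (2 * (weakDeriv 1 u t * divOmega u t) - divOmega u t ^ 2) = 0 := by
  rw [← (profile_omegaD2 hu).integral_gf.1]
  refine integral_congr_ae ?_
  filter_upwards [weakDeriv_one_ae hu, divOmega_ae hu] with t ht ht'
  rw [ht, ht']

lemma integral_omegaD2_mul_divOmega (hu : u ∈ H20) :
    ∫ t in I, (omegaD2 u t * divOmega u t + weakDeriv 1 u t ^ 2) = 0 := by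
  rw [← (profile_omegaD2 hu).integral_hf]
  refine integral_congr_ae ?_
  filter_upwards [weakDeriv_one_ae hu, divOmega_ae hu] with t ht ht'
  rw [ht, ht']

lemma integrable_omegaD2_mul (hu : u ∈ H20) : Integrable
    (fun t => 2 * (omegaD2 u t * weakDeriv 1 u t) + weakDeriv 1 u t ^ 2) volI :=
  (((memLp_omegaD2 hu).integrable_mul (memLp_weakDeriv_one hu)).const_mul 2).add
    (memLp_weakDeriv_one hu).integrable_sq

lemma integrable_weakDeriv_mul (hu : u ∈ H20) : Integrable
    (fun t => 2 * (weakDeriv 1 u t * divOmega u t) - divOmega u t ^ 2) volI :=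
  (((memLp_weakDeriv_one hu).integrable_mul (memLp_divOmega hu)).const_mul 2).sub
    (memLp_divOmega hu).integrable_sq

lemma integrable_omegaD2_mul_divOmega (hu : u ∈ H20) : Integrable
    (fun t => omegaD2 u t * divOmega u t + weakDeriv 1 u t ^ 2) volI :=
  ((memLp_omegaD2 hu).integrable_mul (memLp_divOmega hu)).add
    (memLp_weakDeriv_one hu).integrable_sq

/-- 4h² + 2(2hg+g²) − g² = (2h+g)², and the bracket integrates to zero. -/
lemma hardy_weakDeriv (hu : u ∈ H20) :
    ∫ t in I, weakDeriv 1 u t ^ 2 ≤ 4 * ∫ t in I, omegaD2 u t ^ 2 := by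
  have hg := memLp_weakDeriv_one hu
  have hh := memLp_omegaD2 hu
  have h1 : ∫ t in I, weakDeriv 1 u t ^ 2 ≤ ∫ t in I, (4 * omegaD2 u t ^ 2 +
      2 * (2 * (omegaD2 u t * weakDeriv 1 u t) + weakDeriv 1 u t ^ 2)) := by
    refine integral_mono hg.integrable_sq ((hh.integrable_sq.const_mul 4).add
      ((integrable_omegaD2_mul hu).const_mul 2)) fun t => ?_
    simp only
    nlinarith [sq_nonneg (2 * omegaD2 u t + weakDeriv 1 u t)]
  rw [integral_add (hh.integrable_sq.const_mul 4)
    ((integrable_omegaD2_mul hu).const_mul 2), integral_const_mul,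
    integral_const_mul, integral_omegaD2_mul hu] at h1
  linarith

/-- 4g² − 2(2gf−f²) − f² = (2g−f)², and the bracket integrates to zero. -/
lemma hardy_divOmega (hu : u ∈ H20) :
    ∫ t in I, divOmega u t ^ 2 ≤ 4 * ∫ t in I, weakDeriv 1 u t ^ 2 := by
  have hg := memLp_weakDeriv_one hu
  have hf := memLp_divOmega hu
  have h1 : ∫ t in I, divOmega u t ^ 2 ≤ ∫ t in I, (4 * weakDeriv 1 u t ^ 2 -
      2 * (2 * (weakDeriv 1 u t * divOmega u t) - divOmega u t ^ 2)) := by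
    refine integral_mono hf.integrable_sq ((hg.integrable_sq.const_mul 4).sub
      ((integrable_weakDeriv_mul hu).const_mul 2)) fun t => ?_
    simp only
    nlinarith [sq_nonneg (2 * weakDeriv 1 u t - divOmega u t)]
  rw [integral_sub (hg.integrable_sq.const_mul 4)
    ((integrable_weakDeriv_mul hu).const_mul 2), integral_const_mul,
    integral_const_mul, integral_weakDeriv_mul hu] at h1
  linarith

/-- The main part `(1 + t) L_l u` of the operator. -/
noncomputable def omegaL (l : ℕ) (u : ℝ → ℝ) (t : ℝ) : ℝ :=
  omegaD2 u t + 2 * weakDeriv 1 u t - (l * (l + 1) : ℝ) * divOmega u t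

lemma memLp_omegaL (l : ℕ) (hu : u ∈ H20) : MemLp (omegaL l u) 2 volI :=
  ((memLp_omegaD2 hu).add ((memLp_weakDeriv_one hu).const_mul 2)).sub
    ((memLp_divOmega hu).const_mul _)

/-- With k = l(l+1), the square (h+2g−kf)² equals h² plus 2(2hg+g²) − 2k(hf+g²) − 2k(2gf−f²), which
integrates to zero, plus (2+2k)g² + k(k−2)f². The last coefficient is nonnegative because l ≥ 1
gives k ≥ 2. -/
lemma coercive_omegaL {l : ℕ} (hl : 1 ≤ l) (hu : u ∈ H20) :
    ∫ t in I, omegaD2 u t ^ 2 ≤ ∫ t in I, omegaL l u t ^ 2 := by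
  have hg := memLp_weakDeriv_one hu
  have hf := memLp_divOmega hu
  have hh := memLp_omegaD2 hu
  set k : ℝ := l * (l + 1) with hk
  have hk2 : 2 ≤ k := by
    have : (1 : ℝ) ≤ l := by exact_mod_cast hl
    nlinarith
  have i1 := (integrable_omegaD2_mul hu).const_mul 2
  have i2 := (integrable_omegaD2_mul_divOmega hu).const_mul (2 * k)
  have i3 := (integrable_weakDeriv_mul hu).const_mul (2 * k)
  have h1 : ∫ t in I, (omegaD2 u t ^ 2 +
      (2 * (2 * (omegaD2 u t * weakDeriv 1 u t) + weakDeriv 1 u t ^ 2) -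
      2 * k * (omegaD2 u t * divOmega u t + weakDeriv 1 u t ^ 2) -
      2 * k * (2 * (weakDeriv 1 u t * divOmega u t) - divOmega u t ^ 2))) ≤
      ∫ t in I, omegaL l u t ^ 2 := by
    refine integral_mono (hh.integrable_sq.add ((i1.sub i2).sub i3))
      (memLp_omegaL l hu).integrable_sq fun t => ?_
    simp only [omegaL, ← hk]
    have h3 : 0 ≤ (2 + 2 * k) * weakDeriv 1 u t ^ 2 := by positivity
    have h4 : 0 ≤ k * (k - 2) * divOmega u t ^ 2 :=
      mul_nonneg (mul_nonneg (by linarith) (by linarith)) (sq_nonneg _)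
    nlinarith
  have h6 := integral_add hh.integrable_sq ((i1.sub i2).sub i3)
  simp only [Pi.sub_apply] at h6
  rw [h6] at h1
  have h5 : ∫ t in I, (2 * (2 * (omegaD2 u t * weakDeriv 1 u t) + weakDeriv 1 u t ^ 2) -
      2 * k * (omegaD2 u t * divOmega u t + weakDeriv 1 u t ^ 2) -
      2 * k * (2 * (weakDeriv 1 u t * divOmega u t) - divOmega u t ^ 2)) = 0 := by
    have e1 := integral_sub (i1.sub i2) i3
    have e2 := integral_sub i1 i2
    simp only [Pi.sub_apply] at e1
    rw [e1, e2, integral_const_mul, integral_const_mul, integral_const_mul]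
    rw [integral_omegaD2_mul hu, integral_omegaD2_mul_divOmega hu, integral_weakDeriv_mul hu]
    ring
  linarith

end Identities

/-! ### Weighted bilinear forms on `L²` -/

/-- The form `∫_I c f g`. -/
noncomputable def wform (c f g : ℝ → ℝ) : ℝ := ∫ t in I, c t * f t * g t

/-- Bounded measurable coefficients. -/
structure IsCoeff (c : ℝ → ℝ) (M : ℝ) : Prop where
  meas : AEStronglyMeasurable c volI
  bound : ∀ᵐ t ∂volI, |c t| ≤ M

lemma isCoeff_one : IsCoeff (fun _ => 1) 1 := ⟨by fun_prop, by simp⟩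

section wform

variable {c f f' g : ℝ → ℝ} {M : ℝ}

lemma IsCoeff.integrable (hc : IsCoeff c M) (hf : MemLp f 2 volI) (hg : MemLp g 2 volI) :
    Integrable (fun t => c t * f t * g t) volI :=
  (memLp_bounded_mul M hc.meas hc.bound hf).integrable_mul hg

lemma wform_comm (c f g : ℝ → ℝ) : wform c f g = wform c g f := by
  simp only [wform, mul_right_comm]

lemma wform_congr {f f' g g' : ℝ → ℝ} (h1 : f =ᵐ[volI] f') (h2 : g =ᵐ[volI] g') :
    wform c f g = wform c f' g' := by
  refine integral_congr_ae ?_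
  filter_upwards [h1, h2] with t h1 h2
  rw [h1, h2]

lemma wform_add_left (hc : IsCoeff c M) (hf : MemLp f 2 volI) (hf' : MemLp f' 2 volI)
    (hg : MemLp g 2 volI) : wform c (f + f') g = wform c f g + wform c f' g := by
  rw [wform, wform, wform, ← integral_add (hc.integrable hf hg) (hc.integrable hf' hg)]
  refine integral_congr_ae (.of_forall fun t => ?_)
  simp only [Pi.add_apply]; ring

lemma wform_smul_left (r : ℝ) : wform c (r • f) g = r * wform c f g := by
  rw [wform, wform, ← integral_const_mul]
  refine integral_congr_ae (.of_forall fun t => ?_)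
  simp only [Pi.smul_apply, smul_eq_mul]; ring

lemma wform_self_le (hc : IsCoeff c M) (hf : MemLp f 2 volI) :
    wform c f f ≤ M * ∫ t in I, f t ^ 2 := by
  rw [wform, ← integral_const_mul]
  refine integral_mono_ae (hc.integrable hf hf) (hf.integrable_sq.const_mul M) ?_
  filter_upwards [hc.bound] with t ht
  have := le_of_abs_le ht
  nlinarith [mul_le_mul_of_nonneg_right this (sq_nonneg (f t))]

lemma le_wform_self (hc : IsCoeff c M) (hf : MemLp f 2 volI) {m : ℝ}
    (hm : ∀ᵐ t ∂volI, m ≤ c t) : m * ∫ t in I, f t ^ 2 ≤ wform c f f := by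
  rw [wform, ← integral_const_mul]
  refine integral_mono_ae (hf.integrable_sq.const_mul m) (hc.integrable hf hf) ?_
  filter_upwards [hm] with t ht
  nlinarith [mul_le_mul_of_nonneg_right ht (sq_nonneg (f t))]

lemma integral_sq_add_le (hf : MemLp f 2 volI) (hg : MemLp g 2 volI) :
    ∫ t in I, (f t + g t) ^ 2 ≤ 2 * (∫ t in I, f t ^ 2) + 2 * ∫ t in I, g t ^ 2 := by
  rw [← integral_const_mul, ← integral_const_mul,
    ← integral_add (hf.integrable_sq.const_mul 2) (hg.integrable_sq.const_mul 2)]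
  refine integral_mono (hf.add hg).integrable_sq ((hf.integrable_sq.const_mul 2).add
    (hg.integrable_sq.const_mul 2)) fun t => ?_
  simp only
  nlinarith [sq_nonneg (f t - g t)]

lemma integral_sq_mul_le (hc : IsCoeff c M) (hf : MemLp f 2 volI) :
    ∫ t in I, (c t * f t) ^ 2 ≤ M ^ 2 * ∫ t in I, f t ^ 2 := by
  rw [← integral_const_mul]
  refine integral_mono_ae (memLp_bounded_mul M hc.meas hc.bound hf).integrable_sq
    (hf.integrable_sq.const_mul _) ?_
  filter_upwards [hc.bound] with t ht
  simp only [mul_pow]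
  refine mul_le_mul_of_nonneg_right ?_ (sq_nonneg _)
  rw [← sq_abs (c t)]
  exact pow_le_pow_left₀ (abs_nonneg _) ht 2

end wform

/-! ### The forms `A` and `B` -/

/-- `(1 + t) (L_l u + σ e u)`. -/
noncomputable def shiftL (l : ℕ) (σ : ℝ) (e u : ℝ → ℝ) (t : ℝ) : ℝ :=
  omegaL l u t + σ * (e t * ((1 + t) * u t))

/-- The common shape of the two forms `A`. -/
noncomputable def genForm (l : ℕ) (σ : ℝ) (c d e u v : ℝ → ℝ) : ℝ :=
  wform c (shiftL l σ e u) (shiftL l σ e v) +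
    σ ^ 2 * wform d (fun t => (1 + t) * u t) (fun t => (1 + t) * v t)

lemma shiftL_eq (l : ℕ) (σ : ℝ) (e u : ℝ → ℝ) {t : ℝ} (ht : t ∈ I) :
    shiftL l σ e u t = (1 + t) * (opL l u t + σ * e t * u t) := by
  have : 1 + t ≠ 0 := by linarith [ht.1]
  rw [shiftL, omegaL, opL, omegaD2, divOmega]
  field_simp

lemma formA_eq_genForm (R : ℝ) (l : ℕ) (n : ℝ → ℝ) (τ : ℝ) :
    formA R l n τ =
      genForm l (R ^ 2 / 4 * τ) (fun t => 1 / (n t - 1)) (fun _ => 1) (fun _ => 1) := by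
  funext u v
  rw [formA, genForm, ip, ip, wform, wform]
  congr 1
  · refine setIntegral_congr_fun measurableSet_I fun t ht => ?_
    simp only [shiftL_eq _ _ _ _ ht, jacobi_zero_two, mul_one]
    ring
  · congr 1
    · ring
    · refine setIntegral_congr_fun measurableSet_I fun t ht => ?_
      simp only [jacobi_zero_two]
      ring

lemma formA'_eq_genForm (R : ℝ) (l : ℕ) (n : ℝ → ℝ) (τ : ℝ) :
    formA' R l n τ = genForm l (R ^ 2 / 4 * τ) (fun t => 1 / (1 - n t)) n n := by
  funext u v
  rw [formA', genForm, ip, ip, wform, wform]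
  congr 1
  · refine setIntegral_congr_fun measurableSet_I fun t ht => ?_
    simp only [shiftL_eq _ _ _ _ ht, jacobi_zero_two]
    ring
  · congr 1
    · ring
    · refine setIntegral_congr_fun measurableSet_I fun t ht => ?_
      simp only [jacobi_zero_two]
      ring

/-- Coefficients of `genForm` bounded above and, for `c` and `d`, away from zero. -/
structure Admissible (c d e : ℝ → ℝ) (m M : ℝ) : Prop where
  pos : 0 < m
  hc : IsCoeff c M
  hd : IsCoeff d M
  he : IsCoeff e M
  c_ge : ∀ᵐ t ∂volI, m ≤ c t
  d_ge : ∀ᵐ t ∂volI, m ≤ d t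

section Forms

variable {u v w : ℝ → ℝ} {l : ℕ} {σ m M : ℝ} {c d e : ℝ → ℝ}

lemma memLp_omega_u (hu : u ∈ H20) : MemLp (fun t => (1 + t) * u t) 2 volI :=
  memLp_omega_mul (memLp_of_mem_H20 hu)

lemma memLp_shiftL (he : IsCoeff e M) (hu : u ∈ H20) : MemLp (shiftL l σ e u) 2 volI :=
  (memLp_omegaL l hu).add
    ((memLp_bounded_mul M he.meas he.bound (memLp_omega_u hu)).const_mul σ)

lemma omegaL_add (hu : u ∈ H20) (hv : v ∈ H20) :
    omegaL l (u + v) =ᵐ[volI] omegaL l u + omegaL l v := by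
  filter_upwards [omegaD2_add hu hv, weakDeriv_one_add hu hv] with t h1 h2
  simp only [omegaL, Pi.add_apply, h1, h2, divOmega_add]; ring

lemma omegaL_smul (r : ℝ) (hu : u ∈ H20) : omegaL l (r • u) =ᵐ[volI] r • omegaL l u := by
  filter_upwards [omegaD2_smul r hu, weakDeriv_one_smul r hu] with t h1 h2
  simp only [omegaL, Pi.smul_apply, smul_eq_mul, h1, h2, divOmega_smul]; ring

lemma shiftL_add (hu : u ∈ H20) (hv : v ∈ H20) :
    shiftL l σ e (u + v) =ᵐ[volI] shiftL l σ e u + shiftL l σ e v := by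
  filter_upwards [omegaL_add (l := l) hu hv] with t h1
  simp only [shiftL, Pi.add_apply, h1]; ring

lemma shiftL_smul (r : ℝ) (hu : u ∈ H20) :
    shiftL l σ e (r • u) =ᵐ[volI] r • shiftL l σ e u := by
  filter_upwards [omegaL_smul (l := l) r hu] with t h1
  simp only [shiftL, Pi.smul_apply, smul_eq_mul, h1]; ring

lemma genForm_comm (u v : ℝ → ℝ) : genForm l σ c d e u v = genForm l σ c d e v u := by
  rw [genForm, genForm, wform_comm, wform_comm d]

lemma genForm_add_left (h : Admissible c d e m M) (hu : u ∈ H20) (hv : v ∈ H20) (hw : w ∈ H20) :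
    genForm l σ c d e (u + v) w = genForm l σ c d e u w + genForm l σ c d e v w := by
  have e1 : (fun t => (1 + t) * (u + v) t) = (fun t => (1 + t) * u t) + fun t => (1 + t) * v t := by
    funext t; simp only [Pi.add_apply]; ring
  rw [genForm, genForm, genForm, wform_congr (shiftL_add hu hv) (ae_eq_refl _), e1,
    wform_add_left h.hc (memLp_shiftL h.he hu) (memLp_shiftL h.he hv) (memLp_shiftL h.he hw),
    wform_add_left h.hd (memLp_omega_u hu) (memLp_omega_u hv) (memLp_omega_u hw)]
  ring

lemma genForm_smul_left (r : ℝ) (hu : u ∈ H20) :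
    genForm l σ c d e (r • u) w = r * genForm l σ c d e u w := by
  have e1 : (fun t => (1 + t) * (r • u) t) = r • fun t => (1 + t) * u t := by
    funext t; simp only [Pi.smul_apply, smul_eq_mul]; ring
  rw [genForm, genForm, wform_congr (shiftL_smul r hu) (ae_eq_refl _), e1, wform_smul_left,
    wform_smul_left]
  ring

lemma formB_eq (R : ℝ) (l : ℕ) (u v : ℝ → ℝ) : formB R l u v = R ^ 2 / 4 *
    (wform (fun _ => 1) (fun t => (1 + t) * weakDeriv 1 u t) (fun t => (1 + t) * weakDeriv 1 v t)
      + (l * (l + 1) : ℝ) * wform (fun _ => 1) u v) := by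
  rw [formB, ip, wform, wform, ip]
  congr 3
  funext t
  rw [jacobi_zero_two]; ring

lemma formB_comm (R : ℝ) (u v : ℝ → ℝ) : formB R l u v = formB R l v u := by
  rw [formB_eq, formB_eq, wform_comm, wform_comm _ u]

lemma formB_add_left (R : ℝ) (hu : u ∈ H20) (hv : v ∈ H20) (hw : w ∈ H20) :
    formB R l (u + v) w = formB R l u w + formB R l v w := by
  have e1 : (fun t => (1 + t) * weakDeriv 1 (u + v) t) =ᵐ[volI]
      (fun t => (1 + t) * weakDeriv 1 u t) + fun t => (1 + t) * weakDeriv 1 v t := by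
    filter_upwards [weakDeriv_one_add hu hv] with t h1
    simp only [h1, Pi.add_apply]; ring
  rw [formB_eq, formB_eq, formB_eq, wform_congr e1 (ae_eq_refl _),
    wform_add_left isCoeff_one (memLp_omega_mul (memLp_weakDeriv_one hu))
      (memLp_omega_mul (memLp_weakDeriv_one hv)) (memLp_omega_mul (memLp_weakDeriv_one hw)),
    wform_add_left isCoeff_one (memLp_of_mem_H20 hu) (memLp_of_mem_H20 hv) (memLp_of_mem_H20 hw)]
  ring

lemma formB_smul_left (R r : ℝ) (hu : u ∈ H20) :
    formB R l (r • u) w = r * formB R l u w := by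
  have e1 : (fun t => (1 + t) * weakDeriv 1 (r • u) t) =ᵐ[volI]
      r • fun t => (1 + t) * weakDeriv 1 u t := by
    filter_upwards [weakDeriv_one_smul r hu] with t h1
    simp only [h1, Pi.smul_apply, smul_eq_mul]; ring
  rw [formB_eq, formB_eq, wform_congr e1 (ae_eq_refl _), wform_smul_left, wform_smul_left]
  ring

/-- `genForm` as a bilinear form on `H20`. -/
noncomputable def bilinA (l : ℕ) (σ : ℝ) (h : Admissible c d e m M) :
    LinearMap.BilinForm ℝ H20sub :=
  LinearMap.mk₂ ℝ (fun u v => genForm l σ c d e u v)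
    (fun u v w => genForm_add_left h u.2 v.2 w.2)
    (fun r u w => genForm_smul_left r u.2)
    (fun u v w => by
      rw [genForm_comm, Submodule.coe_add, genForm_add_left h v.2 w.2 u.2, genForm_comm (u := v.1),
        genForm_comm (u := w.1)])
    (fun r u w => by
      rw [genForm_comm, Submodule.coe_smul, genForm_smul_left r w.2, genForm_comm, smul_eq_mul])

/-- `formB` as a bilinear form on `H20`. -/
noncomputable def bilinB (R : ℝ) (l : ℕ) : LinearMap.BilinForm ℝ H20sub :=
  LinearMap.mk₂ ℝ (fun u v => formB R l u v)
    (fun u v w => formB_add_left R u.2 v.2 w.2)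
    (fun r u w => formB_smul_left R r u.2)
    (fun u v w => by
      rw [formB_comm, Submodule.coe_add, formB_add_left R v.2 w.2 u.2, formB_comm R v.1,
        formB_comm R w.1])
    (fun r u w => by
      rw [formB_comm, Submodule.coe_smul, formB_smul_left R r w.2, formB_comm, smul_eq_mul])

@[simp] lemma bilinA_apply (h : Admissible c d e m M) (u v : H20sub) :
    bilinA l σ h u v = genForm l σ c d e u v := rfl

@[simp] lemma bilinB_apply (R : ℝ) (u v : H20sub) : bilinB R l u v = formB R l u v := rfl

lemma integral_sq_nonneg (f : ℝ → ℝ) : 0 ≤ ∫ t in I, f t ^ 2 :=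
  integral_nonneg fun _ => sq_nonneg _

lemma genForm_self_ge (h : Admissible c d e m M) (hu : u ∈ H20) :
    m * (∫ t in I, shiftL l σ e u t ^ 2) + σ ^ 2 * (m * ∫ t in I, ((1 + t) * u t) ^ 2) ≤
      genForm l σ c d e u u :=
  add_le_add (le_wform_self h.hc (memLp_shiftL h.he hu) h.c_ge)
    (mul_le_mul_of_nonneg_left (le_wform_self h.hd (memLp_omega_u hu) h.d_ge) (sq_nonneg _))

lemma isPsd_bilinA (h : Admissible c d e m M) : IsPsd (bilinA l σ h) where
  symm u v := genForm_comm _ _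
  nonneg u := le_trans (by have := h.pos; have := integral_sq_nonneg (shiftL l σ e u)
                           have := integral_sq_nonneg (fun t => (1 + t) * (u : ℝ → ℝ) t)
                           positivity) (genForm_self_ge (l := l) (σ := σ) h u.2)

lemma wform_one_self (f : ℝ → ℝ) : wform (fun _ => 1) f f = ∫ t in I, f t ^ 2 := by
  simp [wform, sq]

lemma formB_self (R : ℝ) (l : ℕ) (u : ℝ → ℝ) : formB R l u u = R ^ 2 / 4 *
    ((∫ t in I, ((1 + t) * weakDeriv 1 u t) ^ 2) + (l * (l + 1) : ℝ) * ∫ t in I, u t ^ 2) := by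
  rw [formB_eq, wform_one_self, wform_one_self]

lemma isPsd_bilinB (R : ℝ) : IsPsd (bilinB R l) where
  symm u v := formB_comm R _ _
  nonneg u := by
    rw [bilinB_apply, formB_self]
    have := integral_sq_nonneg (u : ℝ → ℝ)
    have := integral_sq_nonneg (fun t => (1 + t) * weakDeriv 1 (u : ℝ → ℝ) t)
    positivity

lemma isCoeff_omega : IsCoeff (fun t => 1 + t) 2 := ⟨by fun_prop, ae_abs_one_add_le⟩

lemma integral_sq_omega_le {f : ℝ → ℝ} (hf : MemLp f 2 volI) :
    ∫ t in I, ((1 + t) * f t) ^ 2 ≤ 4 * ∫ t in I, f t ^ 2 := by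
  have := integral_sq_mul_le isCoeff_omega hf
  norm_num at this; exact this

lemma integral_sq_le_divOmega (hu : u ∈ H20) :
    ∫ t in I, u t ^ 2 ≤ 4 * ∫ t in I, divOmega u t ^ 2 := by
  refine le_trans (le_of_eq (integral_congr_ae ?_)) (integral_sq_omega_le (memLp_divOmega hu))
  filter_upwards [ae_eq_omega_divOmega u] with t ht
  exact congrArg (· ^ 2) ht

/-- Coercivity of `A`. -/
lemma omegaD2_le_genForm (hl : 1 ≤ l) (h : Admissible c d e m M) (hu : u ∈ H20) :
    ∫ t in I, omegaD2 u t ^ 2 ≤ (2 + 2 * M ^ 2) / m * genForm l σ c d e u u := by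
  have h1 := genForm_self_ge (l := l) (σ := σ) h hu
  have h2 := coercive_omegaL hl hu
  have hew := memLp_bounded_mul M h.he.meas h.he.bound (memLp_omega_u hu)
  have h3 := integral_sq_add_le (memLp_shiftL (l := l) (σ := σ) h.he hu) (hew.const_mul (-σ))
  have e1 : ∀ t, shiftL l σ e u t + -σ * (e t * ((1 + t) * u t)) = omegaL l u t := fun t => by
    rw [shiftL]; ring
  have e2 : ∫ t in I, (-σ * (e t * ((1 + t) * u t))) ^ 2 =
      σ ^ 2 * ∫ t in I, (e t * ((1 + t) * u t)) ^ 2 := by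
    rw [← integral_const_mul]
    exact integral_congr_ae (.of_forall fun t => by simp only; ring)
  have h4 := integral_sq_mul_le h.he (memLp_omega_u hu)
  simp only [e1, e2] at h3
  have hs := integral_sq_nonneg (shiftL l σ e u)
  have hs' := integral_sq_nonneg (fun t => (1 + t) * u t)
  set S := ∫ t in I, shiftL l σ e u t ^ 2
  set W := ∫ t in I, ((1 + t) * u t) ^ 2
  have h5 := mul_le_mul_of_nonneg_left h4 (sq_nonneg σ)
  rw [div_mul_eq_mul_div, le_div_iff₀ h.pos]
  -- The shift by σ is undone with (a+b)² ≤ 2a²+2b². Its cost σ²W is paid by the second summand of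
  -- the form, so coercivity holds for τ of any sign and size.
  have h6 : ∫ t in I, omegaD2 u t ^ 2 ≤ 2 * S + 2 * (σ ^ 2 * (M ^ 2 * W)) := by linarith
  have h7 := mul_le_mul_of_nonneg_right h6 h.pos.le
  have h8 := mul_le_mul_of_nonneg_left h1 (show 0 ≤ 2 + 2 * M ^ 2 by positivity)
  have h9 : 0 ≤ M ^ 2 * (m * S) := mul_nonneg (sq_nonneg _) (mul_nonneg h.pos.le hs)
  have h10 : 0 ≤ σ ^ 2 * (m * W) := mul_nonneg (sq_nonneg _) (mul_nonneg h.pos.le hs')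
  nlinarith

/-- Boundedness of `A`. -/
lemma genForm_le (h : Admissible c d e m M) (hu : u ∈ H20) :
    genForm l σ c d e u u ≤ M * (324 + 64 * (l * (l + 1) : ℝ) ^ 2 + 512 * σ ^ 2 * M ^ 2
      + 256 * σ ^ 2) * ∫ t in I, omegaD2 u t ^ 2 := by
  have hg := hardy_weakDeriv hu
  have hf := hardy_divOmega hu
  have hu2 := integral_sq_le_divOmega hu
  have hw := integral_sq_omega_le (memLp_of_mem_H20 hu)
  have hew := memLp_bounded_mul M h.he.meas h.he.bound (memLp_omega_u hu)
  have hmg := memLp_weakDeriv_one hu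
  have hmf := memLp_divOmega hu
  have h1 := wform_self_le h.hc (memLp_shiftL (l := l) (σ := σ) h.he hu)
  have h2 := wform_self_le h.hd (memLp_omega_u hu)
  have h3 := integral_sq_add_le (memLp_omegaL l hu) (hew.const_mul σ)
  have h4 := integral_sq_add_le ((memLp_omegaD2 hu).add (hmg.const_mul 2))
    (hmf.const_mul (-(l * (l + 1) : ℝ)))
  have h5 := integral_sq_add_le (memLp_omegaD2 hu) (hmg.const_mul 2)
  have h6 := integral_sq_mul_le h.he (memLp_omega_u hu)
  simp only [mul_pow (2 : ℝ), mul_pow σ, mul_pow (-(l * (l + 1) : ℝ)), integral_const_mul,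
    Pi.add_apply] at h3 h4 h5
  have e1 : ∀ t, omegaD2 u t + 2 * weakDeriv 1 u t + -(l * (l + 1) : ℝ) * divOmega u t =
      omegaL l u t := fun t => by rw [omegaL]; ring
  simp only [e1] at h4
  have e2 : ∀ t, omegaL l u t + σ * (e t * ((1 + t) * u t)) = shiftL l σ e u t := fun t => by
    rw [shiftL]
  simp only [e2] at h3
  have hM : 0 ≤ M := by
    obtain ⟨t, -, ht⟩ := ae_volI_eventually one_mem_closure_I h.hc.bound univ_mem
    exact (abs_nonneg _).trans ht
  rw [genForm]
  have hN := integral_sq_nonneg (omegaD2 u)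
  set N := ∫ t in I, omegaD2 u t ^ 2
  set W := ∫ t in I, ((1 + t) * u t) ^ 2
  set S := ∫ t in I, shiftL l σ e u t ^ 2
  set k : ℝ := l * (l + 1)
  -- The Hardy inequalities and 1+t ≤ 2 cost a factor 4 each: ‖u'‖² ≤ 4N, ‖u/(1+t)‖² ≤ 16N, ‖u‖² ≤
  -- 64N, ‖(1+t)u‖² ≤ 256N. The constants of the statement are generous.
  have hW : W ≤ 256 * N := by linarith
  have hF : ∫ t in I, divOmega u t ^ 2 ≤ 16 * N := by linarith
  have h7 := mul_le_mul_of_nonneg_left (h6.trans (mul_le_mul_of_nonneg_left hW (sq_nonneg M)))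
    (sq_nonneg σ)
  have h8 := mul_le_mul_of_nonneg_left hF (sq_nonneg (-k))
  have hS : S ≤ (324 + 64 * k ^ 2 + 512 * σ ^ 2 * M ^ 2) * N := by nlinarith
  have h9 := mul_le_mul_of_nonneg_left hS hM
  have h10 := mul_le_mul_of_nonneg_left (h2.trans (mul_le_mul_of_nonneg_left hW hM)) (sq_nonneg σ)
  nlinarith

/-- The same chain of factors 4 gives ‖(1+t)u'‖² ≤ 16N and ‖u‖² ≤ 64N. Together with coercivity this
bounds `B` by a multiple of `A`. -/
lemma formB_le (R : ℝ) (hu : u ∈ H20) :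
    formB R l u u ≤ R ^ 2 / 4 * (16 + 64 * (l * (l + 1) : ℝ)) * ∫ t in I, omegaD2 u t ^ 2 := by
  have hg := hardy_weakDeriv hu
  have hf := hardy_divOmega hu
  have hu2 := integral_sq_le_divOmega hu
  have hw := integral_sq_omega_le (memLp_weakDeriv_one hu)
  rw [formB_self, mul_assoc (R ^ 2 / 4)]
  refine mul_le_mul_of_nonneg_left ?_ (by positivity)
  set N := ∫ t in I, omegaD2 u t ^ 2
  have hk : (0 : ℝ) ≤ l * (l + 1) := by positivity
  have h1 : ∫ t in I, u t ^ 2 ≤ 64 * N := by linarith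
  have h2 := mul_le_mul_of_nonneg_left h1 hk
  linarith

lemma ae_eq_zero_of_formB {R : ℝ} (hR : 0 < R) (hl : 1 ≤ l) (hu : u ∈ H20)
    (h0 : formB R l u u = 0) : u =ᵐ[volI] 0 := by
  rw [formB_self] at h0
  have h1 := integral_sq_nonneg u
  have h2 := integral_sq_nonneg (fun t => (1 + t) * weakDeriv 1 u t)
  have hk : (0 : ℝ) < l * (l + 1) := by positivity
  have h3 : ∫ t in I, u t ^ 2 = 0 := by
    rcases mul_eq_zero.1 h0 with h4 | h4
    · have : 0 < R ^ 2 / 4 := by positivity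
      linarith
    · have h5 : (l * (l + 1) : ℝ) * ∫ t in I, u t ^ 2 = 0 := by
        have := mul_nonneg hk.le h1
        linarith
      rcases mul_eq_zero.1 h5 with h6 | h6
      · linarith
      · exact h6
  rw [integral_eq_zero_iff_of_nonneg (fun t => sq_nonneg _)
    (memLp_of_mem_H20 hu).integrable_sq] at h3
  filter_upwards [h3] with t ht
  simpa using ht

end Forms

/-! ### Convergence in `L²(I)` -/

instance : IsFiniteMeasure volI := ⟨by simp [volI, I]⟩

section L2

variable {f g k : ℝ → ℝ}

lemma inner_toLp (hf : MemLp f 2 volI) (hg : MemLp g 2 volI) :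
    inner ℝ (hf.toLp f) (hg.toLp g) = ∫ t in I, f t * g t := by
  rw [L2.inner_def]
  refine integral_congr_ae ?_
  filter_upwards [hf.coeFn_toLp, hg.coeFn_toLp] with t h1 h2
  rw [h1, h2, real_inner_eq_re_inner]
  simp [mul_comm]

lemma norm_toLp_sq (hf : MemLp f 2 volI) : ‖hf.toLp f‖ ^ 2 = ∫ t in I, f t ^ 2 := by
  rw [← real_inner_self_eq_norm_sq, inner_toLp]
  simp only [sq]

lemma norm_toLp_sub_sq (hf : MemLp f 2 volI) (hg : MemLp g 2 volI) :
    ‖hf.toLp f - hg.toLp g‖ ^ 2 = ∫ t in I, (f t - g t) ^ 2 := by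
  rw [← MemLp.toLp_sub, norm_toLp_sq]
  rfl

variable {F : ℕ → ℝ → ℝ}

lemma tendsto_toLp (hF : ∀ n, MemLp (F n) 2 volI) (hf : MemLp f 2 volI)
    (h : Tendsto (fun n => ∫ t in I, (F n t - f t) ^ 2) atTop (𝓝 0)) :
    Tendsto (fun n => (hF n).toLp (F n)) atTop (𝓝 (hf.toLp f)) := by
  rw [tendsto_iff_norm_sub_tendsto_zero]
  have h1 := (h.congr fun n => (norm_toLp_sub_sq (hF n) hf).symm).sqrt
  simpa [Real.sqrt_sq] using h1

lemma tendsto_integral_mul (hF : ∀ n, MemLp (F n) 2 volI) (hf : MemLp f 2 volI)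
    (h : Tendsto (fun n => ∫ t in I, (F n t - f t) ^ 2) atTop (𝓝 0)) (hk : MemLp k 2 volI) :
    Tendsto (fun n => ∫ t in I, F n t * k t) atTop (𝓝 (∫ t in I, f t * k t)) := by
  have h1 := (tendsto_toLp hF hf h).inner (𝕜 := ℝ) (tendsto_const_nhds (x := hk.toLp k))
  simpa only [inner_toLp] using h1

lemma exists_L2_limit (hF : ∀ n, MemLp (F n) 2 volI)
    (h : ∀ ε > 0, ∃ N, ∀ i ≥ N, ∀ j ≥ N, ∫ t in I, (F i t - F j t) ^ 2 < ε) :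
    ∃ f, MemLp f 2 volI ∧ Tendsto (fun n => ∫ t in I, (F n t - f t) ^ 2) atTop (𝓝 0) := by
  have hc : CauchySeq fun n => (hF n).toLp (F n) := by
    rw [Metric.cauchySeq_iff]
    intro ε hε
    obtain ⟨N, hN⟩ := h (ε ^ 2) (by positivity)
    refine ⟨N, fun i hi j hj => ?_⟩
    rw [dist_eq_norm]
    refine lt_of_pow_lt_pow_left₀ 2 hε.le ?_
    rw [norm_toLp_sub_sq]
    exact hN i hi j hj
  obtain ⟨f, hf⟩ := cauchySeq_tendsto_of_complete hc
  refine ⟨f, Lp.memLp f, ?_⟩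
  have h1 := (tendsto_iff_norm_sub_tendsto_zero.1 hf).pow 2
  rw [zero_pow two_ne_zero] at h1
  refine h1.congr fun n => ?_
  have := norm_toLp_sub_sq (hF n) (Lp.memLp f)
  rwa [Lp.toLp_coeFn] at this

/-- An `L²` limit and a pointwise limit coincide. -/
lemma ae_eq_of_tendsto (hF : ∀ n, MemLp (F n) 2 volI) (hf : MemLp f 2 volI)
    (h : Tendsto (fun n => ∫ t in I, (F n t - f t) ^ 2) atTop (𝓝 0))
    (hg : ∀ t ∈ I, Tendsto (fun n => F n t) atTop (𝓝 (g t))) : f =ᵐ[volI] g := by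
  have h1 := tendstoInMeasure_of_tendsto_Lp (tendsto_toLp hF hf h)
  have h2 : TendstoInMeasure volI F atTop f :=
    h1.congr (fun n => (hF n).coeFn_toLp) hf.coeFn_toLp
  have h3 : TendstoInMeasure volI F atTop g := by
    refine tendstoInMeasure_of_tendsto_ae (fun n => (hF n).1) ?_
    filter_upwards [ae_restrict_mem measurableSet_I] with t ht
    exact hg t ht
  exact tendstoInMeasure_ae_unique h2 h3

/-- Bounded sequences in `L²` have weakly convergent subsequences. -/
lemma exists_weak_subseq (hF : ∀ n, MemLp (F n) 2 volI) {M : ℝ}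
    (hM : ∀ n, ∫ t in I, F n t ^ 2 ≤ M) :
    ∃ φ : ℕ → ℕ, StrictMono φ ∧ ∀ k, MemLp k 2 volI →
      ∃ ℓ, Tendsto (fun n => ∫ t in I, F (φ n) t * k t) atTop (𝓝 ℓ) := by
  have : Fact ((2 : ENNReal) ≠ ⊤) := ⟨by simp⟩
  let T : ℕ → WeakDual ℝ (Lp ℝ 2 volI) := fun n =>
    StrongDual.toWeakDual (innerSL ℝ ((hF n).toLp (F n)))
  have hT : ∀ n, T n ∈ WeakDual.toStrongDual ⁻¹'
      Metric.closedBall (0 : StrongDual ℝ (Lp ℝ 2 volI)) (√M) := by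
    intro n
    change innerSL ℝ ((hF n).toLp (F n)) ∈ Metric.closedBall 0 (√M)
    rw [mem_closedBall_zero_iff, innerSL_apply_norm]
    refine Real.le_sqrt_of_sq_le ?_
    rw [norm_toLp_sq]
    exact hM n
  -- Sequential Banach–Alaoglu: the functionals ⟨Fₙ,·⟩ lie in a ball of the dual of the separable
  -- space L²(I).
  obtain ⟨ψ, -, φ, hφ, hlim⟩ := WeakDual.isSeqCompact_closedBall ℝ (Lp ℝ 2 volI) 0 (√M) hT
  refine ⟨φ, hφ, fun k hk => ⟨ψ (hk.toLp k), ?_⟩⟩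
  have h1 := ((WeakDual.eval_continuous (hk.toLp k)).tendsto ψ).comp hlim
  refine h1.congr fun n => ?_
  change inner ℝ ((hF (φ n)).toLp (F (φ n))) (hk.toLp k) = _
  rw [inner_toLp]

end L2

/-! ### Primitives as inner products -/

/-- The kernel of `f ↦ -prim f t`. -/
noncomputable def primKernel (t : ℝ) : ℝ → ℝ := (Ioo t 1).indicator fun _ => 1

/-- The kernel of `h ↦ -prim (h / (1 + ·)) t`. -/
noncomputable def primDivKernel (t : ℝ) : ℝ → ℝ := (Ioo t 1).indicator fun r => 1 / (1 + r)

lemma prim_eq_integral_kernel (f : ℝ → ℝ) {t : ℝ} (ht : t ∈ Icc (-1 : ℝ) 1) :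
    prim f t = -∫ r in I, f r * primKernel t r := by
  rw [prim, intervalIntegral.integral_of_le ht.2, integral_Ioc_eq_integral_Ioo]
  have e : (fun r => f r * primKernel t r) = (Ioo t 1).indicator f := by
    funext r
    by_cases hr : r ∈ Ioo t 1 <;> simp [primKernel, hr]
  rw [e, setIntegral_indicator measurableSet_Ioo, I,
    inter_eq_right.2 (Ioo_subset_Ioo_left ht.1)]

lemma prim_div_eq_integral_kernel (h : ℝ → ℝ) {t : ℝ} (ht : t ∈ Icc (-1 : ℝ) 1) :
    prim (fun r => h r / (1 + r)) t = -∫ r in I, h r * primDivKernel t r := by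
  rw [prim_eq_integral_kernel _ ht]
  congr 2
  funext r
  by_cases hr : r ∈ Ioo t 1 <;> simp [primKernel, primDivKernel, hr, div_eq_mul_inv]

lemma memLp_primKernel (t : ℝ) : MemLp (primKernel t) 2 volI :=
  MemLp.of_bound ((measurable_const.indicator measurableSet_Ioo).aestronglyMeasurable) 1
    (.of_forall fun r => by
      by_cases hr : r ∈ Ioo t 1 <;> simp [primKernel, hr])

lemma abs_primDivKernel_le {t : ℝ} (ht : t ∈ I) (r : ℝ) : |primDivKernel t r| ≤ (1 + t)⁻¹ := by
  have h1 : 0 < 1 + t := by linarith [ht.1]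
  by_cases hr : r ∈ Ioo t 1
  · have h2 : 1 + t ≤ 1 + r := by linarith [hr.1]
    rw [primDivKernel, indicator_of_mem hr, one_div, abs_of_pos (inv_pos.2 (by linarith))]
    exact inv_anti₀ h1 h2
  · rw [primDivKernel, indicator_of_notMem hr, abs_zero]; positivity

lemma memLp_primDivKernel {t : ℝ} (ht : t ∈ I) : MemLp (primDivKernel t) 2 volI :=
  MemLp.of_bound ((show Measurable fun r : ℝ => 1 / (1 + r) by fun_prop).indicator
    measurableSet_Ioo).aestronglyMeasurable ((1 + t)⁻¹) (.of_forall fun r =>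
      abs_primDivKernel_le ht r)

lemma integral_abs_le {f : ℝ → ℝ} (hf : MemLp f 2 volI) :
    ∫ t in I, |f t| ≤ 1 + ∫ t in I, f t ^ 2 := by
  have h1 : ∫ t in I, |f t| ≤ ∫ t in I, (1 / 2 + f t ^ 2) := by
    refine integral_mono (integrable_of_memLp hf).abs
      ((integrable_const _).add hf.integrable_sq) fun t => ?_
    simp only
    nlinarith [sq_nonneg (|f t| - 1 / 2), sq_abs (f t)]
  have h2 : ∫ t in I, (1 / 2 : ℝ) = 1 := by
    rw [setIntegral_const, I, Real.volume_real_Ioo_of_le (by norm_num)]; norm_num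
  rwa [integral_add (integrable_const _) hf.integrable_sq, h2] at h1

lemma abs_integral_mul_le {f k : ℝ → ℝ} {K : ℝ} (hf : MemLp f 2 volI) (hk : ∀ t, |k t| ≤ K)
    (hK : 0 ≤ K) : |∫ t in I, f t * k t| ≤ K * (1 + ∫ t in I, f t ^ 2) := by
  calc |∫ t in I, f t * k t| ≤ ∫ t in I, K * |f t| := by
        rw [← Real.norm_eq_abs]
        refine norm_integral_le_of_norm_le ((integrable_of_memLp hf).abs.const_mul K)
          (.of_forall fun t => ?_)
        rw [norm_mul, mul_comm]
        exact mul_le_mul_of_nonneg_right (hk t) (norm_nonneg _)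
    _ ≤ _ := by
        rw [integral_const_mul]
        exact mul_le_mul_of_nonneg_left (integral_abs_le hf) hK

/-- The kernel representing the primitive at t is at most 1/(1+t), which the factor 1+t cancels. For
h = (1+t)u'' this bounds (1+t)u' uniformly on I. -/
lemma abs_omega_prim_le {h : ℝ → ℝ} (hh : MemLp h 2 volI) {t : ℝ} (ht : t ∈ I) :
    |(1 + t) * prim (fun r => h r / (1 + r)) t| ≤ 1 + ∫ t in I, h t ^ 2 := by
  have h1 : 0 < 1 + t := by linarith [ht.1]
  rw [prim_div_eq_integral_kernel h ⟨ht.1.le, ht.2.le⟩, abs_mul, abs_neg, abs_of_pos h1]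
  have := abs_integral_mul_le hh (abs_primDivKernel_le ht) (by positivity)
  calc _ ≤ (1 + t) * ((1 + t)⁻¹ * (1 + ∫ t in I, h t ^ 2)) :=
        mul_le_mul_of_nonneg_left this h1.le
    _ = _ := by field_simp

lemma abs_prim_le {g : ℝ → ℝ} (hg : MemLp g 2 volI) {t : ℝ} (ht : t ∈ Icc (-1 : ℝ) 1) :
    |prim g t| ≤ 1 + ∫ t in I, g t ^ 2 := by
  rw [prim_eq_integral_kernel g ht, abs_neg]
  have := abs_integral_mul_le hg (k := primKernel t) (K := 1) (fun r => by
      by_cases hr : r ∈ Ioo t 1 <;> simp [primKernel, hr]) zero_le_one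
  linarith

/-! ### Completeness -/

section Completeness

variable {l : ℕ} {σ m M : ℝ} {c d e : ℝ → ℝ}

lemma omegaD2_sub {u v : ℝ → ℝ} (hu : u ∈ H20) (hv : v ∈ H20) :
    omegaD2 (u - v) =ᵐ[volI] omegaD2 u - omegaD2 v := by
  filter_upwards [((weakDeriv_two_spec hu).sub (weakDeriv_two_spec hv)).weakDeriv_ae] with t ht
  simp only [omegaD2, Pi.sub_apply, ht]; ring

lemma weakDeriv_one_sub {u v : ℝ → ℝ} (hu : u ∈ H20) (hv : v ∈ H20) :
    weakDeriv 1 (u - v) =ᵐ[volI] weakDeriv 1 u - weakDeriv 1 v :=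
  ((weakDeriv_one_spec hu).sub (weakDeriv_one_spec hv)).weakDeriv_ae

lemma divOmega_sub (u v : ℝ → ℝ) : divOmega (u - v) = divOmega u - divOmega v := by
  funext t; simp [divOmega, sub_div]

lemma integral_sq_congr {f g : ℝ → ℝ} (h : f =ᵐ[volI] g) :
    ∫ t in I, f t ^ 2 = ∫ t in I, g t ^ 2 := by
  refine integral_congr_ae ?_
  filter_upwards [h] with t ht
  rw [ht]

/-- The limit of a sequence of `H20` that is Cauchy for `‖(1 + t) u''‖`. -/
lemma exists_limit_H20 {x : ℕ → ℝ → ℝ} (hx : ∀ n, x n ∈ H20)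
    (hc : ∀ ε > 0, ∃ N, ∀ i ≥ N, ∀ j ≥ N, ∫ t in I, omegaD2 (x i - x j) t ^ 2 < ε) :
    ∃ u ∈ H20, Tendsto (fun n => ∫ t in I, omegaD2 (x n - u) t ^ 2) atTop (𝓝 0) := by
  have hsub : ∀ i j, x i - x j ∈ H20 := fun i j => H20sub.sub_mem (hx i) (hx j)
  obtain ⟨h, hh, hlimh⟩ := exists_L2_limit (fun n => memLp_omegaD2 (hx n)) (by
    intro ε hε
    obtain ⟨N, hN⟩ := hc ε hε
    refine ⟨N, fun i hi j hj => ?_⟩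
    rw [← integral_sq_congr (f := omegaD2 (x i - x j))
      (g := fun t => omegaD2 (x i) t - omegaD2 (x j) t) (omegaD2_sub (hx i) (hx j))]
    exact hN i hi j hj)
  obtain ⟨g, hg, hlimg⟩ := exists_L2_limit (fun n => memLp_weakDeriv_one (hx n)) (by
    intro ε hε
    obtain ⟨N, hN⟩ := hc (ε / 4) (by positivity)
    refine ⟨N, fun i hi j hj => ?_⟩
    rw [← integral_sq_congr (f := weakDeriv 1 (x i - x j))
      (g := fun t => weakDeriv 1 (x i) t - weakDeriv 1 (x j) t) (weakDeriv_one_sub (hx i) (hx j))]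
    linarith [hN i hi j hj, hardy_weakDeriv (hsub i j)])
  obtain ⟨f, hf, hlimf⟩ := exists_L2_limit (fun n => memLp_divOmega (hx n)) (by
    intro ε hε
    obtain ⟨N, hN⟩ := hc (ε / 16) (by positivity)
    refine ⟨N, fun i hi j hj => ?_⟩
    rw [← integral_sq_congr (f := divOmega (x i - x j))
      (g := fun t => divOmega (x i) t - divOmega (x j) t) (by rw [divOmega_sub]; rfl)]
    linarith [hN i hi j hj, hardy_weakDeriv (hsub i j), hardy_divOmega (hsub i j)])
  have hprof := fun n => profile_omegaD2 (hx n)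
  -- The three L² limits are tied together through primitives: evaluating a primitive at a point is
  -- an L²-continuous functional, so the primitives converge pointwise and identify the limits.
  have e1 : g =ᵐ[volI] prim fun t => h t / (1 + t) := by
    refine ae_eq_of_tendsto (F := fun n => prim fun t => omegaD2 (x n) t / (1 + t))
      (fun n => (hprof n).g_mem) hg (hlimg.congr fun n => integral_congr_ae ?_) fun t ht => ?_
    · filter_upwards [weakDeriv_one_ae (hx n)] with t ht
      rw [ht]
    · have ht' : t ∈ Icc (-1 : ℝ) 1 := ⟨ht.1.le, ht.2.le⟩
      simp only [prim_div_eq_integral_kernel _ ht']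
      exact (tendsto_integral_mul (fun n => memLp_omegaD2 (hx n)) hh hlimh
        (memLp_primDivKernel ht)).neg
  have hU : ∀ t ∈ Icc (-1 : ℝ) 1,
      Tendsto (fun n => prim (weakDeriv 1 (x n)) t) atTop (𝓝 (prim g t)) := by
    intro t ht
    simp only [prim_eq_integral_kernel _ ht]
    exact (tendsto_integral_mul (fun n => memLp_weakDeriv_one (hx n)) hg hlimg
      (memLp_primKernel t)).neg
  have hxU : ∀ n, x n =ᵐ[volI] prim (weakDeriv 1 (x n)) := by
    intro n
    filter_upwards [(hprof n).u_ae, ae_restrict_mem measurableSet_I] with t h1 h2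
    rw [h1, prim_congr (weakDeriv_one_ae (hx n)) ⟨h2.1.le, h2.2.le⟩]
  have e2 : (fun t => (1 + t) * f t) =ᵐ[volI] prim g := by
    refine ae_eq_of_tendsto (F := fun n => prim (weakDeriv 1 (x n)))
      (fun n => (memLp_of_mem_H20 (hx n)).ae_eq (hxU n)) (memLp_omega_mul hf) ?_
      fun t ht => hU t ⟨ht.1.le, ht.2.le⟩
    have h1 : Tendsto (fun n => 4 * ∫ t in I, (divOmega (x n) t - f t) ^ 2) atTop (𝓝 0) := by
      simpa using hlimf.const_mul 4
    refine squeeze_zero (fun n => integral_sq_nonneg _) (fun n => ?_) h1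
    refine le_trans (le_of_eq (integral_congr_ae ?_))
      (integral_sq_omega_le ((memLp_divOmega (hx n)).sub hf))
    filter_upwards [hxU n, ae_eq_omega_divOmega (x n)] with t h1 h2
    rw [← h1, h2]; ring
  -- The condition at −1 survives because evaluating the primitive of u' at −1 is also continuous in
  -- L².
  have ez : prim g (-1) = 0 := by
    refine tendsto_nhds_unique (hU (-1) (by simp)) ?_
    have : ∀ n, prim (weakDeriv 1 (x n)) (-1) = 0 := fun n => by
      rw [prim_congr (weakDeriv_one_ae (hx n)) (by simp), (hprof n).zero]
    simp only [this]
    exact tendsto_const_nhds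
  have hp : Profile (fun t => (1 + t) * f t) h := by
    refine ⟨hh, hg.ae_eq e1, hf.ae_eq ?_, e2.trans ?_, ?_⟩
    · filter_upwards [ae_restrict_mem measurableSet_I] with t ht
      have : 1 + t ≠ 0 := by linarith [ht.1]
      field_simp
    · filter_upwards [ae_restrict_mem measurableSet_I] with t ht
      exact prim_congr e1 ⟨ht.1.le, ht.2.le⟩
    · rw [← prim_congr e1 (by simp), ez]
  refine ⟨_, hp.mem_H20, hlimh.congr fun n => integral_sq_congr ?_⟩
  filter_upwards [omegaD2_sub (hx n) hp.mem_H20, hp.isWeakDeriv_two.weakDeriv_ae,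
    ae_restrict_mem measurableSet_I] with t h1 h2 h3
  have : 1 + t ≠ 0 := by linarith [h3.1]
  rw [h1, Pi.sub_apply]
  congr 1
  rw [omegaD2, h2]; field_simp

/-- Coercivity and boundedness make the energy norm equivalent to ‖(1+t)u''‖, for which
`exists_limit_H20` provides limits. -/
lemma isCompleteFor_bilinA (hl : 1 ≤ l) (h : Admissible c d e m M) :
    IsCompleteFor (bilinA l σ h) ⊤ := by
  intro x _ hcau
  set K := (2 + 2 * M ^ 2) / m with hK
  have hK0 : 0 < K := div_pos (by positivity) h.pos
  obtain ⟨u, hu, hlim⟩ := exists_limit_H20 (x := fun n => (x n : ℝ → ℝ)) (fun n => (x n).2) (by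
    intro ε hε
    obtain ⟨N, hN⟩ := hcau (ε / K) (by positivity)
    refine ⟨N, fun i hi j hj => ?_⟩
    have h1 := hN i hi j hj
    have h2 := omegaD2_le_genForm (σ := σ) hl h (x i - x j).2
    rw [bilinA_apply] at h1
    rw [lt_div_iff₀ hK0, mul_comm] at h1
    exact h2.trans_lt h1)
  refine ⟨⟨u, hu⟩, trivial, ?_⟩
  refine squeeze_zero (fun n => (isPsd_bilinA h).nonneg _)
    (fun n => genForm_le h (show ((x n - ⟨u, hu⟩ : H20sub) : ℝ → ℝ) ∈ H20 from Subtype.property _)) ?_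
  simpa using hlim.const_mul (M * (324 + 64 * (l * (l + 1) : ℝ) ^ 2 + 512 * σ ^ 2 * M ^ 2
      + 256 * σ ^ 2))

/-! ### Compactness -/

/-- Dominated convergence on a bounded interval turns pointwise convergence with a uniform bound
into L² convergence. -/
lemma cauchy_of_pointwise {F : ℕ → ℝ → ℝ} {K : ℝ} (hF : ∀ n, AEStronglyMeasurable (F n) volI)
    (hb : ∀ n, ∀ t ∈ I, |F n t| ≤ K) (hl : ∀ t ∈ I, ∃ ℓ, Tendsto (fun n => F n t) atTop (𝓝 ℓ)) :
    ∀ ε > 0, ∃ N, ∀ i ≥ N, ∀ j ≥ N, ∫ t in I, (F i t - F j t) ^ 2 < ε := by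
  choose! f hf using hl
  have hfm : AEStronglyMeasurable f volI := by
    refine aestronglyMeasurable_of_tendsto_ae atTop hF ?_
    filter_upwards [ae_restrict_mem measurableSet_I] with t ht using hf t ht
  have hfb : ∀ t ∈ I, |f t| ≤ K := fun t ht => le_of_tendsto' (hf t ht).abs fun n => hb n t ht
  have hmF : ∀ n, MemLp (F n) 2 volI := fun n => MemLp.of_bound (hF n) K (by
    filter_upwards [ae_restrict_mem measurableSet_I] with t ht using hb n t ht)
  have hmf : MemLp f 2 volI := MemLp.of_bound hfm K (by
    filter_upwards [ae_restrict_mem measurableSet_I] with t ht using hfb t ht)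
  have hlim : Tendsto (fun n => ∫ t in I, (F n t - f t) ^ 2) atTop (𝓝 (∫ t in I, (0 : ℝ))) := by
    refine tendsto_integral_of_dominated_convergence (fun _ => (2 * K) ^ 2)
      (fun n => ((hF n).sub hfm).pow 2) (integrable_const _) (fun n => ?_) ?_
    · filter_upwards [ae_restrict_mem measurableSet_I] with t ht
      rw [Real.norm_of_nonneg (sq_nonneg _), ← sq_abs]
      refine pow_le_pow_left₀ (abs_nonneg _) ?_ 2
      linarith [abs_sub (F n t) (f t), hb n t ht, hfb t ht]
    · filter_upwards [ae_restrict_mem measurableSet_I] with t ht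
      have := ((hf t ht).sub_const (f t)).pow 2
      simpa using this
  rw [integral_zero] at hlim
  intro ε hε
  obtain ⟨N, hN⟩ := (hlim.eventually (gt_mem_nhds (show 0 < ε / 4 by positivity))).exists_forall_of_atTop
  refine ⟨N, fun i hi j hj => ?_⟩
  have h1 := integral_sq_add_le ((hmF i).sub hmf) (hmf.sub (hmF j))
  have e1 : ∫ t in I, (F i t - F j t) ^ 2 =
      ∫ t in I, ((F i - f) t + (f - F j) t) ^ 2 :=
    integral_congr_ae (.of_forall fun t => by simp only [Pi.sub_apply]; ring)
  have e2 : ∫ t in I, (f - F j) t ^ 2 = ∫ t in I, (F j t - f t) ^ 2 :=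
    integral_congr_ae (.of_forall fun t => by simp only [Pi.sub_apply]; ring)
  have e3 : ∫ t in I, (F i - f) t ^ 2 = ∫ t in I, (F i t - f t) ^ 2 := rfl
  rw [e2, e3] at h1
  rw [e1]
  linarith [hN i hi, hN j hj]

/-- `H20` is compactly embedded in the energy space of `B`. -/
lemma exists_formB_cauchy_subseq (R : ℝ) {x : ℕ → ℝ → ℝ} (hx : ∀ n, x n ∈ H20) {M : ℝ}
    (hM : ∀ n, ∫ t in I, omegaD2 (x n) t ^ 2 ≤ M) :
    ∃ φ : ℕ → ℕ, StrictMono φ ∧ ∀ ε > 0, ∃ N, ∀ i ≥ N, ∀ j ≥ N,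
      formB R l (x (φ i) - x (φ j)) (x (φ i) - x (φ j)) < ε := by
  -- Weak convergence of (1+t)u'' is tested against the kernels, giving convergence of u'(t) at
  -- every t in I. The uniform bounds on (1+t)u' and on u then upgrade pointwise to L² convergence.
  obtain ⟨φ, hφ, hweak⟩ := exists_weak_subseq (fun n => memLp_omegaD2 (hx n)) hM
  refine ⟨φ, hφ, ?_⟩
  set y : ℕ → ℝ → ℝ := fun n => x (φ n) with hy
  have hyH : ∀ n, y n ∈ H20 := fun n => hx _
  have hyM : ∀ n, ∫ t in I, omegaD2 (y n) t ^ 2 ≤ M := fun n => hM _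
  set G : ℕ → ℝ → ℝ := fun n => prim fun t => omegaD2 (y n) t / (1 + t) with hG
  have hprof : ∀ n, Profile (y n) (omegaD2 (y n)) := fun n => profile_omegaD2 (hyH n)
  have hGlim : ∀ t ∈ I, ∃ ℓ, Tendsto (fun n => G n t) atTop (𝓝 ℓ) := by
    intro t ht
    obtain ⟨ℓ, hℓ⟩ := hweak _ (memLp_primDivKernel ht)
    refine ⟨-ℓ, hℓ.neg.congr fun n => ?_⟩
    rw [hG]
    simp only
    rw [prim_div_eq_integral_kernel _ ⟨ht.1.le, ht.2.le⟩]
  have hGb : ∀ n, ∀ t ∈ I, |(1 + t) * G n t| ≤ 1 + M := fun n t ht =>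
    (abs_omega_prim_le (hprof n).h_mem ht).trans (by linarith [hyM n])
  have hGsq : ∀ n, ∫ t in I, G n t ^ 2 ≤ 4 * M := by
    intro n
    rw [← integral_sq_congr (weakDeriv_one_ae (hyH n))]
    linarith [hardy_weakDeriv (hyH n), hyM n]
  have hM0 : 0 ≤ M := (integral_sq_nonneg _).trans (hM 0)
  -- On (t,1) the derivatives are dominated by the constant (1+M)/(1+t), so the pointwise limit
  -- passes under the integral.
  have hUlim : ∀ t ∈ I, ∃ ℓ, Tendsto (fun n => prim (G n) t) atTop (𝓝 ℓ) := by
    intro t ht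
    choose! g hg using hGlim
    have h1 : 0 < 1 + t := by linarith [ht.1]
    refine ⟨-∫ r in t..1, g r, ?_⟩
    simp only [prim]
    refine (intervalIntegral.tendsto_integral_filter_of_dominated_convergence
      (fun _ => (1 + M) / (1 + t)) (.of_forall fun n => ?_) (.of_forall fun n => ?_)
      (by simp) ?_).neg
    · rw [uIoc_of_le ht.2.le]; exact ((hprof n).intervalIntegrable_g ht).1.aestronglyMeasurable
    · have hne : ∀ᵐ r : ℝ, r ≠ 1 := by simp [ae_iff, measure_singleton]
      filter_upwards [hne] with r hr1 hr
      rw [uIoc_of_le ht.2.le] at hr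
      have hrI : r ∈ I := ⟨ht.1.trans hr.1, lt_of_le_of_ne hr.2 hr1⟩
      have h2 := hGb n r hrI
      have h3 : 0 < 1 + r := by linarith [hrI.1]
      rw [abs_mul, abs_of_pos h3] at h2
      rw [Real.norm_eq_abs, le_div_iff₀ h1]
      nlinarith [abs_nonneg (G n r), hr.1]
    · have hne : ∀ᵐ r : ℝ, r ≠ 1 := by simp [ae_iff, measure_singleton]
      filter_upwards [hne] with r hr1 hr
      rw [uIoc_of_le ht.2.le] at hr
      exact hg r ⟨ht.1.trans hr.1, lt_of_le_of_ne hr.2 hr1⟩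
  have hc1 := cauchy_of_pointwise (F := fun n t => (1 + t) * G n t)
    (fun n => (memLp_omega_mul (hprof n).g_mem).1) hGb (fun t ht => by
      obtain ⟨ℓ, hℓ⟩ := hGlim t ht
      exact ⟨_, hℓ.const_mul (1 + t)⟩)
  have hc2 := cauchy_of_pointwise (F := fun n => prim (G n)) (K := 1 + 4 * M)
    (fun n => (memLp_of_mem_H20 (hyH n)).1.congr (hprof n).u_ae)
    (fun n t ht => (abs_prim_le (hprof n).g_mem ⟨ht.1.le, ht.2.le⟩).trans (by linarith [hGsq n]))
    hUlim
  intro ε hε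
  have hk0 : (0 : ℝ) ≤ l * (l + 1) := by positivity
  set k : ℝ := l * (l + 1) with hk
  set D : ℝ := (R ^ 2 / 4 + 1) * (1 + k) with hD
  have hD0 : 0 < D := by positivity
  obtain ⟨N₁, hN₁⟩ := hc1 (ε / D) (by positivity)
  obtain ⟨N₂, hN₂⟩ := hc2 (ε / D) (by positivity)
  refine ⟨max N₁ N₂, fun i hi j hj => ?_⟩
  have h1 := hN₁ i (le_of_max_le_left hi) j (le_of_max_le_left hj)
  have h2 := hN₂ i (le_of_max_le_right hi) j (le_of_max_le_right hj)
  have e1 : ∫ t in I, ((1 + t) * weakDeriv 1 (y i - y j) t) ^ 2 =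
      ∫ t in I, ((1 + t) * G i t - (1 + t) * G j t) ^ 2 := by
    refine integral_congr_ae ?_
    filter_upwards [weakDeriv_one_sub (hyH i) (hyH j), weakDeriv_one_ae (hyH i),
      weakDeriv_one_ae (hyH j)] with t h3 h4 h5
    rw [h3, Pi.sub_apply, h4, h5]; ring
  have e2 : ∫ t in I, (y i - y j) t ^ 2 = ∫ t in I, (prim (G i) t - prim (G j) t) ^ 2 := by
    refine integral_congr_ae ?_
    filter_upwards [(hprof i).u_ae, (hprof j).u_ae] with t h3 h4
    rw [Pi.sub_apply, h3, h4]
  change formB R l (y i - y j) (y i - y j) < ε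
  rw [formB_self, e1, e2, ← hk]
  have h5 : 0 ≤ ∫ t in I, (prim (G i) t - prim (G j) t) ^ 2 := integral_sq_nonneg _
  have h6 : 0 ≤ ∫ t in I, ((1 + t) * G i t - (1 + t) * G j t) ^ 2 := integral_sq_nonneg _
  set X := ∫ t in I, ((1 + t) * G i t - (1 + t) * G j t) ^ 2
  set Y := ∫ t in I, (prim (G i) t - prim (G j) t) ^ 2
  have hR : 0 ≤ R ^ 2 / 4 := by positivity
  have hsum : X + k * Y ≤ (1 + k) * max X Y := by
    have h7 := mul_le_mul_of_nonneg_left (le_max_right X Y) hk0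
    linarith [le_max_left X Y]
  have hmax : max X Y < ε / D := max_lt h1 h2
  have hmax0 : 0 ≤ max X Y := h6.trans (le_max_left _ _)
  calc R ^ 2 / 4 * (X + k * Y) ≤ (R ^ 2 / 4 + 1) * ((1 + k) * max X Y) :=
        mul_le_mul (by linarith) hsum (by positivity) (by positivity)
    _ = D * max X Y := by rw [hD]; ring
    _ < D * (ε / D) := mul_lt_mul_of_pos_left hmax hD0
    _ = ε := by field_simp

lemma isCompactFor_bilin (R : ℝ) (hl : 1 ≤ l) (h : Admissible c d e m M) :
    IsCompactFor (bilinA l σ h) (bilinB R l) := by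
  intro x ⟨M', hM'⟩
  have hK0 : 0 ≤ (2 + 2 * M ^ 2) / m := div_nonneg (by positivity) h.pos.le
  exact exists_formB_cauchy_subseq R (fun n => (x n).2) (fun n =>
    (omegaD2_le_genForm (σ := σ) hl h (x n).2).trans (mul_le_mul_of_nonneg_left (hM' n) hK0))

end Completeness

/-! ### Cutoff functions -/

/-- A smooth cutoff in `I`, equal to `1` where `n (1 - t²) ≥ 2`. -/
noncomputable def cutoff (n : ℕ) (t : ℝ) : ℝ := Real.smoothTransition (n * (1 - t ^ 2) - 1)

lemma contDiff_cutoff (n : ℕ) : ContDiff ℝ ∞ (cutoff n) :=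
  Real.smoothTransition.contDiff.comp (by fun_prop)

lemma cutoff_eq_zero {n : ℕ} {t : ℝ} (h : n * (1 - t ^ 2) ≤ 1) : cutoff n t = 0 :=
  Real.smoothTransition.zero_of_nonpos (by linarith)

lemma abs_cutoff_le (n : ℕ) (t : ℝ) : |cutoff n t| ≤ 1 := by
  rw [cutoff, abs_of_nonneg (Real.smoothTransition.nonneg _)]
  exact Real.smoothTransition.le_one _

lemma tsupport_cutoff_subset (n : ℕ) : tsupport (cutoff n) ⊆ I := by
  have h1 : tsupport (cutoff n) ⊆ {t : ℝ | 1 ≤ (n : ℝ) * (1 - t ^ 2)} := by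
    refine closure_minimal (fun t ht => ?_) (isClosed_le (by fun_prop) (by fun_prop))
    by_contra h
    exact ht (cutoff_eq_zero (not_le.1 h).le)
  refine h1.trans fun t (ht : 1 ≤ (n : ℝ) * (1 - t ^ 2)) => ?_
  have h2 : 0 < 1 - t ^ 2 := by
    by_contra! h3
    nlinarith [Nat.cast_nonneg (α := ℝ) n]
  exact abs_lt.1 ((sq_lt_one_iff_abs_lt_one t).1 (by linarith))

lemma isTest_mul_cutoff (n : ℕ) (p : ℝ[X]) : IsTest (fun t => p.eval t * cutoff n t) := by
  have hs : tsupport (fun t => p.eval t * cutoff n t) ⊆ tsupport (cutoff n) :=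
    tsupport_mul_subset_right
  refine ⟨(p.contDiff_aeval _).mul (contDiff_cutoff n), ?_, hs.trans (tsupport_cutoff_subset n)⟩
  refine HasCompactSupport.of_support_subset_isCompact (isCompact_Icc (a := (-1 : ℝ)) (b := 1)) ?_
  exact (subset_tsupport _).trans ((hs.trans (tsupport_cutoff_subset n)).trans Ioo_subset_Icc_self)

lemma one_sub_sq_pos {t : ℝ} (ht : t ∈ I) : 0 < 1 - t ^ 2 := by
  nlinarith [ht.1, ht.2]

lemma eventually_two_lt {t : ℝ} (ht : t ∈ I) : ∀ᶠ n : ℕ in atTop, 2 < (n : ℝ) * (1 - t ^ 2) :=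
  (tendsto_natCast_atTop_atTop.atTop_mul_const (one_sub_sq_pos ht)).eventually_gt_atTop 2

lemma cutoff_eventually_eq_one {n : ℕ} {t : ℝ} (h : 2 < (n : ℝ) * (1 - t ^ 2)) :
    cutoff n =ᶠ[𝓝 t] fun _ => 1 := by
  have : ∀ᶠ r in 𝓝 t, 2 < (n : ℝ) * (1 - r ^ 2) :=
    (show Continuous fun r : ℝ => (n : ℝ) * (1 - r ^ 2) by fun_prop).continuousAt.eventually
      (lt_mem_nhds h)
  filter_upwards [this] with r hr
  exact Real.smoothTransition.one_of_one_le (by linarith)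

/-- With y = n(1−t²) and χ the smooth transition, the product is −2t · yχ'(y−1). Since yχ'(y−1) is
continuous and supported in [1,2], the bound is uniform in n. -/
lemma exists_deriv_cutoff_bound :
    ∃ K : ℝ, ∀ n : ℕ, ∀ t ∈ I, |(1 - t ^ 2) * deriv (cutoff n) t| ≤ K := by
  have hcont : Continuous fun y : ℝ => y * deriv Real.smoothTransition (y - 1) :=
    continuous_id.mul ((Real.smoothTransition.contDiff (n := 1).continuous_deriv le_rfl).comp
      (by fun_prop))
  have hsupp : HasCompactSupport fun y : ℝ => y * deriv Real.smoothTransition (y - 1) := by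
    refine HasCompactSupport.intro (isCompact_Icc (a := (1 : ℝ)) (b := 2)) fun y hy => ?_
    have h0 : deriv Real.smoothTransition (y - 1) = 0 := by
      rcases lt_or_ge y 1 with h | h
      · have : Real.smoothTransition =ᶠ[𝓝 (y - 1)] fun _ => 0 := by
          filter_upwards [gt_mem_nhds (show y - 1 < 0 by linarith)] with r hr
          exact Real.smoothTransition.zero_of_nonpos hr.le
        rw [this.deriv_eq]; simp
      · have h2 : 2 < y := by by_contra! h3; exact hy ⟨h, h3⟩
        have : Real.smoothTransition =ᶠ[𝓝 (y - 1)] fun _ => 1 := by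
          filter_upwards [lt_mem_nhds (show 1 < y - 1 by linarith)] with r hr
          exact Real.smoothTransition.one_of_one_le hr.le
        rw [this.deriv_eq]; simp
    rw [h0, mul_zero]
  obtain ⟨K, hK⟩ := hcont.bounded_above_of_compact_support hsupp
  refine ⟨2 * K, fun n t ht => ?_⟩
  have hd : HasDerivAt (cutoff n)
      (deriv Real.smoothTransition (n * (1 - t ^ 2) - 1) * (-(2 * n * t))) t := by
    have h1 : HasDerivAt (fun r : ℝ => (n : ℝ) * (1 - r ^ 2) - 1) (-(2 * n * t)) t := by
      have := ((((hasDerivAt_id t).pow 2).const_sub 1).const_mul (n : ℝ)).sub_const 1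
      convert! this using 1
      simp; ring
    exact ((Real.smoothTransition.contDiff (n := 1)).differentiable (by simp)
      _).hasDerivAt.comp t h1
  rw [hd.deriv]
  have h2 := hK (n * (1 - t ^ 2))
  rw [Real.norm_eq_abs] at h2
  have e : (1 - t ^ 2) * (deriv Real.smoothTransition (n * (1 - t ^ 2) - 1) * (-(2 * n * t))) =
      (n * (1 - t ^ 2) * deriv Real.smoothTransition (n * (1 - t ^ 2) - 1)) * (-2 * t) := by ring
  rw [e, abs_mul, mul_comm (2 : ℝ)]
  refine mul_le_mul h2 ?_ (abs_nonneg _) ((abs_nonneg _).trans h2)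
  rw [abs_le]; constructor <;> linarith [ht.1, ht.2]

/-! ### Weighted integration by parts -/

/-- The polynomial `1 - X²`. -/
noncomputable def bump : ℝ[X] := 1 - X ^ 2

@[simp] lemma eval_bump (t : ℝ) : bump.eval t = 1 - t ^ 2 := by simp [bump]

lemma exists_poly_bound (p : ℝ[X]) : ∃ K : ℝ, 0 ≤ K ∧ ∀ t ∈ I, |p.eval t| ≤ K := by
  obtain ⟨K, hK⟩ := isCompact_Icc.exists_bound_of_continuousOn (s := Icc (-1 : ℝ) 1)
    p.continuous.continuousOn
  exact ⟨K, (norm_nonneg _).trans (hK 0 (by simp)), fun t ht => hK t (Ioo_subset_Icc_self ht)⟩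

lemma integrable_mul_poly {f : ℝ → ℝ} (hf : Integrable f volI) (p : ℝ[X]) :
    Integrable (fun t => f t * p.eval t) volI := by
  obtain ⟨K, -, hK⟩ := exists_poly_bound p
  refine hf.mul_bdd (c := K) p.continuous.aestronglyMeasurable ?_
  filter_upwards [ae_restrict_mem measurableSet_I] with t ht using hK t ht

/-- Differentiation loses only one power of 1−t², and the remaining i powers are what makes the
product with f integrable. -/
lemma derivative_bump_pow_mul (i : ℕ) (p : ℝ[X]) : derivative (bump ^ (i + 1) * p) =
    bump ^ i * (C ((i : ℝ) + 1) * derivative bump * p + bump * derivative p) := by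
  rw [derivative_mul, derivative_pow_succ]; ring

/-- The weak derivative is tested with P times the cutoff. The term with the derivative of the
cutoff is dominated by a multiple of |(1−t²)^i f|, since P supplies one extra factor 1−t², and it
tends to zero pointwise. -/
lemma weak_integral_by_parts {f g : ℝ → ℝ} (h : IsWeakDeriv 1 f g) (i : ℕ)
    (hf : Integrable (fun t => (1 - t ^ 2) ^ i * f t) volI)
    (hg : Integrable (fun t => (1 - t ^ 2) ^ (i + 1) * g t) volI) (p : ℝ[X]) :
    ∫ t in I, g t * (bump ^ (i + 1) * p).eval t =
      -∫ t in I, f t * (derivative (bump ^ (i + 1) * p)).eval t := by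
  obtain ⟨K, hK⟩ := exists_deriv_cutoff_bound
  set P := bump ^ (i + 1) * p with hP
  set r := C ((i : ℝ) + 1) * derivative bump * p + bump * derivative p with hr
  have hP' : derivative P = bump ^ i * r := derivative_bump_pow_mul i p
  obtain ⟨Kp, hKp0, hKp⟩ := exists_poly_bound p
  obtain ⟨Kr, hKr0, hKr⟩ := exists_poly_bound r
  have hstep : ∀ n : ℕ, ∫ t in I, f t * ((derivative P).eval t * cutoff n t +
      P.eval t * deriv (cutoff n) t) = -∫ t in I, g t * (P.eval t * cutoff n t) := by
    intro n
    have h1 := h.test (isTest_mul_cutoff n P)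
    rw [iteratedDeriv_one, pow_one, neg_one_mul] at h1
    have e : ∀ t, deriv (fun t => P.eval t * cutoff n t) t =
        (derivative P).eval t * cutoff n t + P.eval t * deriv (cutoff n) t := fun t =>
      ((P.hasDerivAt t).mul (((contDiff_cutoff n).differentiable (by simp)) t).hasDerivAt).deriv
    simp only [e, mul_comm (_ + _) (f _), mul_comm (_ * _) (g _)] at h1
    exact h1
  have hlim1 : Tendsto (fun n : ℕ => ∫ t in I, g t * (P.eval t * cutoff n t)) atTop
      (𝓝 (∫ t in I, g t * P.eval t)) := by
    refine tendsto_integral_of_dominated_convergence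
      (fun t => Kp * |(1 - t ^ 2) ^ (i + 1) * g t|) (fun n => ?_) (hg.abs.const_mul Kp)
      (fun n => ?_) ?_
    · exact h.2.1.aestronglyMeasurable.mul
        (P.continuous.mul (contDiff_cutoff n).continuous).aestronglyMeasurable
    · filter_upwards [ae_restrict_mem measurableSet_I] with t ht
      have h1 := hKp t ht
      have h2 := abs_cutoff_le n t
      rw [Real.norm_eq_abs, hP, eval_mul, eval_pow, eval_bump]
      have e : g t * ((1 - t ^ 2) ^ (i + 1) * p.eval t * cutoff n t) =
        (p.eval t * cutoff n t) * ((1 - t ^ 2) ^ (i + 1) * g t) := by ring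
      rw [e, abs_mul, abs_mul (p.eval t)]
      refine mul_le_mul_of_nonneg_right ?_ (abs_nonneg _)
      calc _ ≤ Kp * 1 := mul_le_mul h1 h2 (abs_nonneg _) hKp0
        _ = Kp := mul_one _
    · filter_upwards [ae_restrict_mem measurableSet_I] with t ht
      refine tendsto_const_nhds.congr' ?_
      filter_upwards [eventually_two_lt ht] with n hn
      rw [(cutoff_eventually_eq_one hn).eq_of_nhds, mul_one]
  have hlim2 : Tendsto (fun n : ℕ => ∫ t in I, f t * ((derivative P).eval t * cutoff n t +
      P.eval t * deriv (cutoff n) t)) atTop (𝓝 (∫ t in I, f t * (derivative P).eval t)) := by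
    refine tendsto_integral_of_dominated_convergence
      (fun t => (Kr + Kp * K) * |(1 - t ^ 2) ^ i * f t|) (fun n => ?_) (hf.abs.const_mul _)
      (fun n => ?_) ?_
    · refine h.1.aestronglyMeasurable.mul (Continuous.aestronglyMeasurable ?_)
      exact ((derivative P).continuous.mul (contDiff_cutoff n).continuous).add
        (P.continuous.mul ((contDiff_cutoff n).continuous_deriv (by simp)))
    · filter_upwards [ae_restrict_mem measurableSet_I] with t ht
      rw [Real.norm_eq_abs, hP', hP, eval_mul, eval_mul, eval_pow, eval_pow, eval_bump]
      have e : f t * ((1 - t ^ 2) ^ i * r.eval t * cutoff n t +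
          (1 - t ^ 2) ^ (i + 1) * p.eval t * deriv (cutoff n) t) =
          (r.eval t * cutoff n t + p.eval t * ((1 - t ^ 2) * deriv (cutoff n) t)) *
            ((1 - t ^ 2) ^ i * f t) := by ring
      rw [e, abs_mul]
      refine mul_le_mul_of_nonneg_right ((abs_add_le _ _).trans (add_le_add ?_ ?_)) (abs_nonneg _)
      · rw [abs_mul]
        calc _ ≤ Kr * 1 := mul_le_mul (hKr t ht) (abs_cutoff_le n t) (abs_nonneg _) hKr0
          _ = Kr := mul_one _
      · rw [abs_mul]
        exact mul_le_mul (hKp t ht) (hK n t ht) (abs_nonneg _) hKp0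
    · filter_upwards [ae_restrict_mem measurableSet_I] with t ht
      refine tendsto_const_nhds.congr' ?_
      filter_upwards [eventually_two_lt ht] with n hn
      have h1 := cutoff_eventually_eq_one hn
      rw [h1.eq_of_nhds, h1.deriv_eq]; simp
  have h3 := tendsto_nhds_unique (hlim2.congr hstep) hlim1.neg
  rw [h3, neg_neg]

/-- A chain of weak derivatives with the integrability needed for weighted integration by
parts. -/
structure WeakChain (j : ℕ) (G : ℕ → ℝ → ℝ) : Prop where
  integrable : ∀ i ≤ j, Integrable (fun t => (1 - t ^ 2) ^ i * G i t) volI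
  weak : ∀ i < j, IsWeakDeriv 1 (G i) (G (i + 1))

lemma WeakChain.integral_eq {j : ℕ} {G : ℕ → ℝ → ℝ} (h : WeakChain j G) :
    ∀ i ≤ j, ∀ p : ℝ[X], ∫ t in I, G i t * (bump ^ i * p).eval t =
      (-1) ^ i * ∫ t in I, G 0 t * (derivative^[i] (bump ^ i * p)).eval t := by
  intro i
  induction i with
  | zero => intro _ p; simp
  | succ i ih =>
    intro hi p
    rw [weak_integral_by_parts (h.weak i hi) i (h.integrable i (by omega)) (h.integrable _ hi) p,
      Function.iterate_succ_apply, derivative_bump_pow_mul, ih (by omega), pow_succ]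
    ring

lemma weakChain_polynomial (j : ℕ) (q : ℝ[X]) :
    WeakChain j (fun i t => (derivative^[i] q).eval t) where
  integrable i _ := by
    have := integrable_mul_poly (integrable_const (1 : ℝ)) (bump ^ i * derivative^[i] q)
    simpa using this
  weak i _ := (isWeakDeriv_polynomial i q).of_succ (isWeakDeriv_polynomial (i + 1) q)

/-! ### Legendre polynomials -/

/-- The operator `q ↦ (-1)^j ∂^j ((1 - X²)^j ∂^j q)`. -/
noncomputable def sturm (j : ℕ) (q : ℝ[X]) : ℝ[X] :=
  (-1) ^ j * derivative^[j] (bump ^ j * derivative^[j] q)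

/-- The eigenvalue of `sturm j` on polynomials of degree `k`. -/
def sturmEigenvalue (j k : ℕ) : ℕ := (k + j).descFactorial j * k.descFactorial j

lemma sturm_add (j : ℕ) (p q : ℝ[X]) : sturm j (p + q) = sturm j p + sturm j q := by
  simp only [sturm, iterate_map_add, mul_add]

lemma sturm_smul (j : ℕ) (c : ℝ) (p : ℝ[X]) : sturm j (c • p) = c • sturm j p := by
  simp only [sturm, iterate_derivative_smul, mul_smul_comm]

lemma WeakChain.integral_sturm {j : ℕ} {G : ℕ → ℝ → ℝ} (h : WeakChain j G) (q : ℝ[X]) :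
    ∫ t in I, G 0 t * (sturm j q).eval t =
      ∫ t in I, G j t * (bump ^ j * derivative^[j] q).eval t := by
  rw [h.integral_eq j le_rfl, ← integral_const_mul]
  refine integral_congr_ae (.of_forall fun t => ?_)
  simp only [sturm, eval_mul, eval_pow, eval_neg, eval_one]; ring

lemma integral_mul_sturm (j : ℕ) (p q : ℝ[X]) : ∫ t in I, p.eval t * (sturm j q).eval t =
    ∫ t in I, (1 - t ^ 2) ^ j * ((derivative^[j] p).eval t * (derivative^[j] q).eval t) := by
  have := (weakChain_polynomial j p).integral_sturm q
  simp only [Function.iterate_zero, id] at this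
  rw [this]
  refine integral_congr_ae (.of_forall fun t => ?_)
  simp only [eval_mul, eval_pow, eval_bump]; ring

lemma integral_sturm_symm (j : ℕ) (p q : ℝ[X]) : ∫ t in I, p.eval t * (sturm j q).eval t =
    ∫ t in I, (sturm j p).eval t * q.eval t := by
  simp only [mul_comm ((sturm j p).eval _)]
  rw [integral_mul_sturm, integral_mul_sturm]
  simp only [mul_comm ((derivative^[j] p).eval _)]

lemma natDegree_bump_le : bump.natDegree ≤ 2 := by
  rw [bump]; compute_degree

lemma coeff_bump_two : bump.coeff 2 = -1 := by
  rw [bump, coeff_sub, coeff_X_pow, coeff_one]; norm_num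

lemma natDegree_bump_pow_le (j : ℕ) : (bump ^ j).natDegree ≤ j * 2 :=
  natDegree_pow_le_of_le j natDegree_bump_le

lemma coeff_bump_pow (j : ℕ) : (bump ^ j).coeff (j * 2) = (-1) ^ j := by
  rw [coeff_pow_of_natDegree_le natDegree_bump_le, coeff_bump_two]

lemma neg_one_pow_mul_eq (j : ℕ) (p : ℝ[X]) : (-1) ^ j * p = C ((-1) ^ j) * p := by
  simp

lemma natDegree_sturm_le {j k : ℕ} {q : ℝ[X]} (hq : q.natDegree ≤ k) :
    (sturm j q).natDegree ≤ k := by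
  rcases lt_or_ge q.natDegree j with h | h
  · rw [sturm, iterate_derivative_eq_zero h]; simp
  · rw [sturm, neg_one_pow_mul_eq]
    refine (natDegree_C_mul_le _ _).trans ((natDegree_iterate_derivative _ _).trans ?_)
    have h1 : (bump ^ j * derivative^[j] q).natDegree ≤ j * 2 + (q.natDegree - j) :=
      natDegree_mul_le_of_le (natDegree_bump_pow_le j) (natDegree_iterate_derivative _ _)
    omega

/-- The leading coefficient of `bump ^ j` is (−1)^j and cancels the sign, while the two j-fold
derivatives contribute the two falling factorials. -/
lemma coeff_sturm {j k : ℕ} (hjk : j ≤ k) {q : ℝ[X]} (hq : q.natDegree ≤ k) :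
    (sturm j q).coeff k = sturmEigenvalue j k * q.coeff k := by
  rw [sturm, neg_one_pow_mul_eq, coeff_C_mul, coeff_iterate_derivative,
    show k + j = j * 2 + (k - j) by omega, coeff_mul_add_eq_of_natDegree_le
      (natDegree_bump_pow_le j) ((natDegree_iterate_derivative _ _).trans (by omega)),
    coeff_bump_pow, coeff_iterate_derivative, sturmEigenvalue,
    show j * 2 + (k - j) = k + j by omega, show k - j + j = k by omega]
  simp only [nsmul_eq_mul]
  push_cast
  have : ((-1 : ℝ) ^ j) * (-1) ^ j = 1 := by rw [← mul_pow]; simp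
  linear_combination ((k + j).descFactorial j * k.descFactorial j * q.coeff k : ℝ) * this

lemma memLp_poly (p : ℝ[X]) : MemLp (fun t => p.eval t) 2 volI := by
  obtain ⟨K, -, hK⟩ := exists_poly_bound p
  refine MemLp.of_bound p.continuous.aestronglyMeasurable K ?_
  filter_upwards [ae_restrict_mem measurableSet_I] with t ht using hK t ht

lemma integrable_poly_mul (p q : ℝ[X]) : Integrable (fun t => p.eval t * q.eval t) volI :=
  (memLp_poly p).integrable_mul (memLp_poly q)

lemma poly_eq_zero_of_ae {p : ℝ[X]} (h : (fun t => p.eval t) =ᵐ[volI] 0) : p = 0 := by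
  have hcl : EqOn (fun t => p.eval t) 0 I :=
    Measure.eqOn_of_ae_eq h p.continuous.continuousOn continuousOn_const
      (by rw [isOpen_I.interior_eq]; exact subset_closure)
  refine Polynomial.eq_zero_of_infinite_isRoot p ((Ioo_infinite (show (-1 : ℝ) < 1 by
    norm_num)).mono fun t ht => hcl ht)

lemma poly_eq_zero_of_integral_sq {p : ℝ[X]} (h : ∫ t in I, p.eval t * p.eval t = 0) : p = 0 := by
  refine poly_eq_zero_of_ae ?_
  rw [integral_eq_zero_iff_of_nonneg (fun t => mul_self_nonneg _)
    ((memLp_poly p).integrable_mul (memLp_poly p))] at h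
  filter_upwards [h] with t ht
  exact mul_self_eq_zero.1 ht

/-- The unnormalized Legendre polynomials, by the formula of Rodrigues. -/
noncomputable def rodrigues (k : ℕ) : ℝ[X] := derivative^[k] (bump ^ k)

lemma natDegree_rodrigues_le (k : ℕ) : (rodrigues k).natDegree ≤ k := by
  have h1 := natDegree_iterate_derivative (bump ^ k) k
  have h2 := natDegree_bump_pow_le k
  rw [rodrigues]; omega

lemma coeff_rodrigues_ne_zero (k : ℕ) : (rodrigues k).coeff k ≠ 0 := by
  rw [rodrigues, coeff_iterate_derivative, show k + k = k * 2 by ring, coeff_bump_pow, nsmul_eq_mul]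
  refine mul_ne_zero ?_ (pow_ne_zero _ (by norm_num))
  have : (k * 2).descFactorial k ≠ 0 := by
    rw [Ne, Nat.descFactorial_eq_zero_iff_lt]; omega
  exact_mod_cast this

/-- All k derivatives are moved onto p, which they annihilate. -/
lemma integral_mul_rodrigues {k : ℕ} {p : ℝ[X]} (hp : p.natDegree < k) :
    ∫ t in I, p.eval t * (rodrigues k).eval t = 0 := by
  have h := (weakChain_polynomial k p).integral_eq k le_rfl 1
  simp only [iterate_derivative_eq_zero hp, eval_zero, zero_mul, integral_zero, mul_one,
    Function.iterate_zero, id] at h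
  rw [rodrigues]
  exact (mul_eq_zero.1 h.symm).resolve_left (pow_ne_zero _ (by norm_num))

/-- The difference E of the two sides has degree below k, by comparison of leading coefficients. By
symmetry of `sturm j` and orthogonality of `rodrigues k` to lower degrees, E is orthogonal to
itself. -/
lemma sturm_rodrigues {j k : ℕ} (hjk : j ≤ k) :
    sturm j (rodrigues k) = (sturmEigenvalue j k : ℝ) • rodrigues k := by
  rw [← sub_eq_zero]
  set E := sturm j (rodrigues k) - (sturmEigenvalue j k : ℝ) • rodrigues k with hE
  by_contra hE0
  have h1 : E.natDegree ≤ k := (natDegree_sub_le _ _).trans (max_le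
    (natDegree_sturm_le (natDegree_rodrigues_le k))
    ((natDegree_smul_le _ _).trans (natDegree_rodrigues_le k)))
  have h2 : E.coeff k = 0 := by
    rw [hE, coeff_sub, coeff_sturm hjk (natDegree_rodrigues_le k), coeff_smul, smul_eq_mul, sub_self]
  have h3 : E.natDegree < k := by
    refine lt_of_le_of_ne h1 fun h => hE0 ?_
    rw [← h] at h2
    exact leadingCoeff_eq_zero.1 h2
  refine hE0 (poly_eq_zero_of_integral_sq ?_)
  have h4 : ∫ t in I, E.eval t * E.eval t = (∫ t in I, E.eval t * (sturm j (rodrigues k)).eval t) -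
      sturmEigenvalue j k * ∫ t in I, E.eval t * (rodrigues k).eval t := by
    rw [← integral_const_mul, ← integral_sub (integrable_poly_mul _ _)
      ((integrable_poly_mul _ _).const_mul _)]
    refine integral_congr_ae (.of_forall fun t => ?_)
    have e : E.eval t = (sturm j (rodrigues k)).eval t - sturmEigenvalue j k * (rodrigues k).eval t := by
      rw [hE, eval_sub, eval_smul, smul_eq_mul]
    linear_combination E.eval t * e
  rw [h4, integral_sturm_symm, integral_mul_rodrigues ((natDegree_sturm_le le_rfl).trans_lt h3),
    integral_mul_rodrigues h3]
  ring

/-- The normalized Legendre polynomials. -/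
noncomputable def legendre (k : ℕ) : ℝ[X] :=
  (√(∫ t in I, (rodrigues k).eval t * (rodrigues k).eval t))⁻¹ • rodrigues k

lemma rodrigues_norm_pos (k : ℕ) : 0 < ∫ t in I, (rodrigues k).eval t * (rodrigues k).eval t := by
  refine lt_of_le_of_ne (integral_nonneg fun t => mul_self_nonneg _) fun h => ?_
  have h1 := poly_eq_zero_of_integral_sq h.symm
  exact coeff_rodrigues_ne_zero k (by rw [h1, coeff_zero])

lemma natDegree_legendre_le (k : ℕ) : (legendre k).natDegree ≤ k :=
  (natDegree_smul_le _ _).trans (natDegree_rodrigues_le k)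

lemma coeff_legendre_ne_zero (k : ℕ) : (legendre k).coeff k ≠ 0 := by
  rw [legendre, coeff_smul]
  exact mul_ne_zero (inv_ne_zero (Real.sqrt_pos.2 (rodrigues_norm_pos k)).ne')
    (coeff_rodrigues_ne_zero k)

lemma sturm_legendre {j k : ℕ} (hjk : j ≤ k) :
    sturm j (legendre k) = (sturmEigenvalue j k : ℝ) • legendre k := by
  rw [legendre, sturm_smul, sturm_rodrigues hjk, smul_comm]

lemma integral_legendre (i k : ℕ) :
    ∫ t in I, (legendre i).eval t * (legendre k).eval t = if i = k then 1 else 0 := by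
  have e : ∀ i k, ∫ t in I, (legendre i).eval t * (legendre k).eval t =
      ((√(∫ t in I, (rodrigues i).eval t * (rodrigues i).eval t))⁻¹ *
      (√(∫ t in I, (rodrigues k).eval t * (rodrigues k).eval t))⁻¹) *
      ∫ t in I, (rodrigues i).eval t * (rodrigues k).eval t := by
    intro i k
    rw [← integral_const_mul]
    refine integral_congr_ae (.of_forall fun t => ?_)
    simp only [legendre, eval_smul, smul_eq_mul]; ring
  rw [e]
  rcases lt_trichotomy i k with h | h | h
  · rw [integral_mul_rodrigues ((natDegree_rodrigues_le i).trans_lt h), mul_zero, if_neg h.ne]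
  · subst h
    rw [if_pos rfl, ← mul_inv, Real.mul_self_sqrt (rodrigues_norm_pos i).le,
      inv_mul_cancel₀ (rodrigues_norm_pos i).ne']
  · simp only [mul_comm ((rodrigues i).eval _)]
    rw [integral_mul_rodrigues ((natDegree_rodrigues_le k).trans_lt h), mul_zero, if_neg h.ne']

/-- The Legendre polynomials of degree less than `n` span the polynomials of degree less
than `n`. -/
lemma mem_of_legendre_mem (S : Submodule ℝ ℝ[X]) :
    ∀ n : ℕ, (∀ k < n, legendre k ∈ S) → ∀ p : ℝ[X], p.degree < n → p ∈ S := by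
  intro n
  induction n with
  | zero =>
    intro _ p hp
    have : p = 0 := by
      rw [← degree_eq_bot]
      simpa [Nat.WithBot.lt_zero_iff] using hp
    rw [this]; exact S.zero_mem
  | succ n ih =>
    intro hS p hp
    set c : ℝ := p.coeff n / (legendre n).coeff n with hc
    have h1 : p - c • legendre n ∈ S := by
      refine ih (fun k hk => hS k (by omega)) _ ((degree_lt_iff_coeff_zero _ _).2 fun m hm => ?_)
      rw [coeff_sub, coeff_smul, smul_eq_mul]
      rcases hm.eq_or_lt with rfl | hlt
      · rw [hc, div_mul_cancel₀ _ (coeff_legendre_ne_zero n), sub_self]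
      · rw [(degree_lt_iff_coeff_zero _ _).1 hp m hlt,
          coeff_eq_zero_of_natDegree_lt ((natDegree_legendre_le n).trans_lt hlt)]
        ring
    have := S.add_mem h1 (S.smul_mem c (hS n (by omega)))
    simpa using this

/-! ### The Legendre basis and the projection error -/

/-- The Legendre polynomials as elements of `L²(I)`. -/
noncomputable def legendreLp (k : ℕ) : Lp ℝ 2 volI :=
  (memLp_poly (legendre k)).toLp fun t => (legendre k).eval t

lemma orthonormal_legendreLp : Orthonormal ℝ legendreLp := by
  rw [orthonormal_iff_ite]
  intro i k
  rw [legendreLp, legendreLp, inner_toLp, integral_legendre]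

lemma integrable_mul_poly_of_memLp {f : ℝ → ℝ} (hf : MemLp f 2 volI) (p : ℝ[X]) :
    Integrable (fun t => f t * p.eval t) volI := integrable_mul_poly (integrable_of_memLp hf) p

/-- The polynomials orthogonal to `f`. -/
noncomputable def polyOrthogonal {f : ℝ → ℝ} (hf : MemLp f 2 volI) : Submodule ℝ ℝ[X] where
  carrier := {p | ∫ t in I, f t * p.eval t = 0}
  zero_mem' := by simp
  add_mem' := by
    intro p q (hp : ∫ t in I, f t * p.eval t = 0) (hq : ∫ t in I, f t * q.eval t = 0)
    change ∫ t in I, f t * (p + q).eval t = 0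
    simp only [eval_add, mul_add]
    rw [integral_add (integrable_mul_poly_of_memLp hf p) (integrable_mul_poly_of_memLp hf q),
      hp, hq, add_zero]
  smul_mem' := by
    intro c p (hp : ∫ t in I, f t * p.eval t = 0)
    change ∫ t in I, f t * (c • p).eval t = 0
    simp only [eval_smul, smul_eq_mul, mul_left_comm _ c]
    rw [integral_const_mul, hp, mul_zero]

lemma mem_polyOrthogonal {f : ℝ → ℝ} (hf : MemLp f 2 volI) {p : ℝ[X]} :
    p ∈ polyOrthogonal hf ↔ ∫ t in I, f t * p.eval t = 0 := Iff.rfl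

/-- A function orthogonal to all polynomials vanishes. -/
lemma ae_eq_zero_of_orthogonal {f : ℝ → ℝ} (hf : MemLp f 2 volI)
    (h : ∀ p : ℝ[X], ∫ t in I, f t * p.eval t = 0) : f =ᵐ[volI] 0 := by
  have hfi := integrable_of_memLp hf
  have hloc : LocallyIntegrableOn f I := IntegrableOn.locallyIntegrableOn hfi
  refine ae_eq_of_forall_test hloc
    (continuousOn_const.locallyIntegrableOn measurableSet_I) fun φ hφ => ?_
  simp only [Pi.zero_apply, mul_zero, integral_zero]
  set A := ∫ t in I, |f t| with hA
  have hA0 : 0 ≤ A := integral_nonneg fun t => abs_nonneg _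
  by_contra hne
  set η := |∫ t in I, φ t * f t| with hη
  have hη0 : 0 < η := abs_pos.2 hne
  -- Weierstrass approximation: since ∫ f p = 0, the tolerance gives η ≤ η/2, where A is the L¹ norm
  -- of f and the +1 guards against A = 0.
  obtain ⟨p, hp⟩ := exists_polynomial_near_of_continuousOn (-1) 1 φ
    hφ.smooth.continuous.continuousOn (η / (2 * (A + 1))) (by positivity)
  have e : ∫ t in I, φ t * f t = ∫ t in I, (φ t * f t - f t * p.eval t) := by
    rw [integral_sub (hφ.integrable hloc) (integrable_mul_poly hfi p), h p, sub_zero]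
  have h1 : η ≤ η / (2 * (A + 1)) * A := by
    have h0 : |∫ t in I, (φ t * f t - f t * p.eval t)| ≤
        ∫ t in I, η / (2 * (A + 1)) * |f t| := by
      rw [← Real.norm_eq_abs]
      refine norm_integral_le_of_norm_le (hfi.abs.const_mul _) ?_
      filter_upwards [ae_restrict_mem measurableSet_I] with t ht
      have e2 : φ t * f t - f t * p.eval t = -(p.eval t - φ t) * f t := by ring
      rw [e2, norm_mul, norm_neg]
      exact mul_le_mul_of_nonneg_right (hp t (Ioo_subset_Icc_self ht)).le (norm_nonneg _)
    rwa [← e, integral_const_mul] at h0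
  have h2 : η / (2 * (A + 1)) * A ≤ η / 2 := by
    rw [div_mul_eq_mul_div, div_le_div_iff₀ (by positivity) (by norm_num)]
    nlinarith
  linarith

lemma orthogonal_legendreLp : (Submodule.span ℝ (range legendreLp))ᗮ = ⊥ := by
  rw [Submodule.eq_bot_iff]
  intro x hx
  have h1 : ∀ k, legendre k ∈ polyOrthogonal (Lp.memLp x) := by
    intro k
    have h2 := hx (legendreLp k) (Submodule.subset_span (mem_range_self k))
    rw [← Lp.toLp_coeFn x (Lp.memLp x), legendreLp, inner_toLp] at h2
    rw [mem_polyOrthogonal]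
    simpa only [mul_comm] using h2
  have h2 : ∀ p : ℝ[X], ∫ t in I, x t * p.eval t = 0 := fun p =>
    mem_of_legendre_mem _ (p.natDegree + 1) (fun k _ => h1 k) p
      (degree_le_natDegree.trans_lt (by exact_mod_cast Nat.lt_succ_self _))
  exact (Lp.eq_zero_iff_ae_eq_zero).2 (ae_eq_zero_of_orthogonal (Lp.memLp x) h2)

lemma hasSum_legendre {f : ℝ → ℝ} (hf : MemLp f 2 volI) :
    HasSum (fun k => (∫ t in I, f t * (legendre k).eval t) ^ 2) (∫ t in I, f t ^ 2) := by
  let b := HilbertBasis.mkOfOrthogonalEqBot orthonormal_legendreLp orthogonal_legendreLp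
  have hb : ∀ k, b k = legendreLp k := fun k => by
    simp only [b, HilbertBasis.coe_mkOfOrthogonalEqBot]
  have h := b.hasSum_inner_mul_inner (hf.toLp f) (hf.toLp f)
  rw [inner_toLp] at h
  convert! h using 1
  · funext k
    rw [real_inner_comm (b k), hb, legendreLp, inner_toLp]
    simp only [mul_comm, sq]
  · simp only [sq]

lemma sturmEigenvalue_mono (j : ℕ) {k k' : ℕ} (h : k ≤ k') :
    sturmEigenvalue j k ≤ sturmEigenvalue j k' :=
  Nat.mul_le_mul (Nat.descFactorial_le _ (by omega)) (Nat.descFactorial_le _ h)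

lemma sturmEigenvalue_pos {j k : ℕ} (h : j ≤ k) : 0 < sturmEigenvalue j k :=
  Nat.mul_pos (Nat.descFactorial_pos.2 (by omega)) (Nat.descFactorial_pos.2 h)

/-- The falling factorials at degree N−1 are at least N^j and (N−j)^j, and N ≤ (j+1)(N−j) as soon as
N ≥ j+1. This is the source of the convergence rate. -/
lemma pow_le_sturmEigenvalue {j N : ℕ} (h : j + 1 ≤ N) :
    N ^ (2 * j) ≤ (j + 1) ^ j * sturmEigenvalue j (N - 1) := by
  have h1 : N ^ j ≤ (N - 1 + j).descFactorial j := by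
    have := Nat.pow_sub_le_descFactorial (N - 1 + j) j
    rwa [show N - 1 + j + 1 - j = N by omega] at this
  have h2 : (N - j) ^ j ≤ (N - 1).descFactorial j := by
    have := Nat.pow_sub_le_descFactorial (N - 1) j
    rwa [show N - 1 + 1 - j = N - j by omega] at this
  have h3 : N ≤ (j + 1) * (N - j) := by
    obtain ⟨r, rfl⟩ := Nat.exists_eq_add_of_le h
    rw [show j + 1 + r - j = r + 1 by omega]
    nlinarith
  calc N ^ (2 * j) = N ^ j * N ^ j := by rw [two_mul, pow_add]
    _ ≤ N ^ j * ((j + 1) * (N - j)) ^ j := Nat.mul_le_mul_left _ (Nat.pow_le_pow_left h3 j)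
    _ = (j + 1) ^ j * (N ^ j * (N - j) ^ j) := by rw [mul_pow]; ring
    _ ≤ _ := Nat.mul_le_mul_left _ (Nat.mul_le_mul h1 h2)

/-- The Bessel-type inequality for Legendre coefficients of high degree. -/
lemma WeakChain.sum_sq_le {j : ℕ} {G : ℕ → ℝ → ℝ} (hG : WeakChain j G)
    (hj : Integrable (fun t => (1 - t ^ 2) ^ j * G j t ^ 2) volI) {k₀ : ℕ} (hk₀ : j ≤ k₀)
    (s : Finset ℕ) (hs : ∀ k ∈ s, k₀ ≤ k) :
    ((sturmEigenvalue j k₀ : ℕ) : ℝ) * ∑ k ∈ s, (∫ t in I, G 0 t * (legendre k).eval t) ^ 2 ≤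
      ∫ t in I, (1 - t ^ 2) ^ j * G j t ^ 2 := by
  set c : ℝ := ((sturmEigenvalue j k₀ : ℕ) : ℝ) with hc
  have hc0 : 0 < c := by rw [hc]; exact_mod_cast sturmEigenvalue_pos hk₀
  set a : ℕ → ℝ := fun k => ∫ t in I, G 0 t * (legendre k).eval t with ha
  set γ : ℕ → ℝ := fun k => ((sturmEigenvalue j k : ℕ) : ℝ) with hγ
  have hγ0 : ∀ k ∈ s, c ≤ γ k := fun k hk => by
    simp only [hc, hγ]
    exact_mod_cast sturmEigenvalue_mono j (hs k hk)
  -- Dividing by the eigenvalues makes `sturm j w` the partial Legendre sum of G₀.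
  set w : ℝ[X] := ∑ k ∈ s, (a k / γ k) • legendre k with hw
  have hsw : sturm j w = ∑ k ∈ s, a k • legendre k := by
    have hlin : ∀ (r : Finset ℕ) (f : ℕ → ℝ[X]), sturm j (∑ k ∈ r, f k) = ∑ k ∈ r, sturm j (f k) := by
      intro r f
      exact map_sum (⟨⟨sturm j, by simpa using sturm_smul j 0 0⟩, sturm_add j⟩ : ℝ[X] →+ ℝ[X]) f r
    rw [hw, hlin]
    refine Finset.sum_congr rfl fun k hk => ?_
    have hne : γ k ≠ 0 := (hc0.trans_le (hγ0 k hk)).ne'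
    rw [sturm_smul, sturm_legendre (hk₀.trans (hs k hk)), smul_smul]
    congr 1
    exact div_mul_cancel₀ _ hne
  have hG0 : Integrable (G 0) volI := by simpa using hG.integrable 0 (by omega)
  have h1 : ∫ t in I, G 0 t * (sturm j w).eval t = ∑ k ∈ s, a k ^ 2 := by
    rw [hsw]
    simp only [eval_finsetSum, eval_smul, smul_eq_mul, Finset.mul_sum]
    rw [integral_finsetSum _ fun k _ => ?_]
    · refine Finset.sum_congr rfl fun k _ => ?_
      simp only [mul_left_comm _ (a k)]
      rw [integral_const_mul, sq]
    · simp only [mul_left_comm _ (a k)]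
      exact (integrable_mul_poly hG0 _).const_mul _
  have h2 : ∫ t in I, w.eval t * (sturm j w).eval t ≤ (∑ k ∈ s, a k ^ 2) / c := by
    have e : ∫ t in I, w.eval t * (sturm j w).eval t = ∑ k ∈ s, a k ^ 2 / γ k := by
      rw [hsw]
      simp only [eval_finsetSum, eval_smul, smul_eq_mul, Finset.mul_sum]
      rw [integral_finsetSum _ fun k _ => ?_]
      · refine Finset.sum_congr rfl fun k hk => ?_
        simp only [mul_left_comm _ (a k)]
        rw [integral_const_mul]
        have e2 : ∫ t in I, w.eval t * (legendre k).eval t = a k / γ k := by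
          simp only [hw, eval_finsetSum, eval_smul, smul_eq_mul, Finset.sum_mul, mul_assoc]
          rw [integral_finsetSum _ fun i _ => (integrable_poly_mul _ _).const_mul _]
          simp only [integral_const_mul, integral_legendre]
          simp [hk]
        rw [e2]; ring
      · simp only [mul_left_comm _ (a k)]
        exact (integrable_poly_mul _ _).const_mul _
    rw [e, Finset.sum_div]
    exact Finset.sum_le_sum fun k hk => div_le_div_of_nonneg_left (sq_nonneg _) hc0 (hγ0 k hk)
  rw [hG.integral_sturm] at h1
  rw [integral_mul_sturm] at h2
  set σ := ∑ k ∈ s, a k ^ 2 with hσ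
  have i1 : Integrable (fun t => G j t * (bump ^ j * derivative^[j] w).eval t) volI := by
    have := integrable_mul_poly (hG.integrable j le_rfl) (derivative^[j] w)
    refine this.congr (.of_forall fun t => ?_)
    simp only [eval_mul, eval_pow, eval_bump]; ring
  have i2 : Integrable (fun t => (1 - t ^ 2) ^ j *
      ((derivative^[j] w).eval t * (derivative^[j] w).eval t)) volI := by
    have := integrable_poly_mul (bump ^ j) (derivative^[j] w * derivative^[j] w)
    simpa using this
  -- Expand ∫(1−t²)^j (G_j − c w^{(j)})² ≥ 0. The cross term is −2cΣaₖ² and the last term is at most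
  -- c²·Σaₖ²/c, leaving cΣaₖ² ≤ ∫(1−t²)^j G_j².
  have h3 : 0 ≤ ∫ t in I, ((1 - t ^ 2) ^ j * G j t ^ 2 -
      (2 * c) * (G j t * (bump ^ j * derivative^[j] w).eval t) +
      c ^ 2 * ((1 - t ^ 2) ^ j * ((derivative^[j] w).eval t * (derivative^[j] w).eval t))) := by
    refine integral_nonneg_of_ae ?_
    filter_upwards [ae_restrict_mem measurableSet_I] with t ht
    have hp : 0 ≤ (1 - t ^ 2) ^ j := pow_nonneg (one_sub_sq_pos ht).le j
    have e : (1 - t ^ 2) ^ j * G j t ^ 2 -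
      (2 * c) * (G j t * (bump ^ j * derivative^[j] w).eval t) +
      c ^ 2 * ((1 - t ^ 2) ^ j * ((derivative^[j] w).eval t * (derivative^[j] w).eval t)) =
      (1 - t ^ 2) ^ j * (G j t - c * (derivative^[j] w).eval t) ^ 2 := by
      simp only [eval_mul, eval_pow, eval_bump]; ring
    rw [Pi.zero_apply, e]
    positivity
  have i3 : Integrable (fun t => (1 - t ^ 2) ^ j * G j t ^ 2 -
      (2 * c) * (G j t * (bump ^ j * derivative^[j] w).eval t)) volI := hj.sub (i1.const_mul _)
  rw [integral_add i3 (i2.const_mul _), integral_sub hj (i1.const_mul _),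
    integral_const_mul, integral_const_mul, h1] at h3
  have h4 := mul_le_mul_of_nonneg_left h2 (sq_nonneg c)
  have h5 : c ^ 2 * (σ / c) = c * σ := by field_simp
  linarith

/-- The error of the Legendre projection, in terms of a weighted norm of the derivative. -/
lemma WeakChain.exists_projection {j : ℕ} {G : ℕ → ℝ → ℝ} (hG : WeakChain j G)
    (hG0 : MemLp (G 0) 2 volI)
    (hj : Integrable (fun t => (1 - t ^ 2) ^ j * G j t ^ 2) volI) {M : ℕ} (hM : j ≤ M + 1) :
    ∃ q : ℝ[X], q.natDegree ≤ M ∧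
      (∀ p : ℝ[X], p.natDegree ≤ M → ∫ t in I, (G 0 t - q.eval t) * p.eval t = 0) ∧
      (sturmEigenvalue j (M + 1) : ℝ) * ∫ t in I, (G 0 t - q.eval t) ^ 2 ≤
        ∫ t in I, (1 - t ^ 2) ^ j * G j t ^ 2 := by
  set a : ℕ → ℝ := fun k => ∫ t in I, G 0 t * (legendre k).eval t with ha
  set q : ℝ[X] := ∑ k ∈ Finset.range (M + 1), a k • legendre k with hq
  have he : MemLp (fun t => G 0 t - q.eval t) 2 volI := hG0.sub (memLp_poly q)
  have hcoef : ∀ k, ∫ t in I, (G 0 t - q.eval t) * (legendre k).eval t =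
      if k < M + 1 then 0 else a k := by
    intro k
    have e1 : ∫ t in I, (G 0 t - q.eval t) * (legendre k).eval t =
        a k - ∫ t in I, q.eval t * (legendre k).eval t := by
      simp only [sub_mul]
      exact integral_sub (integrable_mul_poly_of_memLp hG0 _) (integrable_poly_mul _ _)
    have e2 : ∫ t in I, q.eval t * (legendre k).eval t = if k < M + 1 then a k else 0 := by
      simp only [hq, eval_finsetSum, eval_smul, smul_eq_mul, Finset.sum_mul, mul_assoc]
      rw [integral_finsetSum _ fun i _ => (integrable_poly_mul _ _).const_mul _]
      simp only [integral_const_mul, integral_legendre]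
      simp
    rw [e1, e2]
    split_ifs <;> ring
  refine ⟨q, ?_, fun p hp => ?_, ?_⟩
  · refine natDegree_sum_le_of_forall_le _ _ fun k hk => ?_
    exact (natDegree_smul_le _ _).trans ((natDegree_legendre_le k).trans
      (Nat.lt_succ_iff.1 (Finset.mem_range.1 hk)))
  · refine mem_of_legendre_mem (polyOrthogonal he) (M + 1) (fun k hk => ?_) p
      (degree_le_natDegree.trans_lt (by exact_mod_cast Nat.lt_succ_of_le hp))
    rw [mem_polyOrthogonal, hcoef, if_pos hk]
  · have hc0 : (0 : ℝ) < sturmEigenvalue j (M + 1) := by exact_mod_cast sturmEigenvalue_pos hM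
    rw [mul_comm, ← le_div_iff₀ hc0]
    refine hasSum_le_of_sum_le (hasSum_legendre he) fun s => ?_
    simp only [hcoef]
    rw [le_div_iff₀ hc0, mul_comm]
    have h1 := hG.sum_sq_le hj hM (s.filter fun k => M + 1 ≤ k)
      (fun k hk => (Finset.mem_filter.1 hk).2)
    refine le_trans (le_of_eq ?_) h1
    congr 1
    rw [Finset.sum_filter]
    refine Finset.sum_congr rfl fun k _ => ?_
    rcases lt_or_ge k (M + 1) with h | h
    · rw [if_pos h, if_neg (by omega)]; norm_num
    · rw [if_neg (by omega), if_pos h]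

/-! ### Polynomials in `H20` -/

lemma exists_antiderivative {n : ℕ} {q : ℝ[X]} (hq : q.natDegree ≤ n) :
    ∃ p : ℝ[X], p.natDegree ≤ n + 1 ∧ derivative p = q ∧ p.eval 1 = 0 := by
  set r : ℝ[X] := ∑ k ∈ Finset.range (n + 1), C (q.coeff k / (k + 1)) * X ^ (k + 1) with hr
  have hrd : r.natDegree ≤ n + 1 := by
    refine natDegree_sum_le_of_forall_le _ _ fun k hk => ?_
    have := Finset.mem_range.1 hk
    exact (natDegree_C_mul_X_pow_le _ _).trans (by omega)
  refine ⟨r - C (r.eval 1), ?_, ?_, by simp⟩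
  · exact (natDegree_sub_le _ _).trans (max_le hrd (by simp))
  · rw [derivative_sub, derivative_C, sub_zero, hr, derivative_sum]
    conv_rhs => rw [q.as_sum_range' (n + 1) (by omega)]
    refine Finset.sum_congr rfl fun k _ => ?_
    rw [derivative_C_mul_X_pow, ← C_mul_X_pow_eq_monomial]
    congr 2
    push_cast
    have : (k : ℝ) + 1 ≠ 0 := by positivity
    field_simp

lemma weakDeriv_poly_ae (k : ℕ) (p : ℝ[X]) :
    weakDeriv k (fun t => p.eval t) =ᵐ[volI] fun t => (derivative^[k] p).eval t :=
  (isWeakDeriv_polynomial k p).weakDeriv_ae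

lemma zeroAt_poly {p : ℝ[X]} {a : ℝ} (h : p.eval a = 0) : ZeroAt (fun t => p.eval t) a := by
  refine ⟨_, ae_eq_refl _, ?_⟩
  have := p.continuous.tendsto a
  rw [h] at this
  exact this.mono_left nhdsWithin_le_nhds

lemma poly_mem_H20 {p : ℝ[X]} (h1 : p.eval (-1) = 0) (h2 : p.eval 1 = 0)
    (h3 : (derivative p).eval 1 = 0) : (fun t => p.eval t) ∈ H20 := by
  refine mem_H20_of (isWeakDeriv_polynomial 1 p) (isWeakDeriv_polynomial 2 p) ?_
    (memLp_poly _) (memLp_omega_mul (memLp_poly _)) (zeroAt_poly h1) (zeroAt_poly h2)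
    (zeroAt_poly h3)
  obtain ⟨r, hr⟩ := dvd_iff_isRoot.2 h1
  refine (memLp_poly r).ae_eq ?_
  filter_upwards [ae_restrict_mem measurableSet_I] with t ht
  have : 1 + t ≠ 0 := by linarith [ht.1]
  rw [divOmega, hr]
  simp only [eval_mul, eval_sub, eval_X, eval_C, sub_neg_eq_add]
  rw [add_comm t 1]; field_simp

/-- (1+t)p' − p is an antiderivative of (1+t)p''. It expresses the condition p(−1) = 0 as
orthogonality of p'' to 1+t. -/
lemma integral_omega_derivative {p : ℝ[X]} (h2 : p.eval 1 = 0) (h3 : (derivative p).eval 1 = 0) :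
    ∫ t in I, (derivative (derivative p)).eval t * (1 + X : ℝ[X]).eval t = p.eval (-1) := by
  set P : ℝ[X] := (1 + X) * derivative p - p with hP
  have hd : ∀ t, HasDerivAt (fun t => P.eval t)
      ((derivative (derivative p)).eval t * (1 + X : ℝ[X]).eval t) t := by
    intro t
    have e : derivative P = derivative (derivative p) * (1 + X) := by
      rw [hP]; simp; ring
    rw [← eval_mul, ← e]
    exact P.hasDerivAt t
  have h := intervalIntegral.integral_eq_sub_of_hasDerivAt (a := -1) (b := 1) (fun t _ => hd t)
    ((Polynomial.continuous _).mul (Polynomial.continuous _)).continuousOn.intervalIntegrable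
  rw [intervalIntegral.integral_of_le (by norm_num), integral_Ioc_eq_integral_Ioo] at h
  rw [I, h, hP]
  simp [h2, h3]

/-! ### Approximation of regular functions -/

section Approximation

variable {u : ℝ → ℝ}

lemma jacobi_self (i : ℕ) (t : ℝ) : jacobi i i t = (1 - t ^ 2) ^ i := by
  rw [jacobi, zpow_natCast, zpow_natCast, ← mul_pow]; ring

/-- The higher derivatives of an element of `Hs`. -/
lemma weakDeriv_spec_of_mem_Hs {s : ℕ} (hu : u ∈ Hs s) {i : ℕ} (hi : i + 2 ≤ s) :
    IsWeakDeriv (i + 2) u (weakDeriv (i + 2) u) ∧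
      Integrable (fun t => (1 - t ^ 2) ^ i * weakDeriv (i + 2) u t ^ 2) volI := by
  have key : DerivMemL2 (i + 2) (jacobi i i) u := by
    rcases Nat.eq_zero_or_pos i with rfl | hpos
    · obtain ⟨v, hv, hm⟩ := hu.2.1.2.2
      refine ⟨v, hv, hm.1, hm.2.congr (.of_forall fun t => ?_)⟩
      simp only [Nat.cast_zero, jacobi_zero_zero]
    · have := hu.2.2 (i + 2) (by omega) hi
      simpa using this
  obtain ⟨v, hv, hm⟩ := key
  refine ⟨hv.weakDeriv, hm.2.congr ?_⟩
  filter_upwards [hv.weakDeriv_ae] with t ht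
  rw [ht, jacobi_self]

lemma weakChain_of_mem_Hs {s j : ℕ} (hu : u ∈ Hs s) (hj : j + 2 ≤ s) :
    WeakChain j fun i => weakDeriv (i + 2) u where
  weak i hi := (weakDeriv_spec_of_mem_Hs hu (by omega)).1.of_succ
    (weakDeriv_spec_of_mem_Hs hu (i := i + 1) (by omega)).1
  integrable i hi := by
    obtain ⟨hw, hint⟩ := weakDeriv_spec_of_mem_Hs hu (i := i) (by omega)
    refine Integrable.mono ((integrable_const (1 : ℝ)).add hint)
      (AEStronglyMeasurable.mul (by fun_prop) hw.2.1.aestronglyMeasurable) ?_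
    filter_upwards [ae_restrict_mem measurableSet_I] with t ht
    have h0 : 0 ≤ (1 - t ^ 2) ^ i := pow_nonneg (one_sub_sq_pos ht).le i
    have h1 : (1 - t ^ 2) ^ i ≤ 1 :=
      pow_le_one₀ (one_sub_sq_pos ht).le (by linarith [sq_nonneg t])
    rw [norm_mul, Real.norm_of_nonneg h0, Pi.add_apply,
      Real.norm_of_nonneg (add_nonneg zero_le_one (mul_nonneg h0 (sq_nonneg _)))]
    change _ * |weakDeriv (i + 2) u t| ≤ _
    generalize weakDeriv (i + 2) u t = x
    -- For 0 ≤ w ≤ 1 one has w|x| ≤ 1 + w x², so the weighted square bound implies weighted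
    -- integrability.
    nlinarith [sq_nonneg (|x| - 1), sq_abs x, mul_nonneg h0 (sq_nonneg (|x| - 1)), abs_nonneg x]

/-- Elements of `Hs` are approximated by the elements of `XN`. -/
theorem exists_XN_approx {s : ℕ} (hs : 2 ≤ s) (hu : u ∈ Hs s) {N : ℕ} (hN : 3 ≤ N)
    (hsN : s ≤ N + 1) : ∃ v ∈ XN N, ∫ t in I, omegaD2 (v - u) t ^ 2 ≤
      4 * (s : ℝ) ^ s * ((N : ℝ) ^ (2 * (s - 2)))⁻¹ *
        ∫ t in I, (1 - t ^ 2) ^ (s - 2) * weakDeriv s u t ^ 2 := by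
  obtain ⟨j, rfl⟩ := Nat.exists_eq_add_of_le' hs
  obtain ⟨M, rfl⟩ := Nat.exists_eq_add_of_le' (show 2 ≤ N by omega)
  rw [Nat.add_sub_cancel]
  have hG := weakChain_of_mem_Hs hu le_rfl
  have hf : MemLp (weakDeriv 2 u) 2 volI := by
    obtain ⟨hw, hint⟩ := weakDeriv_spec_of_mem_Hs hu (i := 0) (by omega)
    rw [memLp_two_iff_integrable_sq hw.2.1.aestronglyMeasurable]
    simpa using hint
  -- Here N = M+2: u'' is projected onto degree at most M, leaving room for two integrations. Both
  -- antiderivatives vanish at 1, so p(1) = p'(1) = 0.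
  obtain ⟨q, hq1, hq2, hq3⟩ := hG.exists_projection hf
    (weakDeriv_spec_of_mem_Hs hu le_rfl).2 (M := M) (by omega)
  simp only [zero_add] at hq2 hq3
  obtain ⟨p', hp'1, hp'2, hp'3⟩ := exists_antiderivative hq1
  obtain ⟨p, hp1, hp2, hp3⟩ := exists_antiderivative hp'1
  -- p(−1) = ∫(1+t)q = ∫(1+t)u'' = 0. The middle equality is orthogonality of the projection error
  -- to 1+X, whose degree 1 is at most M because N ≥ 3.
  have hzero : p.eval (-1) = 0 := by
    rw [← integral_omega_derivative hp3 (by rw [hp2, hp'3]), hp2, hp'2]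
    have h1 := hq2 (1 + X) ((natDegree_add_le _ _).trans (by simp; omega))
    simp only [sub_mul] at h1
    rw [integral_sub (integrable_mul_poly_of_memLp hf _) (integrable_poly_mul _ _)] at h1
    have h2 : ∫ t in I, weakDeriv 2 u t * (1 + X : ℝ[X]).eval t = 0 := by
      rw [← (profile_omegaD2 hu.1).integral_h]
      refine integral_congr_ae (.of_forall fun t => ?_)
      simp only [omegaD2, eval_add, eval_one, eval_X]; ring
    linarith
  have hpH : (fun t => p.eval t) ∈ H20 := poly_mem_H20 hzero hp3 (by rw [hp2, hp'3])
  refine ⟨fun t => p.eval t, ⟨hpH, p, by omega, rfl⟩, ?_⟩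
  have e1 : ∫ t in I, omegaD2 ((fun t => p.eval t) - u) t ^ 2 =
      ∫ t in I, ((1 + t) * (weakDeriv 2 u t - q.eval t)) ^ 2 := by
    refine integral_congr_ae ?_
    filter_upwards [omegaD2_sub hpH hu.1, weakDeriv_poly_ae 2 p] with t h1 h2
    rw [h1, Pi.sub_apply, omegaD2, omegaD2, h2]
    simp only [Function.iterate_succ, Function.iterate_zero, Function.comp_apply, id, hp2, hp'2]
    ring
  rw [e1]
  refine (integral_sq_omega_le (hf.sub (memLp_poly q))).trans ?_
  set W := ∫ t in I, (1 - t ^ 2) ^ j * weakDeriv (j + 2) u t ^ 2 with hW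
  have hW0 : 0 ≤ W := integral_nonneg_of_ae (by
    filter_upwards [ae_restrict_mem measurableSet_I] with t ht
    exact mul_nonneg (pow_nonneg (one_sub_sq_pos ht).le j) (sq_nonneg _))
  -- M+1 = N−1 is the first degree omitted by the projection, and j+1 ≤ N is the assumption s ≤ N+1.
  have hcoef := pow_le_sturmEigenvalue (show j + 1 ≤ M + 2 by omega)
  rw [show M + 2 - 1 = M + 1 by omega] at hcoef
  have hcoef' : ((M + 2 : ℕ) : ℝ) ^ (2 * j) ≤ (j + 1 : ℝ) ^ j * sturmEigenvalue j (M + 1) := by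
    exact_mod_cast hcoef
  have hNpos : (0 : ℝ) < ((M + 2 : ℕ) : ℝ) ^ (2 * j) := by positivity
  set T := ∫ t in I, (weakDeriv 2 u t - q.eval t) ^ 2 with hT
  have hT0 : 0 ≤ T := integral_sq_nonneg _
  have h5 : ((M + 2 : ℕ) : ℝ) ^ (2 * j) * T ≤ (j + 1 : ℝ) ^ j * W := by
    calc _ ≤ (j + 1 : ℝ) ^ j * sturmEigenvalue j (M + 1) * T :=
          mul_le_mul_of_nonneg_right hcoef' hT0
      _ = (j + 1 : ℝ) ^ j * (sturmEigenvalue j (M + 1) * T) := by ring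
      _ ≤ _ := mul_le_mul_of_nonneg_left hq3 (by positivity)
  have h6 : (j + 1 : ℝ) ^ j ≤ ((j + 2 : ℕ) : ℝ) ^ (j + 2) := by
    push_cast
    calc (j + 1 : ℝ) ^ j ≤ (j + 2 : ℝ) ^ j :=
          pow_le_pow_left₀ (by positivity) (by linarith) j
      _ ≤ _ := pow_le_pow_right₀ (by linarith [Nat.cast_nonneg (α := ℝ) j]) (by omega)
  have h7 : T ≤ (((M + 2 : ℕ) : ℝ) ^ (2 * j))⁻¹ * (((j + 2 : ℕ) : ℝ) ^ (j + 2) * W) := by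
    rw [inv_mul_eq_div, le_div_iff₀ hNpos, mul_comm]
    exact h5.trans (mul_le_mul_of_nonneg_right h6 hW0)
  change 4 * T ≤ _
  calc 4 * T ≤ 4 * ((((M + 2 : ℕ) : ℝ) ^ (2 * j))⁻¹ * (((j + 2 : ℕ) : ℝ) ^ (j + 2) * W)) := by
        linarith
    _ = _ := by ring

end Approximation

/-! ### The Galerkin error of the transmission eigenvalues -/

section Span

variable {V : Type*} [AddCommGroup V] [Module ℝ V] {A B : LinearMap.BilinForm ℝ V} {n : ℕ}

lemma continuous_form_sum (A : LinearMap.BilinForm ℝ V) (z : Fin n → V) :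
    Continuous fun c : Fin n → ℝ => A (∑ i, c i • z i) (∑ i, c i • z i) := by
  simp only [map_sum, map_smul, LinearMap.sum_apply, LinearMap.smul_apply, smul_eq_mul]
  fun_prop

lemma form_sum_smul (A : LinearMap.BilinForm ℝ V) (z : Fin n → V) (r : ℝ) (c : Fin n → ℝ) :
    A (∑ i, (r • c) i • z i) (∑ i, (r • c) i • z i) =
      r ^ 2 * A (∑ i, c i • z i) (∑ i, c i • z i) := by
  have e : ∑ i, (r • c) i • z i = r • ∑ i, c i • z i := by
    rw [Finset.smul_sum]
    exact Finset.sum_congr rfl fun i _ => by rw [Pi.smul_apply, smul_eq_mul, mul_smul]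
  rw [e, map_smul, map_smul, LinearMap.smul_apply, smul_eq_mul, smul_eq_mul]; ring

/-- On a finite-dimensional span, a form is bounded by a definite one. -/
lemma exists_rayleigh_bound (A : LinearMap.BilinForm ℝ V) (hB : IsPsd B) (z : Fin n → V)
    (hz : ∀ c : Fin n → ℝ, B (∑ i, c i • z i) (∑ i, c i • z i) = 0 → c = 0) :
    ∃ Λ : ℝ, 0 < Λ ∧ ∀ c : Fin n → ℝ,
      A (∑ i, c i • z i) (∑ i, c i • z i) ≤ Λ * B (∑ i, c i • z i) (∑ i, c i • z i) := by
  -- The quotient of the forms is continuous on the unit sphere of coefficients, hence bounded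
  -- there; homogeneity extends the bound to all c.
  have hne : ∀ c ∈ Metric.sphere (0 : Fin n → ℝ) 1,
      B (∑ i, c i • z i) (∑ i, c i • z i) ≠ 0 := fun c hc h0 => by
    rw [hz c h0] at hc
    simp at hc
  obtain ⟨C, hC⟩ := (isCompact_sphere (0 : Fin n → ℝ) 1).exists_bound_of_continuousOn
    ((continuous_form_sum A z).continuousOn.div (continuous_form_sum B z).continuousOn hne)
  refine ⟨|C| + 1, by positivity, fun c => ?_⟩
  rcases eq_or_ne c 0 with rfl | hc
  · simp
  have hr : ‖c‖ ≠ 0 := norm_ne_zero_iff.2 hc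
  set c' : Fin n → ℝ := ‖c‖⁻¹ • c with hc'
  have hcc : c = ‖c‖ • c' := by rw [hc', smul_smul, mul_inv_cancel₀ hr, one_smul]
  have hmem : c' ∈ Metric.sphere (0 : Fin n → ℝ) 1 := by
    rw [mem_sphere_zero_iff_norm, hc', norm_smul, norm_inv, norm_norm, inv_mul_cancel₀ hr]
  have hpos : 0 < B (∑ i, c' i • z i) (∑ i, c' i • z i) :=
    (hB.nonneg _).lt_of_ne' (hne c' hmem)
  have h1 := (le_abs_self _).trans (hC c' hmem)
  rw [Pi.div_apply, div_le_iff₀ hpos] at h1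
  clear_value c'
  rw [hcc, form_sum_smul, form_sum_smul, mul_left_comm]
  refine mul_le_mul_of_nonneg_left (h1.trans ?_) (sq_nonneg _)
  exact mul_le_mul_of_nonneg_right (by linarith [le_abs_self C]) hpos.le

end Span

/-! ### Polynomial trial spaces and the transfer to bilinear forms on `H20` -/

/-- Evaluation of polynomials as functions. -/
noncomputable def polyFun : ℝ[X] →ₗ[ℝ] ℝ → ℝ := LinearMap.pi fun t => Polynomial.leval t

/-- The polynomials of degree at most `N` in `H20`, as a subspace of `H20`. -/
noncomputable def polySub (N : ℕ) : Submodule ℝ H20sub :=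
  ((degreeLT ℝ (N + 1)).map polyFun).comap H20sub.subtype

lemma mem_polySub {N : ℕ} {v : H20sub} : v ∈ polySub N ↔ (v : ℝ → ℝ) ∈ XN N := by
  simp only [polySub, Submodule.mem_comap, Submodule.mem_map, mem_degreeLT, XN]
  refine ⟨fun ⟨p, hp, he⟩ => ⟨v.2, p, ?_, he.symm⟩, fun ⟨_, p, hp, he⟩ => ⟨p, ?_, he.symm⟩⟩
  · rcases eq_or_ne p 0 with rfl | h0
    · simp
    · exact Nat.lt_succ_iff.1 ((natDegree_lt_iff_degree_lt h0).2 hp)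
  · exact degree_le_natDegree.trans_lt (by exact_mod_cast Nat.lt_succ_of_le hp)

instance (N : ℕ) : FiniteDimensional ℝ (polySub N) := by
  have : FiniteDimensional ℝ (degreeLT ℝ (N + 1)) :=
    Module.Finite.equiv (degreeLTEquiv ℝ (N + 1)).symm
  let f : polySub N →ₗ[ℝ] (degreeLT ℝ (N + 1)).map polyFun :=
    H20sub.subtype.restrict (fun v hv => hv)
  exact Module.Finite.of_injective f fun v w h => by
    have h' : (f v : ℝ → ℝ) = f w := congrArg Subtype.val h
    exact Subtype.ext (Subtype.ext h')

section Conversion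

variable {l : ℕ} {R σ m M : ℝ} {c d e : ℝ → ℝ}

lemma formB_eq_zero_of_ae {u : ℝ → ℝ} (h : u =ᵐ[volI] 0) :
    formB R l u u = 0 := by
  have h0 : (fun t => (0 : ℝ[X]).eval t) =ᵐ[volI] u := by
    filter_upwards [h] with t ht
    rw [ht, eval_zero, Pi.zero_apply]
  have h1 : weakDeriv 1 u =ᵐ[volI] 0 :=
    ((isWeakDeriv_polynomial 1 0).congr (v' := 0) h0 (.of_forall fun t => by simp)).weakDeriv_ae
  rw [formB_self, integral_eq_zero_of_ae, integral_eq_zero_of_ae]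
  · simp
  · filter_upwards [h] with t ht
    simp [ht]
  · filter_upwards [h1] with t ht
    simp [ht]

/-- The two notions of a nonzero eigenvector match because B(w,w) ≠ 0 excludes w = 0 almost
everywhere. -/
lemma firstPairs_of_isFirstEigenpairs (h : Admissible c d e m M) {W : Set (ℝ → ℝ)}
    {X : Submodule ℝ H20sub} (hW : ∀ u ∈ W, u ∈ H20) (hX : ∀ u : H20sub, u ∈ X ↔ (u : ℝ → ℝ) ∈ W)
    {k : ℕ} {lam : Fin k → ℝ} {u : Fin k → ℝ → ℝ}
    (hu : IsFirstEigenpairs W (genForm l σ c d e) (formB R l) k lam u) :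
    FirstPairs (bilinA l σ h) (bilinB R l) X lam fun i => ⟨u i, hW _ (hu.eigenpair i).1⟩ where
  mem i := (hX _).2 (hu.eigenpair i).1
  eig i v hv := (hu.eigenpair i).2.2 v ((hX v).1 hv)
  orthonormal := hu.orthonormal
  monotone := hu.monotone
  first μ w hw hne heig := hu.first μ w ⟨(hX w).1 hw,
    fun h0 => hne (formB_eq_zero_of_ae h0),
    fun v hv => heig ⟨v, hW v hv⟩ ((hX ⟨v, hW v hv⟩).2 hv)⟩

lemma Admissible.le (h : Admissible c d e m M) : m ≤ M := by
  obtain ⟨t, -, h1, h2⟩ := ae_volI_eventually one_mem_closure_I (h.c_ge.and h.hc.bound) univ_mem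
  exact h1.trans ((le_abs_self _).trans h2)

/-- The polynomials `(1 - X)² (1 + X) Xʲ`. -/
noncomputable def edgePoly (j : ℕ) : ℝ[X] := (1 - X) ^ 2 * (1 + X) * X ^ j

lemma edgePoly_mem_H20 (j : ℕ) : (fun t => (edgePoly j).eval t) ∈ H20 :=
  poly_mem_H20 (by simp [edgePoly]) (by simp [edgePoly])
    (by simp [edgePoly, derivative_mul, derivative_pow])

/-- `edgePoly` as an element of `H20`. -/
noncomputable def edgeFun (j : ℕ) : H20sub := ⟨fun t => (edgePoly j).eval t, edgePoly_mem_H20 j⟩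

/-- For j ≤ q these functions belong to every trial space with N ≥ q+3 = m+2. They serve as the
fixed family that bounds the m-th discrete eigenvalue independently of N. -/
lemma edgeFun_mem {j N : ℕ} (h : j + 3 ≤ N) : edgeFun j ∈ polySub N := by
  refine mem_polySub.2 ⟨edgePoly_mem_H20 j, edgePoly j, le_trans ?_ h, rfl⟩
  rw [edgePoly]
  compute_degree
  omega

/-- A combination that is zero for `B` is a polynomial vanishing almost everywhere on I; cancelling
(1−X)²(1+X) leaves the polynomial with coefficients a. -/
lemma edgeFun_sum_eq_zero (hR : 0 < R) (hl : 1 ≤ l) {k : ℕ} (a : Fin k → ℝ)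
    (h : bilinB R l (∑ i, a i • edgeFun i) (∑ i, a i • edgeFun i) = 0) : a = 0 := by
  have h1 := ae_eq_zero_of_formB hR hl (∑ i, a i • edgeFun i : H20sub).2 h
  set p : ℝ[X] := ∑ i : Fin k, monomial i (a i) with hp
  have e : ((∑ i, a i • edgeFun i : H20sub) : ℝ → ℝ) =
      fun t => ((1 - X) ^ 2 * (1 + X) * p).eval t := by
    funext t
    rw [Submodule.coe_sum, Finset.sum_apply, hp, Finset.mul_sum, eval_finsetSum]
    refine Finset.sum_congr rfl fun i _ => ?_
    simp only [edgeFun, edgePoly, Submodule.coe_smul, Pi.smul_apply, smul_eq_mul,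
      eval_mul, eval_pow, eval_X, eval_monomial]
    ring
  rw [e] at h1
  have h2 := poly_eq_zero_of_ae h1
  have hne1 : (1 - X : ℝ[X]) ≠ 0 := fun h0 => by
    have := congrArg (eval 0) h0; simp at this
  have hne2 : (1 + X : ℝ[X]) ≠ 0 := fun h0 => by
    have := congrArg (eval 0) h0; simp at this
  have h3 : p = 0 := by simpa [hne1, hne2] using h2
  funext i
  have h4 := congrArg (fun r : ℝ[X] => r.coeff i) h3
  simpa [hp, finsetSum_coeff, coeff_monomial, Fin.val_inj] using h4

lemma wnorm_jacobi_sq {s : ℕ} (hs : 2 ≤ s) (f : ℝ → ℝ) :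
    wnorm (jacobi ((s : ℤ) - 2) ((s : ℤ) - 2)) f ^ 2 = ∫ t in I, (1 - t ^ 2) ^ (s - 2) * f t ^ 2 := by
  have e : ip (jacobi ((s : ℤ) - 2) ((s : ℤ) - 2)) f f =
      ∫ t in I, (1 - t ^ 2) ^ (s - 2) * f t ^ 2 := by
    rw [ip, show (s : ℤ) - 2 = ((s - 2 : ℕ) : ℤ) by omega]
    refine integral_congr_ae (.of_forall fun t => ?_)
    simp only [jacobi_self]; ring
  rw [wnorm, Real.sq_sqrt, e]
  rw [e]
  refine integral_nonneg_of_ae ?_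
  filter_upwards [ae_restrict_mem measurableSet_I] with t ht
  exact mul_nonneg (pow_nonneg (one_sub_sq_pos ht).le _) (sq_nonneg _)

/-- The Galerkin error for a form with bounded coefficients. -/
theorem galerkin_error_le (hR : 0 < R) (hl : 1 ≤ l) (h : Admissible c d e m M) (q : ℕ) {s : ℕ}
    (hs : 2 ≤ s) : ∃ C : ℝ, 0 < C ∧ ∀ (lam : Fin (q + 1) → ℝ) (u : Fin (q + 1) → ℝ → ℝ),
      IsFirstEigenpairs H20 (genForm l σ c d e) (formB R l) (q + 1) lam u → (∀ i, u i ∈ Hs s) →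
      ∀ N : ℕ, q + 3 ≤ N → s ≤ N + 1 → ∀ (lamN : Fin (q + 1) → ℝ) (uN : Fin (q + 1) → ℝ → ℝ),
        IsFirstEigenpairs (XN N) (genForm l σ c d e) (formB R l) (q + 1) lamN uN →
        |lamN (Fin.last q) - lam (Fin.last q)| ≤ C * (N : ℝ) ^ (2 * (2 - (s : ℤ))) *
          ⨆ i, wnorm (jacobi ((s : ℤ) - 2) ((s : ℤ) - 2)) (weakDeriv s (u i)) ^ 2 := by
  have hm := h.pos
  have hM : 0 < M := hm.trans_le h.le
  have hl0 : (0 : ℝ) ≤ l * (l + 1) := by positivity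
  have hs0 : (0 : ℝ) < s := by exact_mod_cast (by omega : 0 < s)
  set K := R ^ 2 / 4 * (16 + 64 * (l * (l + 1) : ℝ)) * ((2 + 2 * M ^ 2) / m) with hK
  have hK0 : 0 < K := by positivity
  set CA := M * (324 + 64 * (l * (l + 1) : ℝ) ^ 2 + 512 * σ ^ 2 * M ^ 2 + 256 * σ ^ 2) with hCA
  have hCA0 : 0 < CA := by positivity
  have hBA : ∀ v, bilinB R l v v ≤ K * bilinA l σ h v v := fun v => by
    rw [bilinA_apply, bilinB_apply, hK, mul_assoc]
    exact (formB_le R v.2).trans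
      (mul_le_mul_of_nonneg_left (omegaD2_le_genForm hl h v.2) (by positivity))
  -- Λ is fixed before N, the eigenvalues and the eigenfunctions are introduced, so the final
  -- constant depends on none of them.
  obtain ⟨Λ, hΛ0, hΛ⟩ := exists_rayleigh_bound (bilinA l σ h) (isPsd_bilinB (l := l) R)
    (fun i : Fin (q + 1) => edgeFun i) fun a => edgeFun_sum_eq_zero hR hl a
  refine ⟨4 * Λ * (q + 1) ^ 2 * K * (CA * (4 * (s : ℝ) ^ s)), by positivity, ?_⟩
  intro lam u hu hus N hN hsN lamN uN huN
  -- On polynomials the form is definite, since a polynomial that is zero almost everywhere on I is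
  -- the zero polynomial.
  have hdef : ∀ v ∈ polySub N, bilinA l σ h v v = 0 → v = 0 := fun v hv hv0 => by
    have h1 : bilinB R l v v = 0 :=
      le_antisymm ((hBA v).trans (by rw [hv0, mul_zero])) ((isPsd_bilinB R).nonneg v)
    have h2 := ae_eq_zero_of_formB hR hl v.2 h1
    obtain ⟨-, p, -, hp⟩ := mem_polySub.1 hv
    rw [hp] at h2
    refine Subtype.ext (hp.trans ?_)
    rw [poly_eq_zero_of_ae h2]
    funext t; simp
  set S := ⨆ i, wnorm (jacobi ((s : ℤ) - 2) ((s : ℤ) - 2)) (weakDeriv s (u i)) ^ 2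
  have key := FirstPairs.galerkin_error (isPsd_bilinA h) (isPsd_bilinB R) hBA hK0
    (isCompactFor_bilin R hl h) (X := polySub N) le_top (isCompleteFor_bilinA hl h) hdef
    (firstPairs_of_isFirstEigenpairs h (fun _ hu => hu) 
      (fun v => ⟨fun _ => v.2, fun _ => Submodule.mem_top⟩) hu)
    (firstPairs_of_isFirstEigenpairs h (fun _ hu => hu.1) (fun _ => mem_polySub) huN)
    (z := fun i => edgeFun i) (fun i => edgeFun_mem (by omega))
    (fun a => edgeFun_sum_eq_zero hR hl a) hΛ
    (E := CA * (4 * (s : ℝ) ^ s * ((N : ℝ) ^ (2 * (s - 2)))⁻¹ * S)) fun i => by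
      obtain ⟨v, hv, hve⟩ := exists_XN_approx hs (hus i) (N := N) (by omega) hsN
      refine ⟨⟨v, hv.1⟩, mem_polySub.2 hv, ?_⟩
      have hd : v - u i ∈ H20 :=
        H20sub.sub_mem (show v ∈ H20sub from hv.1) (show u i ∈ H20sub from (hus i).1)
      refine (genForm_le h hd).trans (mul_le_mul_of_nonneg_left (hve.trans ?_) hCA0.le)
      rw [← wnorm_jacobi_sq hs]
      exact mul_le_mul_of_nonneg_left (le_ciSup (f := fun i =>
        wnorm (jacobi ((s : ℤ) - 2) ((s : ℤ) - 2)) (weakDeriv s (u i)) ^ 2)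
        (finite_range _).bddAbove i) (by positivity)
  refine key.trans (le_of_eq ?_)
  rw [show 2 * (2 - (s : ℤ)) = -((2 * (s - 2) : ℕ) : ℤ) by omega, zpow_neg, zpow_natCast]
  ring

end Conversion

/-! ### Admissibility of the coefficients -/

lemma exists_admissible_of_one_lt {n : ℝ → ℝ} (hn : AEMeasurable n volI) {α M : ℝ} (hα : 0 < α)
    (h : ∀ᵐ t ∂volI, 1 + α ≤ n t ∧ n t ≤ M) :
    ∃ a b, Admissible (fun t => 1 / (n t - 1)) (fun _ => 1) (fun _ => 1) a b := by
  obtain ⟨t, -, h1, h2⟩ := ae_volI_eventually one_mem_closure_I h univ_mem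
  have hM : 0 < M - 1 := by linarith
  refine ⟨min (1 / (M - 1)) 1, max (1 / α) 1, by positivity,
    ⟨((hn.sub_const 1).const_div 1).aestronglyMeasurable, ?_⟩,
    ⟨by fun_prop, .of_forall fun _ => by simp⟩,
    ⟨by fun_prop, .of_forall fun _ => by simp⟩, ?_, .of_forall fun _ => min_le_right _ _⟩
  · filter_upwards [h] with t ht
    rw [abs_of_pos (one_div_pos.2 (by linarith))]
    exact (one_div_le_one_div_of_le hα (by linarith)).trans (le_max_left _ _)
  · filter_upwards [h] with t ht
    exact (min_le_left _ _).trans (one_div_le_one_div_of_le (by linarith) (by linarith))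

lemma exists_admissible_of_lt_one {n : ℝ → ℝ} (hn : AEMeasurable n volI) {δ β : ℝ} (hδ : 0 < δ)
    (hβ : 0 < β) (h : ∀ᵐ t ∂volI, δ ≤ n t ∧ n t ≤ 1 - β) :
    ∃ a b, Admissible (fun t => 1 / (1 - n t)) n n a b := by
  have hn' : IsCoeff n (max (1 / β) 1) := ⟨hn.aestronglyMeasurable, by
    filter_upwards [h] with t ht
    rw [abs_of_pos (hδ.trans_le ht.1)]
    exact le_trans (by linarith) (le_max_right _ _)⟩
  refine ⟨min δ 1, max (1 / β) 1, by positivity,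
    ⟨((hn.const_sub 1).const_div 1).aestronglyMeasurable, ?_⟩, hn', hn', ?_, ?_⟩
  · filter_upwards [h] with t ht
    rw [abs_of_pos (one_div_pos.2 (by linarith))]
    exact (one_div_le_one_div_of_le hβ (by linarith)).trans (le_max_left _ _)
  · filter_upwards [h] with t ht
    refine (min_le_right _ _).trans ?_
    -- The lower bound 1 for 1/(1−n) comes from 0 < 1−n < 1.
    rw [le_div_iff₀ (by linarith)]
    linarith
  · filter_upwards [h] with t ht
    exact (min_le_left _ _).trans ht.1

end TEMode

/-! ### The eigenvalue error for the transmission problem -/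

theorem theorem5 (R : ℝ) (hR : 0 < R) (l : ℕ) (hl : 1 ≤ l) (τ : ℝ)
    (n : ℝ → ℝ) (hn : AEMeasurable n (volume.restrict TEMode.I))
    (a : (ℝ → ℝ) → (ℝ → ℝ) → ℝ)
    (ha :
      ((∃ α M : ℝ, 0 < α ∧ ∀ᵐ t ∂(volume.restrict TEMode.I), 1 + α ≤ n t ∧ n t ≤ M) ∧
          a = formA R l n τ) ∨
      ((∃ δ β : ℝ, 0 < δ ∧ 0 < β ∧
          ∀ᵐ t ∂(volume.restrict TEMode.I), δ ≤ n t ∧ n t ≤ 1 - β) ∧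
          a = formA' R l n τ))
    (m : ℕ) (hm : 1 ≤ m) (s : ℕ) (hs : 2 ≤ s) :
    ∃ C : ℝ, 0 < C ∧
      ∀ (lam : Fin m → ℝ) (u : Fin m → ℝ → ℝ),
        IsFirstEigenpairs H20 a (formB R l) m lam u → (∀ i, u i ∈ Hs s) →
      ∀ N : ℕ, m + 2 ≤ N → s ≤ N + 1 →
      ∀ (lamN : Fin m → ℝ) (uN : Fin m → ℝ → ℝ),
        IsFirstEigenpairs (XN N) a (formB R l) m lamN uN →
        (s ≤ 3 →
          |lamN ⟨m - 1, by omega⟩ - lam ⟨m - 1, by omega⟩| ≤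
            C * (N : ℝ) ^ (2 * (2 - (s : ℤ))) *
              ⨆ i : Fin m, (wnorm (jacobi ((s : ℤ) - 2) ((s : ℤ) - 2)) (weakDeriv s (u i))
                + wnorm (fun _ => 1) (weakDeriv 2 (u i))) ^ 2) ∧
        (3 < s →
          |lamN ⟨m - 1, by omega⟩ - lam ⟨m - 1, by omega⟩| ≤
            C * (N : ℝ) ^ (2 * (2 - (s : ℤ))) *
              ⨆ i : Fin m,
                wnorm (jacobi ((s : ℤ) - 2) ((s : ℤ) - 2)) (weakDeriv s (u i)) ^ 2) := by
  obtain ⟨q, rfl⟩ := Nat.exists_eq_add_of_le' hm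
  -- Both cases share the shape `genForm` with σ = R²τ/4: c = 1/(n−1), d = e = 1 in the first, and c
  -- = 1/(1−n), d = e = n in the second.
  obtain ⟨σ, c, d, e, κ, M, hadm, rfl⟩ : ∃ (σ : ℝ) (c d e : ℝ → ℝ) (κ M : ℝ)
      (_ : Admissible c d e κ M), a = genForm l σ c d e := by
    rcases ha with ⟨⟨α, M, hα, h⟩, rfl⟩ | ⟨⟨δ, β, hδ, hβ, h⟩, rfl⟩
    · obtain ⟨κ, M', hadm⟩ := exists_admissible_of_one_lt hn hα h
      exact ⟨_, _, _, _, κ, M', hadm, formA_eq_genForm R l n τ⟩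
    · obtain ⟨κ, M', hadm⟩ := exists_admissible_of_lt_one hn hδ hβ h
      exact ⟨_, _, _, _, κ, M', hadm, formA'_eq_genForm R l n τ⟩
  obtain ⟨C, hC0, hC⟩ := galerkin_error_le (σ := σ) hR hl hadm q hs
  refine ⟨C, hC0, fun lam u hu hus N hN hsN lamN uN huN => ?_⟩
  have key := hC lam u hu hus N hN hsN lamN uN huN
  refine ⟨fun _ => key.trans ?_, fun _ => key⟩
  -- The estimate without ‖∂²u‖ holds for every s ≥ 2; for s ≤ 3 the additional norm only enlarges
  -- the right side.
  refine mul_le_mul_of_nonneg_left (ciSup_mono (finite_range _).bddAbove fun i => ?_)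
    (by positivity)
  exact pow_le_pow_left₀ (Real.sqrt_nonneg _)
    (le_add_of_nonneg_right (Real.sqrt_nonneg _)) 2
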